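/- All graphs are finite and simple, and the spectrum of a graph is the multiset of eigenvalues (with multiplicities) of its adjacency matrix. Two graphs are cospectral if they have the same spectrum, and a graph is determined by its spectrum if every graph cospectral with it is isomorphic to it. Let $\mathcal G$ be the class of connected graphs that have one eigenvalue $r>1$, one eigenvalue $s<-1$ (each counted with multiplicity), and all other eigenvalues equal to $1$ or $-1$. Write $J$ for all-one matrices, $O$ for zero matrices, $I_n$ for the identity matrix of order $n$, $\mathbf 1$ for the all-one column vector, and $R_{2k}$ for the reverse identity matrix of order $2k$, which is the adjacency matrix of $kK_2$. A graph is of * type (ii), with parameters $a\ge1$, $k\ge2$, if (for a suitable ordering of the vertices) its adjacency matrix is $\begin{bmatrix}J-I_a&J\\J&R_{2k}\end{bmatrix}$; * type (iii), with parameters $\ell\ge m\ge2$, if its adjacency matrix is $\begin{bmatrix}R_{2\ell}&J\\J&R_{2m}\end{bmatrix}$; * type (iv), if its adjacency matrix is $\begin{bmatrix}O&N\\N^\top&O\end{bmatrix}$ with $N=\begin{bmatrix}1&\mathbf 1^\top\\\mathbf 1&I_4\end{bmatrix}$ or $N=\begin{bmatrix}J-I_3&J\\O&J-I_3\end{bmatrix}$;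 * type (vi), with parameters $(a,m)=(3,5)$ or $(4,4)$, if its adjacency matrix is $\begin{bmatrix}J-I_a&J&O\\J&O&J-I_m\\O&J-I_m&O\end{bmatrix}$. **Statement.** A graph $G\in\mathcal G$ is determined by its spectrum if and only if $G$ is none of the following: 1. of type (ii) with $(a,k)=(1,16)$ or $(a,k)=(2,7)$; 2. of type (ii) with $a=2$ and $k$ a composite number; 3. of type (iii) with parameters $\ell\ge m\ge 2$ such that $\ell m$ has a divisor $d$ with $m<d<\ell$; 4. of type (iv). Moreover, for every $k\ge1$, the friendship graph $F_k$ (consisting of $k$ edge-disjoint triangles that meet in one vertex) is determined by its spectrum if and only if $k\ne16$. Finally, the type (vi) graph $H$ with $(a,m)=(3,5)$ belongs to $\mathcal G$, and $F_{16}$ is cospectral with the disjoint union $H+10K_2$. -/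

import Mathlib

universe u v

/-- The (adjacency) spectrum of a finite graph: the multiset of eigenvalues of its real adjacency
matrix, with multiplicities, i.e. the roots of its characteristic polynomial. -/
noncomputable def adjSpectrum {V : Type u} [Fintype V] (G : SimpleGraph V) : Multiset ℝ := by
  classical
  exact (G.adjMatrix ℝ).charpoly.roots

/-- Two finite graphs are cospectral if their adjacency matrices have the same spectrum. -/
def Cospectral {V : Type u} {W : Type v} [Fintype V] [Fintype W]
    (G : SimpleGraph V) (H : SimpleGraph W) : Prop :=
  adjSpectrum G = adjSpectrum H

/-- `G` is determined by its spectrum: every finite graph cospectral with `G` is isomorphic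
to `G`. (Every finite graph is isomorphic to one on a vertex set in `Type`.) -/
def DeterminedBySpectrum {V : Type u} [Fintype V] (G : SimpleGraph V) : Prop :=
  ∀ (W : Type) [Fintype W] (H : SimpleGraph W), Cospectral G H → Nonempty (G ≃g H)

/-- The class `𝒢`: connected graphs with an eigenvalue `r > 1`, an eigenvalue `s < -1`, and all
other eigenvalues (counted with multiplicity) equal to `1` or `-1`. -/
def InClassG {V : Type u} [Fintype V] (G : SimpleGraph V) : Prop :=
  G.Connected ∧ ∃ (r s : ℝ) (M : Multiset ℝ), 1 < r ∧ s < -1 ∧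
    adjSpectrum G = r ::ₘ s ::ₘ M ∧ ∀ x ∈ M, x = 1 ∨ x = -1

/-- The graph whose adjacency matrix is `M`, for a symmetric `0`-`1` matrix `M` with zero diagonal:
distinct vertices `i`, `j` are adjacent when the `(i, j)` entry is `1`. -/
def graphOfMatrix {V : Type u} (M : Matrix V V ℤ) : SimpleGraph V :=
  SimpleGraph.fromRel fun i j => M i j = 1

/-- The all-one matrix `J`. -/
def allOnes (m : Type u) (n : Type v) : Matrix m n ℤ := Matrix.of fun _ _ => 1

/-- `J - I`, of order `n`. -/
def JsubI (n : ℕ) : Matrix (Fin n) (Fin n) ℤ := allOnes (Fin n) (Fin n) - 1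

/-- The reverse identity matrix `R_n` of order `n`; `R_{2k}` is the adjacency matrix of `k K_2`. -/
def reverseId (n : ℕ) : Matrix (Fin n) (Fin n) ℤ := Matrix.of fun i j => if j = i.rev then 1 else 0

/-- `k K_2`, the disjoint union of `k` edges. -/
def disjointEdges (k : ℕ) : SimpleGraph (Fin (2 * k)) := graphOfMatrix (reverseId (2 * k))

/-- Type (ii): adjacency matrix `[J - I_a, J; J, R_{2k}]`. -/
def typeII (a k : ℕ) : SimpleGraph (Fin a ⊕ Fin (2 * k)) :=
  graphOfMatrix (Matrix.fromBlocks (JsubI a) (allOnes _ _) (allOnes _ _) (reverseId (2 * k)))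

/-- Type (iii): adjacency matrix `[R_{2ℓ}, J; J, R_{2m}]`. -/
def typeIII (l m : ℕ) : SimpleGraph (Fin (2 * l) ⊕ Fin (2 * m)) :=
  graphOfMatrix
    (Matrix.fromBlocks (reverseId (2 * l)) (allOnes _ _) (allOnes _ _) (reverseId (2 * m)))

/-- The bipartite graph with adjacency matrix `[O, N; Nᵀ, O]`. -/
def bipartiteGraphOf {m : Type u} {n : Type v} (N : Matrix m n ℤ) : SimpleGraph (m ⊕ n) :=
  graphOfMatrix (Matrix.fromBlocks 0 N N.transpose 0)

/-- Type (iv), first graph: `N = [1, 𝟏ᵀ; 𝟏, I_4]`. -/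
def typeIVa : SimpleGraph ((Fin 1 ⊕ Fin 4) ⊕ (Fin 1 ⊕ Fin 4)) :=
  bipartiteGraphOf (Matrix.fromBlocks 1 (allOnes _ _) (allOnes _ _) 1)

/-- Type (iv), second graph: `N = [J - I_3, J; O, J - I_3]`. -/
def typeIVb : SimpleGraph ((Fin 3 ⊕ Fin 3) ⊕ (Fin 3 ⊕ Fin 3)) :=
  bipartiteGraphOf (Matrix.fromBlocks (JsubI 3) (allOnes _ _) 0 (JsubI 3))

/-- Type (vi): adjacency matrix `[J - I_a, J, O; J, O, J - I_m; O, J - I_m, O]`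
(the first two block rows and columns are grouped together). -/
def typeVI (a m : ℕ) : SimpleGraph ((Fin a ⊕ Fin m) ⊕ Fin m) :=
  graphOfMatrix
    (Matrix.fromBlocks
      (Matrix.fromBlocks (JsubI a) (allOnes _ _) (allOnes _ _) 0)
      (Matrix.fromRows 0 (JsubI m))
      (Matrix.fromCols 0 (JsubI m))
      0)

/-- The `i`-th triangle of the friendship graph; `none` is the common vertex. -/
def friendshipTriangle {k : ℕ} (i : Fin k) : Set (Option (Fin k × Bool)) :=
  {none, some (i, false), some (i, true)}

/-- The friendship graph `F_k`: `k` edge-disjoint triangles meeting in one vertex. -/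
def friendshipGraph (k : ℕ) : SimpleGraph (Option (Fin k × Bool)) :=
  SimpleGraph.fromRel fun x y => ∃ i : Fin k, x ∈ friendshipTriangle i ∧ y ∈ friendshipTriangle i

/-!
Call the eigenvalues `r > 1` and `s < -1` of a graph in the class `𝒢` its main eigenvalues. All
other eigenvalues of the adjacency matrix `A` are `± 1`, so `A² - 1` has rank two and is positive
semidefinite: it is the Gram matrix of vectors in the plane, one for each vertex, whose coordinates
are given by eigenvectors for `r` and `s` (`HasSpectralType.exists_gram`, `IsPlanarGram`). Inner
products of these vectors count common neighbours, and a linear relation `f` between them satisfies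
`A² f = f`, hence `‖(A + 1) f‖² = 2 ⟨f, (A + 1) f⟩`. Any three vectors are linearly dependent, and
this identity for their relation has two consequences. Every triangle contains two twins, that is,
vertices with the same closed neighbourhood (`IsPlanarGram.twin_of_triangle`). Moreover, the
vectors of all neighbours of a vertex `v`, other than its twins, lie on one side of the vector of
`v` (`IsPlanarGram.det_mul_det_pos`); that side splits the vertices into two classes. It follows
that a connected graph in question arises from a bipartite graph by replacing vertices by cliques
(`IsPlanarGram.exists_isCliqueBlowup`).

Now the geometry of the plane determines the graph (`IsCliqueBlowup.exists_shape`). If the two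
sides are completely joined, the vanishing of Gram determinants of three vectors restricts the
orders of the cliques (`IsCliqueBlowup.side_cases`, `IsCliqueBlowup.vertex_and_clique`), and leaves
the types (ii) and (iii) and three sporadic graphs. Otherwise there are two perpendicular vectors
from different sides, and in the orthogonal basis that they form every vector but those of one
clique lies on an axis (`IsCliqueBlowup.of_not_complete`). A count of flags then yields a complete
bipartite graph with a perfect matching removed, or a graph of type (iv) or (vi). The list is
encoded by `Shape`.

A graph of unspecified connectivity with a spectrum of this kind carries both main eigenvectors on
one component, which is in the list (`HasSpectralType.exists_shape`). Its spectrum is determined by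
the number of vertices and the sum and the product of the main eigenvalues, since the trace of `A`
is zero (`HasSpectralType.cospectral`). So `G` in the list is determined by its spectrum as soon as
no other listed graph with at most as many vertices has the same sum and product, which is an
arithmetical matter (`Shape.eq_of_tr_eq`); and when there is a smaller one, adding single edges to
it gives a cospectral mate (`Shape.Rep.not_determinedBySpectrum`). The friendship graph `F_k` with
`k ≥ 2` is the graph of type (ii) with `a = 1`; the triangle `F_1` does not have an eigenvalue
below `-1` and is treated by counting vertices and edges.
-/

open scoped Matrix

/-! ### Spectra of graphs -/

section Spectrum

variable {V : Type*} {W : Type*} [Fintype V] [Fintype W]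

theorem adjSpectrum_eq_roots [DecidableEq V] (G : SimpleGraph V) [DecidableRel G.Adj] :
    adjSpectrum G = (G.adjMatrix ℝ).charpoly.roots := by
  unfold adjSpectrum
  congr!

theorem adjSpectrum_congr {G : SimpleGraph V} {H : SimpleGraph W} (e : G ≃g H) :
    adjSpectrum G = adjSpectrum H := by
  classical
  have h : H.adjMatrix ℝ = Matrix.reindex e.toEquiv e.toEquiv (G.adjMatrix ℝ) := by
    ext i j
    have := e.symm.map_adj_iff (v := i) (w := j)
    simp only [SimpleGraph.adjMatrix_apply, Matrix.reindex_apply, Matrix.submatrix_apply]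
    exact if_congr this.symm rfl rfl
  rw [adjSpectrum_eq_roots, adjSpectrum_eq_roots, h, Matrix.charpoly_reindex]

theorem adjSpectrum_sum (G : SimpleGraph V) (H : SimpleGraph W) :
    adjSpectrum (G ⊕g H) = adjSpectrum G + adjSpectrum H := by
  classical
  have h : (G ⊕g H).adjMatrix ℝ = Matrix.fromBlocks (G.adjMatrix ℝ) 0 0 (H.adjMatrix ℝ) := by
    ext i j
    rcases i with i | i <;> rcases j with j | j <;> simp [SimpleGraph.adjMatrix_apply]
  rw [adjSpectrum_eq_roots, adjSpectrum_eq_roots, adjSpectrum_eq_roots, h,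
    Matrix.charpoly_fromBlocks_zero₁₂, Polynomial.roots_mul]
  exact mul_ne_zero (Matrix.charpoly_monic _).ne_zero (Matrix.charpoly_monic _).ne_zero

omit [Fintype V] in
theorem isHermitian_adjMatrix (G : SimpleGraph V) [DecidableRel G.Adj] :
    (G.adjMatrix ℝ).IsHermitian := by
  rw [Matrix.IsHermitian, Matrix.conjTranspose_eq_transpose_of_trivial, G.transpose_adjMatrix]

/-- The spectral theorem for a graph: the rows of an orthogonal matrix `U` are eigenvectors of the
adjacency matrix, and the corresponding eigenvalues form the spectrum. -/
theorem exists_orthogonal_eigenvectors [DecidableEq V] (G : SimpleGraph V) [DecidableRel G.Adj] :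
    ∃ (U : Matrix V V ℝ) (l : V → ℝ), U * Uᵀ = 1 ∧ Uᵀ * U = 1 ∧
      (∀ k, G.adjMatrix ℝ *ᵥ U k = l k • U k) ∧ adjSpectrum G = Finset.univ.val.map l := by
  have hA := isHermitian_adjMatrix G
  have hU : (Matrix.of fun k i => hA.eigenvectorBasis k i) *
      (Matrix.of fun k i => hA.eigenvectorBasis k i)ᵀ = (1 : Matrix V V ℝ) := by
    ext k l
    have := orthonormal_iff_ite.mp hA.eigenvectorBasis.orthonormal l k
    simp only [PiLp.inner_apply, RCLike.inner_apply, conj_trivial] at this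
    simp only [Matrix.mul_apply, Matrix.of_apply, Matrix.transpose_apply, Matrix.one_apply]
    rw [this]
    simp [eq_comm]
  refine ⟨_, hA.eigenvalues, hU, mul_eq_one_comm.mp hU, fun k => hA.mulVec_eigenvectorBasis k, ?_⟩
  rw [adjSpectrum_eq_roots, hA.roots_charpoly_eq_eigenvalues]
  rfl

theorem card_adjSpectrum (G : SimpleGraph V) : (adjSpectrum G).card = Fintype.card V := by
  classical
  obtain ⟨U, l, -, -, -, h⟩ := exists_orthogonal_eigenvectors G
  simp [h]

theorem sum_adjSpectrum (G : SimpleGraph V) : (adjSpectrum G).sum = 0 := by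
  classical
  rw [adjSpectrum_eq_roots,
    ← Matrix.trace_eq_sum_roots_charpoly_of_splits (isHermitian_adjMatrix G).splits_charpoly]
  simp

/-- An eigenvalue of the adjacency matrix belongs to the spectrum. -/
theorem mem_adjSpectrum_of_mulVec_eq [DecidableEq V] {G : SimpleGraph V} [DecidableRel G.Adj]
    {f : V → ℝ} {x : ℝ} (hf : f ≠ 0) (h : G.adjMatrix ℝ *ᵥ f = x • f) : x ∈ adjSpectrum G := by
  rw [adjSpectrum_eq_roots, Polynomial.mem_roots (Matrix.charpoly_monic _).ne_zero,
    Polynomial.IsRoot, Matrix.eval_charpoly, ← Matrix.exists_mulVec_eq_zero_iff]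
  refine ⟨f, hf, ?_⟩
  rw [Matrix.sub_mulVec, h, Matrix.scalar_apply, ← Matrix.smul_one_eq_diagonal,
    Matrix.smul_mulVec, Matrix.one_mulVec, sub_self]

/-- The spectrum of `G` consists of `r > 1` and `s < -1`, with sum `τ` and product `ρ`, and of
further eigenvalues `± 1`. The graph need not be connected. -/
def HasSpectralType (G : SimpleGraph V) (τ ρ : ℝ) : Prop :=
  ∃ (r s : ℝ) (M : Multiset ℝ), 1 < r ∧ s < -1 ∧ r + s = τ ∧ r * s = ρ ∧
    adjSpectrum G = r ::ₘ s ::ₘ M ∧ ∀ x ∈ M, x = 1 ∨ x = -1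

theorem HasSpectralType.of_cospectral {G : SimpleGraph V} {H : SimpleGraph W} {τ ρ : ℝ}
    (h : Cospectral G H) (hG : HasSpectralType G τ ρ) : HasSpectralType H τ ρ := by
  obtain ⟨r, s, M, h1, h2, h3, h4, h5, h6⟩ := hG
  exact ⟨r, s, M, h1, h2, h3, h4, h ▸ h5, h6⟩

/-- Two numbers `r > 1` and `s < -1` are determined by their sum and product. -/
theorem eq_and_eq_of_add_eq_of_mul_eq {r s r' s' : ℝ} (h1 : 1 < r) (h2 : s < -1) (_ : 1 < r')
    (h2' : s' < -1) (ha : r + s = r' + s') (hm : r * s = r' * s') : r = r' ∧ s = s' := by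
  have h : (r - r') * (r - s') = 0 := by
    have : s = r' + s' - r := by linarith
    subst this
    linarith
  have hr : r - r' = 0 := (mul_eq_zero.mp h).resolve_right (by linarith)
  constructor <;> linarith

/-- A multiset of numbers `± 1` is determined by its cardinality and its sum. -/
theorem multiset_eq_of_card_eq_of_sum_eq {M N : Multiset ℝ} (hM : ∀ x ∈ M, x = 1 ∨ x = -1)
    (hN : ∀ x ∈ N, x = 1 ∨ x = -1) (hc : M.card = N.card) (hs : M.sum = N.sum) : M = N := by
  have key : ∀ K : Multiset ℝ, (∀ x ∈ K, x = 1 ∨ x = -1) → ∃ a b : ℕ,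
      K = Multiset.replicate a 1 + Multiset.replicate b (-1) := by
    intro K
    induction K using Multiset.induction_on with
    | empty => exact fun _ => ⟨0, 0, by simp⟩
    | cons x K ih =>
      intro h
      obtain ⟨a, b, hab⟩ := ih fun y hy => h y (Multiset.mem_cons_of_mem hy)
      rcases h x (Multiset.mem_cons_self x K) with rfl | rfl
      · exact ⟨a + 1, b, by rw [hab, Multiset.replicate_succ, Multiset.cons_add]⟩
      · exact ⟨a, b + 1, by rw [hab, Multiset.replicate_succ, Multiset.add_cons]⟩
  obtain ⟨a, b, rfl⟩ := key M hM
  obtain ⟨c, d, rfl⟩ := key N hN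
  simp only [Multiset.card_add, Multiset.card_replicate, Multiset.sum_add,
    Multiset.sum_replicate, nsmul_eq_mul] at hc hs
  have hc' : (a : ℝ) + b = c + d := by exact_mod_cast hc
  have h1 : a = c := by
    have : (a : ℝ) = c := by linarith
    exact_mod_cast this
  have h2 : b = d := by omega
  rw [h1, h2]

/-- The number of vertices and the trace, which is zero, determine the multiplicities of `1` and
`-1`. -/
theorem HasSpectralType.cospectral {G : SimpleGraph V} {H : SimpleGraph W} {τ ρ : ℝ}
    (hG : HasSpectralType G τ ρ) (hH : HasSpectralType H τ ρ)
    (hc : Fintype.card V = Fintype.card W) : Cospectral G H := by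
  obtain ⟨r, s, M, h1, h2, h3, h4, h5, h6⟩ := hG
  obtain ⟨r', s', M', h1', h2', h3', h4', h5', h6'⟩ := hH
  obtain ⟨rfl, rfl⟩ := eq_and_eq_of_add_eq_of_mul_eq h1 h2 h1' h2' (by rw [h3, h3'])
    (by rw [h4, h4'])
  have hM : M = M' := by
    refine multiset_eq_of_card_eq_of_sum_eq h6 h6' ?_ ?_
    · have := card_adjSpectrum G
      have := card_adjSpectrum H
      simp only [h5, h5', Multiset.card_cons] at *
      omega
    · have := sum_adjSpectrum G
      have := sum_adjSpectrum H
      simp only [h5, h5', Multiset.sum_cons] at *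
      linarith
  rw [Cospectral, h5, h5', hM]

/-- The parameters are determined by any two eigenvalues outside `[-1, 1]` of opposite sign. -/
theorem HasSpectralType.add_mul_eq {G : SimpleGraph V} {τ ρ : ℝ} (hG : HasSpectralType G τ ρ)
    {r s : ℝ} (hr : 1 < r) (hs : s < -1) (hrG : r ∈ adjSpectrum G) (hsG : s ∈ adjSpectrum G) :
    r + s = τ ∧ r * s = ρ := by
  obtain ⟨r', s', M, h1, h2, h3, h4, h5, h6⟩ := hG
  rw [h5, Multiset.mem_cons, Multiset.mem_cons] at hrG hsG
  have h : r = r' := by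
    rcases hrG with h | h | h
    · exact h
    · linarith
    · rcases h6 _ h with h | h <;> linarith
  have h' : s = s' := by
    rcases hsG with h | h | h
    · linarith
    · exact h
    · rcases h6 _ h with h | h <;> linarith
  subst h h'
  exact ⟨h3, h4⟩

/-- Adding a graph all of whose eigenvalues are `± 1` does not change the spectral type. -/
theorem HasSpectralType.sum {G : SimpleGraph V} {H : SimpleGraph W} {τ ρ : ℝ}
    (hG : HasSpectralType G τ ρ) (hH : ∀ x ∈ adjSpectrum H, x = 1 ∨ x = -1) :
    HasSpectralType (G ⊕g H) τ ρ := by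
  obtain ⟨r, s, M, h1, h2, h3, h4, h5, h6⟩ := hG
  refine ⟨r, s, M + adjSpectrum H, h1, h2, h3, h4, ?_, ?_⟩
  · rw [adjSpectrum_sum, h5, Multiset.cons_add, Multiset.cons_add]
  · intro x hx
    rcases Multiset.mem_add.mp hx with h | h
    exacts [h6 x h, hH x h]

/-- If `A² = 1` then all eigenvalues are `± 1`. -/
theorem adjSpectrum_eq_one_or_of_sq [DecidableEq V] (G : SimpleGraph V) [DecidableRel G.Adj]
    (h : G.adjMatrix ℝ * G.adjMatrix ℝ = 1) : ∀ x ∈ adjSpectrum G, x = 1 ∨ x = -1 := by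
  obtain ⟨U, l, hU, -, hl, hs⟩ := exists_orthogonal_eigenvectors G
  intro x hx
  rw [hs, Multiset.mem_map] at hx
  obtain ⟨k, -, rfl⟩ := hx
  have h2 : (G.adjMatrix ℝ * G.adjMatrix ℝ) *ᵥ U k = (l k * l k) • U k := by
    rw [← Matrix.mulVec_mulVec, hl, Matrix.mulVec_smul, hl, smul_smul]
  have hk : U k ⬝ᵥ U k = 1 := by
    have := congrFun (congrFun hU k) k
    rwa [Matrix.one_apply_eq] at this
  rw [h, Matrix.one_mulVec] at h2
  have h3 : U k ⬝ᵥ U k = U k ⬝ᵥ ((l k * l k) • U k) := congrArg (U k ⬝ᵥ ·) h2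
  rw [dotProduct_smul, hk, smul_eq_mul, mul_one] at h3
  exact mul_self_eq_one_iff.mp h3.symm

end Spectrum

/-! ### The matrix `A² - 1` of a graph with two main eigenvalues -/

section Gram

variable {V : Type*} [Fintype V]

theorem exists_ne_of_map_eq_cons_cons {l : V → ℝ} {r s : ℝ} {M : Multiset ℝ}
    (h : Finset.univ.val.map l = r ::ₘ s ::ₘ M) :
    ∃ i j, i ≠ j ∧ l i = r ∧ l j = s ∧ ∀ k, k ≠ i → k ≠ j → l k ∈ M := by
  classical
  rw [← Multiset.map_eq_cons] at h
  obtain ⟨i, -, hi, h⟩ := h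
  rw [← Multiset.map_eq_cons] at h
  obtain ⟨j, hj, hj', h⟩ := h
  have hn : (Finset.univ : Finset V).val.Nodup := Finset.univ.nodup
  refine ⟨i, j, ?_, hi, hj', fun k hki hkj => ?_⟩
  · rintro rfl
    exact hn.notMem_erase hj
  · rw [← h]
    refine Multiset.mem_map_of_mem l ?_
    rw [Multiset.mem_erase_of_ne hkj, Multiset.mem_erase_of_ne hki]
    exact Finset.mem_univ_val k

/-- Since all eigenvalues but `r` and `s` are `± 1`, the matrix `A² - 1` is the Gram matrix of the
planar vectors `(p i, q i)`, where `p` and `q` are eigenvectors for `r` and `s`. -/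
theorem HasSpectralType.exists_gram [DecidableEq V] {G : SimpleGraph V} [DecidableRel G.Adj]
    {τ ρ : ℝ} (h : HasSpectralType G τ ρ) :
    ∃ (r s : ℝ) (p q : V → ℝ), 1 < r ∧ s < -1 ∧ r + s = τ ∧ r * s = ρ ∧
      G.adjMatrix ℝ *ᵥ p = r • p ∧ G.adjMatrix ℝ *ᵥ q = s • q ∧ p ≠ 0 ∧ q ≠ 0 ∧
      ∀ i j, (G.adjMatrix ℝ * G.adjMatrix ℝ) i j - (1 : Matrix V V ℝ) i j
        = p i * p j + q i * q j := by
  obtain ⟨r, s, M, h1, h2, h3, h4, h5, h6⟩ := h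
  obtain ⟨U, l, hU, hU', hl, hs⟩ := exists_orthogonal_eigenvectors G
  obtain ⟨k₁, k₂, hne, hk₁, hk₂, hk⟩ := exists_ne_of_map_eq_cons_cons (hs.symm.trans h5)
  have hr : 0 < r ^ 2 - 1 := by nlinarith
  have hs : 0 < s ^ 2 - 1 := by nlinarith
  have hU0 : ∀ k, U k ≠ 0 := by
    intro k h0
    have := congrFun (congrFun hU k) k
    rw [Matrix.one_apply_eq, Matrix.mul_apply] at this
    simp [h0] at this
  have hAU : G.adjMatrix ℝ * Uᵀ = Uᵀ * Matrix.diagonal l := by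
    ext i k
    rw [Matrix.mul_diagonal]
    have := congrFun (hl k) i
    simpa [Matrix.mul_apply, Matrix.mulVec, dotProduct, mul_comm] using this
  have hAA : G.adjMatrix ℝ * G.adjMatrix ℝ - 1
      = Uᵀ * Matrix.diagonal (fun k => l k ^ 2 - 1) * U := by
    have : G.adjMatrix ℝ * G.adjMatrix ℝ
        = Uᵀ * (Matrix.diagonal l * Matrix.diagonal l) * U := by
      calc G.adjMatrix ℝ * G.adjMatrix ℝ
          = G.adjMatrix ℝ * (G.adjMatrix ℝ * Uᵀ) * U := by
            rw [Matrix.mul_assoc, Matrix.mul_assoc, hU', Matrix.mul_one]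
        _ = _ := by
            rw [hAU, ← Matrix.mul_assoc, hAU, Matrix.mul_assoc Uᵀ]
    rw [this]
    nth_rewrite 1 [← hU']
    rw [Matrix.diagonal_mul_diagonal, ← sub_eq_zero]
    have e : (Matrix.diagonal fun k => l k ^ 2 - 1)
        = (Matrix.diagonal fun k => l k * l k) - (1 : Matrix V V ℝ) := by
      rw [← Matrix.diagonal_one, Matrix.diagonal_sub]
      simp [sq]
    rw [e, Matrix.mul_sub, Matrix.sub_mul, Matrix.mul_one]
    exact sub_self _
  refine ⟨r, s, √(r ^ 2 - 1) • U k₁, √(s ^ 2 - 1) • U k₂, h1, h2, h3, h4, ?_, ?_, ?_, ?_, ?_⟩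
  · rw [Matrix.mulVec_smul, hl, hk₁, smul_comm]
  · rw [Matrix.mulVec_smul, hl, hk₂, smul_comm]
  · exact smul_ne_zero (Real.sqrt_ne_zero'.mpr hr) (hU0 _)
  · exact smul_ne_zero (Real.sqrt_ne_zero'.mpr hs) (hU0 _)
  · intro i j
    rw [← Matrix.sub_apply, hAA, Matrix.mul_apply, Finset.sum_eq_add k₁ k₂ hne]
    · have e1 := Real.mul_self_sqrt hr.le
      have e2 := Real.mul_self_sqrt hs.le
      simp only [Matrix.mul_diagonal, Matrix.transpose_apply, Pi.smul_apply, smul_eq_mul, hk₁, hk₂]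
      linear_combination (-U k₁ i * U k₁ j) * e1 - U k₂ i * U k₂ j * e2
    · intro k _ ⟨h, h'⟩
      have : l k ^ 2 - 1 = 0 := by rcases h6 _ (hk k h h') with h | h <;> rw [h] <;> norm_num
      rw [Matrix.mul_diagonal, this, mul_zero, zero_mul]
    · exact fun h => absurd (Finset.mem_univ _) h
    · exact fun h => absurd (Finset.mem_univ _) h

/-- Recognition of the spectral type: it suffices that the image of `A² - 1` lies in the
`A`-invariant plane spanned by `f` and `g`; then `τ` and `ρ` are the trace and the determinant of
`A` on that plane. -/
theorem hasSpectralType_of_plane [DecidableEq V] {G : SimpleGraph V} [DecidableRel G.Adj]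
    {f g : V → ℝ} {a b c d α β γ τ ρ : ℝ}
    (hf : G.adjMatrix ℝ *ᵥ f = a • f + b • g) (hg : G.adjMatrix ℝ *ᵥ g = c • f + d • g)
    (hτ : a + d = τ) (hρ : a * d - b * c = ρ) (h1 : ρ < -1 - τ) (h2 : ρ < -1 + τ)
    (hfg : ∃ i j, f i * g j - f j * g i ≠ 0)
    (hB : ∀ i j, (G.adjMatrix ℝ * G.adjMatrix ℝ) i j - (1 : Matrix V V ℝ) i j
      = f i * (α * f j + β * g j) + g i * (β * f j + γ * g j)) :
    HasSpectralType G τ ρ := by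
  obtain ⟨U, l, hU, hU', hl, hs⟩ := exists_orthogonal_eigenvectors G
  have hli : ∀ x y : ℝ, x • f + y • g = 0 → x = 0 ∧ y = 0 := by
    intro x y hxy
    obtain ⟨i, j, hij⟩ := hfg
    have hi := congrFun hxy i
    have hj := congrFun hxy j
    simp only [Pi.add_apply, Pi.smul_apply, smul_eq_mul, Pi.zero_apply] at hi hj
    constructor
    · apply (mul_eq_zero.mp (_ : x * (f i * g j - f j * g i) = 0)).resolve_right hij
      linear_combination g j * hi - g i * hj
    · apply (mul_eq_zero.mp (_ : y * (f i * g j - f j * g i) = 0)).resolve_right hij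
      linear_combination f i * hj - f j * hi
  -- every root of the characteristic polynomial on the plane is an eigenvalue of the graph
  have hroot : ∀ t : ℝ, t * t - τ * t + ρ = 0 → t ∈ adjSpectrum G := by
    intro t ht
    obtain ⟨x, y, hxy, e1, e2⟩ : ∃ x y : ℝ, ¬ (x = 0 ∧ y = 0) ∧ a * x + c * y = t * x ∧
        b * x + d * y = t * y := by
      by_cases h0 : c = 0 ∧ t = a
      · obtain ⟨rfl, rfl⟩ := h0
        by_cases h0' : t - d = 0 ∧ b = 0
        · exact ⟨1, 0, by simp, by ring, by rw [h0'.2]; ring⟩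
        · exact ⟨t - d, b, h0', by ring, by ring⟩
      · refine ⟨c, t - a, fun h => h0 ⟨h.1, by linarith [h.2]⟩, by ring, ?_⟩
        rw [← hτ, ← hρ] at ht
        linear_combination -ht
    refine mem_adjSpectrum_of_mulVec_eq (f := x • f + y • g) (fun h0 => hxy (hli x y h0)) ?_
    rw [Matrix.mulVec_add, Matrix.mulVec_smul, Matrix.mulVec_smul, hf, hg]
    ext i
    simp only [Pi.add_apply, Pi.smul_apply, smul_eq_mul]
    linear_combination f i * e1 + g i * e2
  have hdisc : 0 ≤ τ ^ 2 - 4 * ρ := by nlinarith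
  set D := √(τ ^ 2 - 4 * ρ) with hD
  have hDD : D * D = τ ^ 2 - 4 * ρ := Real.mul_self_sqrt hdisc
  have hD0 : 0 ≤ D := Real.sqrt_nonneg _
  have hr1 : 1 < (τ + D) / 2 := by
    by_contra hcon
    nlinarith
  have hs1 : (τ - D) / 2 < -1 := by
    by_contra hcon
    nlinarith
  have hr := hroot ((τ + D) / 2) (by linear_combination hDD / 4)
  have hs' := hroot ((τ - D) / 2) (by linear_combination hDD / 4)
  rw [hs, Multiset.mem_map] at hr hs'
  obtain ⟨k₁, -, hk₁⟩ := hr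
  obtain ⟨k₂, -, hk₂⟩ := hs'
  have hne : k₁ ≠ k₂ := by
    rintro rfl
    linarith
  have hdot : ∀ k m, U k ⬝ᵥ U m = if k = m then 1 else 0 := by
    intro k m
    have := congrFun (congrFun hU k) m
    rwa [Matrix.one_apply] at this
  have hplane : ∀ k, l k * l k ≠ 1 → ∃ x y : ℝ, U k = x • f + y • g := by
    intro k hk
    have e : (G.adjMatrix ℝ * G.adjMatrix ℝ) *ᵥ U k = (l k * l k) • U k := by
      rw [← Matrix.mulVec_mulVec, hl, Matrix.mulVec_smul, hl, smul_smul]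
    have hc : l k * l k - 1 ≠ 0 := sub_ne_zero.mpr hk
    refine ⟨(l k * l k - 1)⁻¹ * ∑ j, (α * f j + β * g j) * U k j,
      (l k * l k - 1)⁻¹ * ∑ j, (β * f j + γ * g j) * U k j, ?_⟩
    ext i
    have e1 : (l k * l k - 1) * U k i
        = ∑ j, ((G.adjMatrix ℝ * G.adjMatrix ℝ) i j - (1 : Matrix V V ℝ) i j) * U k j := by
      have e2 := congrFun e i
      have e3 := congrFun (Matrix.one_mulVec (U k)) i
      simp only [Matrix.mulVec, dotProduct, Pi.smul_apply, smul_eq_mul] at e2 e3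
      simp only [mul_assoc, sub_mul, Finset.sum_sub_distrib]
      rw [e2, e3]
      ring
    have e4 : (l k * l k - 1) * U k i = f i * (∑ j, (α * f j + β * g j) * U k j)
        + g i * ∑ j, (β * f j + γ * g j) * U k j := by
      rw [e1, Finset.mul_sum, Finset.mul_sum, ← Finset.sum_add_distrib]
      refine Finset.sum_congr rfl fun j _ => ?_
      rw [hB]
      ring
    simp only [Pi.add_apply, Pi.smul_apply, smul_eq_mul]
    linear_combination (l k * l k - 1)⁻¹ * e4 - U k i * mul_inv_cancel₀ hc
  have hrest : ∀ k, k ≠ k₁ → k ≠ k₂ → l k = 1 ∨ l k = -1 := by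
    intro k hkk₁ hkk₂
    by_contra hcon
    have hk : l k * l k ≠ 1 := fun h => hcon (mul_self_eq_one_iff.mp h)
    obtain ⟨x₁, y₁, e₁⟩ := hplane k₁ (by rw [hk₁]; nlinarith)
    obtain ⟨x₂, y₂, e₂⟩ := hplane k₂ (by rw [hk₂]; nlinarith)
    obtain ⟨x₃, y₃, e₃⟩ := hplane k hk
    -- three orthonormal vectors in a plane
    have hrel : (x₂ * y₃ - x₃ * y₂) • U k₁ + (x₃ * y₁ - x₁ * y₃) • U k₂
        + (x₁ * y₂ - x₂ * y₁) • U k = 0 := by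
      rw [e₁, e₂, e₃]
      ext i
      simp only [Pi.add_apply, Pi.smul_apply, smul_eq_mul, Pi.zero_apply]
      ring
    have d3 := congrArg (U k ⬝ᵥ ·) hrel
    simp only [dotProduct_add, dotProduct_smul, hdot, hkk₁, hkk₂, if_true, if_false, smul_eq_mul,
      dotProduct_zero, mul_zero, mul_one, zero_add] at d3
    have hx : x₂ • U k₁ - x₁ • U k₂ = 0 := by
      rw [e₁, e₂]
      ext i
      simp only [Pi.add_apply, Pi.sub_apply, Pi.smul_apply, smul_eq_mul, Pi.zero_apply]
      linear_combination -g i * d3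
    have hy : y₂ • U k₁ - y₁ • U k₂ = 0 := by
      rw [e₁, e₂]
      ext i
      simp only [Pi.add_apply, Pi.sub_apply, Pi.smul_apply, smul_eq_mul, Pi.zero_apply]
      linear_combination f i * d3
    have hx' := congrArg (U k₂ ⬝ᵥ ·) hx
    have hy' := congrArg (U k₂ ⬝ᵥ ·) hy
    simp only [dotProduct_sub, dotProduct_smul, hdot, hne.symm, if_true, if_false, smul_eq_mul,
      dotProduct_zero, mul_zero, mul_one, zero_sub, neg_eq_zero] at hx' hy'
    have h11 := hdot k₁ k₁
    rw [e₁, hx', hy'] at h11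
    simp at h11
  refine ⟨(τ + D) / 2, (τ - D) / 2, ((Finset.univ.val.erase k₁).erase k₂).map l, hr1, hs1,
    by ring, by linear_combination -hDD / 4, ?_, ?_⟩
  · rw [hs, ← hk₁, ← hk₂, ← Multiset.map_cons, ← Multiset.map_cons,
      Multiset.cons_erase ((Multiset.mem_erase_of_ne hne.symm).mpr (Finset.mem_univ_val _)),
      Multiset.cons_erase (Finset.mem_univ_val _)]
  · intro x hx
    obtain ⟨k, hk, rfl⟩ := Multiset.mem_map.mp hx
    have hn : (Finset.univ : Finset V).val.Nodup := Finset.univ.nodup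
    rw [(hn.erase k₁).mem_erase_iff, hn.mem_erase_iff] at hk
    exact hrest k hk.2.1 hk.1

end Gram

/-! ### Planar Gram representations -/

section Planar

open scoped Classical

variable {V : Type*} [Fintype V]

/-- The number of common neighbours of `i` and `j`; for `i = j` this is the degree. -/
noncomputable def common (G : SimpleGraph V) (i j : V) : ℕ :=
  (Finset.univ.filter fun z => G.Adj i z ∧ G.Adj j z).card

/-- The inner product of the planar vectors `(p i, q i)` and `(p j, q j)`. -/
def planarInner (p q : V → ℝ) (i j : V) : ℝ := p i * p j + q i * q j

/-- The determinant of the planar vectors `(p i, q i)` and `(p j, q j)`. -/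
def planarDet (p q : V → ℝ) (i j : V) : ℝ := p i * q j - q i * p j

/-- The planar vectors `(p i, q i)` are nonzero and have Gram matrix `A² - 1`, where `A` is the
adjacency matrix of `G`. -/
structure IsPlanarGram (G : SimpleGraph V) (p q : V → ℝ) : Prop where
  gram : ∀ i j, (common G i j : ℝ) - (if i = j then 1 else 0) = planarInner p q i j
  pos : ∀ i, 0 < planarInner p q i i

/-- Two vertices are twins if they have the same closed neighbourhood. Distinct twins are
adjacent. -/
def Twin (G : SimpleGraph V) (u v : V) : Prop :=
  ∀ z, (z = u ∨ G.Adj u z) ↔ (z = v ∨ G.Adj v z)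

omit [Fintype V] in
theorem Twin.refl (G : SimpleGraph V) (u : V) : Twin G u u := fun _ => Iff.rfl

omit [Fintype V] in
theorem Twin.symm {G : SimpleGraph V} {u v : V} (h : Twin G u v) : Twin G v u :=
  fun z => (h z).symm

omit [Fintype V] in
theorem Twin.trans {G : SimpleGraph V} {u v w : V} (h : Twin G u v) (h' : Twin G v w) :
    Twin G u w := fun z => (h z).trans (h' z)

omit [Fintype V] in
theorem Twin.adj {G : SimpleGraph V} {u v : V} (h : Twin G u v) (hne : u ≠ v) : G.Adj u v :=
  ((h v).mpr (Or.inl rfl)).resolve_left hne.symm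

omit [Fintype V] in
theorem Twin.adj_iff {G : SimpleGraph V} {u v z : V} (h : Twin G u v) (hu : z ≠ u) (hv : z ≠ v) :
    G.Adj u z ↔ G.Adj v z := by
  have := h z
  simpa [hu, hv] using this

theorem common_comm (G : SimpleGraph V) (i j : V) : common G i j = common G j i := by
  unfold common
  simp_rw [and_comm]

theorem adjMatrix_mul_self_apply (G : SimpleGraph V) (i j : V) :
    (G.adjMatrix ℝ * G.adjMatrix ℝ) i j = common G i j := by
  rw [Matrix.mul_apply, common, Finset.card_filter]
  push_cast
  refine Finset.sum_congr rfl fun z _ => ?_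
  rw [SimpleGraph.adjMatrix_apply, SimpleGraph.adjMatrix_apply, SimpleGraph.adj_comm G z j,
    ite_zero_mul_ite_zero, mul_one]

theorem common_le_left (G : SimpleGraph V) (i j : V) : common G i j ≤ common G i i := by
  apply Finset.card_le_card
  intro z
  simp +contextual

/-- If all neighbours of `i` are counted as common neighbours with `j`, they are neighbours of `j`.
-/
theorem adj_of_common_eq {G : SimpleGraph V} {i j : V} (h : common G i j = common G i i) {z : V}
    (hz : G.Adj i z) : G.Adj j z := by
  have hsub : (Finset.univ.filter fun z => G.Adj i z ∧ G.Adj j z) ⊆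
      Finset.univ.filter fun z => G.Adj i z ∧ G.Adj i z := by
    intro z
    simp +contextual
  have heq := Finset.eq_of_subset_of_card_le hsub (le_of_eq h.symm)
  have : z ∈ Finset.univ.filter fun z => G.Adj i z ∧ G.Adj i z := by simp [hz]
  rw [← heq] at this
  simp only [Finset.mem_filter] at this
  exact this.2.2

/-- The analogue of `adj_of_common_eq` for adjacent `i` and `j`: here `j` itself is a neighbour of
`i` but not a common neighbour. -/
theorem adj_of_common_add_one_eq {G : SimpleGraph V} {i j : V} (hij : G.Adj i j)
    (h : common G i j + 1 = common G i i) {z : V} (hz : G.Adj i z) (hzj : z ≠ j) : G.Adj j z := by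
  have hsub : insert j (Finset.univ.filter fun z => G.Adj i z ∧ G.Adj j z) ⊆
      Finset.univ.filter fun z => G.Adj i z ∧ G.Adj i z := by
    intro z hz
    rcases Finset.mem_insert.mp hz with rfl | hz
    · simp [hij]
    · simp only [Finset.mem_filter] at hz ⊢
      exact ⟨hz.1, hz.2.1, hz.2.1⟩
  have heq := Finset.eq_of_subset_of_card_le hsub (by
    rw [Finset.card_insert_of_notMem (a := j) (by simp)]; exact le_of_eq h.symm)
  have : z ∈ Finset.univ.filter fun z => G.Adj i z ∧ G.Adj i z := by simp [hz]
  rw [← heq, Finset.mem_insert] at this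
  simp only [Finset.mem_filter] at this
  exact (this.resolve_left hzj).2.2

theorem Twin.common_eq {G : SimpleGraph V} {i j : V} (h : Twin G i j) (hne : i ≠ j) :
    common G i j + 1 = common G i i := by
  rw [common, ← Finset.card_insert_of_notMem (a := j) (by simp), common]
  congr 1
  ext z
  simp only [Finset.mem_insert, Finset.mem_filter, Finset.mem_univ, true_and, and_self]
  constructor
  · rintro (rfl | hz)
    exacts [h.adj hne, hz.1]
  · intro hz
    by_cases hzj : z = j
    · exact Or.inl hzj
    · exact Or.inr ⟨hz, (h.adj_iff hz.ne' hzj).mp hz⟩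

omit [Fintype V] in
theorem planarInner_comm (p q : V → ℝ) (i j : V) : planarInner p q i j = planarInner p q j i := by
  simp only [planarInner]; ring

omit [Fintype V] in
theorem planarDet_swap (p q : V → ℝ) (i j : V) : planarDet p q i j = -planarDet p q j i := by
  simp only [planarDet]; ring

omit [Fintype V] in
theorem planarDet_sq (p q : V → ℝ) (i j : V) : planarDet p q i j ^ 2
    = planarInner p q i i * planarInner p q j j - planarInner p q i j ^ 2 := by
  simp only [planarInner, planarDet]; ring

namespace IsPlanarGram

variable {G : SimpleGraph V} {p q : V → ℝ}

theorem inner_self (h : IsPlanarGram G p q) (i : V) :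
    planarInner p q i i = common G i i - 1 := by
  rw [← h.gram, if_pos rfl]

theorem inner_of_ne (h : IsPlanarGram G p q) {i j : V} (hne : i ≠ j) :
    planarInner p q i j = common G i j := by
  rw [← h.gram, if_neg hne, sub_zero]

theorem two_le_common_self (h : IsPlanarGram G p q) (i : V) : 2 ≤ common G i i := by
  have := h.pos i
  rw [h.inner_self] at this
  have : (1 : ℝ) < common G i i := by linarith
  exact_mod_cast this

theorem inner_nonneg (h : IsPlanarGram G p q) (i j : V) : 0 ≤ planarInner p q i j := by
  by_cases hij : i = j
  · subst hij; exact (h.pos i).le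
  · rw [h.inner_of_ne hij]; positivity

/-- The parallel vectors of two distinct vertices either have equal length, or lengths `1` and
`2`. -/
theorem parallel (h : IsPlanarGram G p q) {i j : V} (hne : i ≠ j)
    (hdet : planarDet p q i j = 0) (hle : common G i i ≤ common G j j) :
    (common G i i = common G j j ∧ common G i j + 1 = common G i i) ∨
    (common G i i = 2 ∧ common G j j = 5 ∧ common G i j = 2) := by
  have hsq := planarDet_sq p q i j
  rw [hdet, h.inner_self, h.inner_self, h.inner_of_ne hne] at hsq
  have h2 := h.two_le_common_self i
  have hc := common_le_left G i j
  generalize common G i i = d at *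
  generalize common G j j = e at *
  generalize common G i j = c at *
  obtain ⟨d, rfl⟩ := Nat.exists_eq_add_of_le h2
  obtain ⟨e, rfl⟩ := Nat.exists_eq_add_of_le hle
  have hsq' : c ^ 2 = (1 + d) * (1 + d + e) := by
    have : (c : ℝ) ^ 2 = (1 + d) * (1 + d + e) := by push_cast at hsq; linarith
    exact_mod_cast this
  rcases Nat.eq_zero_or_pos e with rfl | he
  · left
    have : c = 1 + d := by nlinarith
    omega
  · right
    have : c = 2 + d := by
      have : 1 + d < c := by nlinarith
      omega
    subst this
    have h3 : e * (d + 1) = 3 + 2 * d := by nlinarith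
    have h4 : 3 ≤ e := by
      by_contra hcon
      have : e * (d + 1) ≤ 2 * (d + 1) := Nat.mul_le_mul_right _ (by omega)
      omega
    have : d = 0 := by
      have : 3 * (d + 1) ≤ e * (d + 1) := Nat.mul_le_mul_right _ h4
      omega
    subst this
    omega

/-- Adjacent vertices with parallel vectors are twins. In the case of different lengths in
`parallel`, all neighbours of `i`, hence also `j`, would be neighbours of `j`. -/
theorem twin_of_adj_of_det_eq_zero (h : IsPlanarGram G p q) {i j : V} (hij : G.Adj i j)
    (hdet : planarDet p q i j = 0) : Twin G i j := by
  have key : ∀ {i j : V}, G.Adj i j → planarDet p q i j = 0 → common G i i ≤ common G j j →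
      Twin G i j := by
    intro i j hij hdet hle
    rcases h.parallel hij.ne hdet hle with ⟨h1, h2⟩ | ⟨h1, -, h3⟩
    · have h3 : common G j i + 1 = common G j j := by rw [common_comm, h2, h1]
      intro z
      by_cases hzi : z = i
      · subst hzi; simp [hij.symm]
      · by_cases hzj : z = j
        · subst hzj; simp [hij]
        · simp only [hzi, hzj, false_or]
          exact ⟨fun hz => adj_of_common_add_one_eq hij h2 hz hzj,
            fun hz => adj_of_common_add_one_eq hij.symm h3 hz hzi⟩
    · exact absurd (adj_of_common_eq (h3.trans h1.symm) hij) (G.loopless.irrefl j)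
  rcases le_total (common G i i) (common G j j) with hle | hle
  · exact key hij hdet hle
  · refine (key hij.symm ?_ hle).symm
    rw [planarDet_swap, hdet, neg_zero]

/-- Twins have the same vector: the squared distance of two vectors is
`common G i i + common G j j - 2 - 2 * common G i j`. -/
theorem eq_of_twin (h : IsPlanarGram G p q) {i j : V} (hij : Twin G i j) :
    p i = p j ∧ q i = q j := by
  by_cases hne : i = j
  · subst hne; simp
  have h1 := hij.common_eq hne
  have h2 := hij.symm.common_eq (Ne.symm hne)
  have e1 := h.inner_self i
  have e2 := h.inner_self j
  have e3 := h.inner_of_ne hne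
  rw [common_comm] at h2
  have h1' : (common G i j : ℝ) + 1 = common G i i := by exact_mod_cast h1
  have h2' : (common G i j : ℝ) + 1 = common G j j := by exact_mod_cast h2
  simp only [planarInner] at e1 e2 e3
  have : (p i - p j) ^ 2 + (q i - q j) ^ 2 = 0 := by nlinarith
  have hp : (p i - p j) ^ 2 = 0 := by nlinarith [sq_nonneg (p i - p j), sq_nonneg (q i - q j)]
  have hq : (q i - q j) ^ 2 = 0 := by nlinarith [sq_nonneg (p i - p j), sq_nonneg (q i - q j)]
  constructor
  · linarith [pow_eq_zero_iff (two_ne_zero) |>.mp hp]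
  · linarith [pow_eq_zero_iff (two_ne_zero) |>.mp hq]

end IsPlanarGram

/-- The indicator of the closed neighbourhood of `i`, that is, the `i`-th row of `A + 1`. -/
noncomputable def closedNbr (G : SimpleGraph V) (i v : V) : ℝ := if v = i ∨ G.Adj i v then 1 else 0

/-- The entries of `(A + 1)² = A² + 2 A + 1`. -/
theorem sum_closedNbr_mul (G : SimpleGraph V) (i j : V) :
    ∑ v, closedNbr G i v * closedNbr G j v
      = common G i j + 2 * (if G.Adj i j then 1 else 0) + (if i = j then 1 else 0) := by
  have e : ∀ i v, closedNbr G i v = (G.adjMatrix ℝ + 1) i v := by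
    intro i v
    rw [closedNbr, Matrix.add_apply, SimpleGraph.adjMatrix_apply, Matrix.one_apply]
    by_cases h : v = i
    · subst h; simp
    · simp [h, Ne.symm h]
  have hs : ∀ j v, (G.adjMatrix ℝ + 1) j v = (G.adjMatrix ℝ + 1 : Matrix V V ℝ) v j := by
    intro j v
    rw [← e, Matrix.add_apply, SimpleGraph.adjMatrix_apply, Matrix.one_apply, closedNbr]
    by_cases h : v = j
    · subst h; simp
    · simp [h, SimpleGraph.adj_comm]
  simp_rw [e]
  conv_lhs => enter [2, v]; rw [hs j v]
  rw [← Matrix.mul_apply, add_mul, mul_add, mul_one, one_mul, Matrix.add_apply, Matrix.add_apply,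
    Matrix.add_apply, adjMatrix_mul_self_apply, SimpleGraph.adjMatrix_apply, Matrix.one_apply]
  ring

namespace IsPlanarGram

variable {G : SimpleGraph V} {p q : V → ℝ}

/-- A linear relation `f` between the planar vectors is fixed by `A²`, whence
`‖(A + 1) f‖² = 2 ⟨f, (A + 1) f⟩`. This is the case of a relation between three vectors. -/
theorem sum_sq_eq (h : IsPlanarGram G p q) {i j k : V} (hij : i ≠ j) (hjk : j ≠ k) (hik : i ≠ k)
    {α β γ : ℝ} (hp : α * p i + β * p j + γ * p k = 0) (hq : α * q i + β * q j + γ * q k = 0) :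
    ∑ v, (α * closedNbr G i v + β * closedNbr G j v + γ * closedNbr G k v) ^ 2
      = 2 * (α ^ 2 + β ^ 2 + γ ^ 2 + 2 * α * β * (if G.Adj i j then 1 else 0)
        + 2 * β * γ * (if G.Adj j k then 1 else 0)
        + 2 * α * γ * (if G.Adj i k then 1 else 0)) := by
  have e : ∀ v, (α * closedNbr G i v + β * closedNbr G j v + γ * closedNbr G k v) ^ 2
      = α ^ 2 * (closedNbr G i v * closedNbr G i v) + β ^ 2 * (closedNbr G j v * closedNbr G j v)
      + γ ^ 2 * (closedNbr G k v * closedNbr G k v)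
      + 2 * α * β * (closedNbr G i v * closedNbr G j v)
      + 2 * β * γ * (closedNbr G j v * closedNbr G k v)
      + 2 * α * γ * (closedNbr G i v * closedNbr G k v) := fun v => by ring
  simp_rw [e, Finset.sum_add_distrib, ← Finset.mul_sum, sum_closedNbr_mul]
  have e1 := h.inner_self i
  have e2 := h.inner_self j
  have e3 := h.inner_self k
  have e4 := h.inner_of_ne hij
  have e5 := h.inner_of_ne hjk
  have e6 := h.inner_of_ne hik
  have h0 : α ^ 2 * planarInner p q i i + β ^ 2 * planarInner p q j j
      + γ ^ 2 * planarInner p q k k + 2 * α * β * planarInner p q i j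
      + 2 * β * γ * planarInner p q j k + 2 * α * γ * planarInner p q i k = 0 := by
    simp only [planarInner]
    linear_combination (α * p i + β * p j + γ * p k) * hp + (α * q i + β * q j + γ * q k) * hq
  simp only [hij, hjk, hik, if_false, if_true, SimpleGraph.irrefl]
  rw [e1, e2, e3, e4, e5, e6] at h0
  linear_combination h0

theorem exists_mem_ne_of_not_twin {u v : V} (h : ¬ Twin G u v) :
    ∃ z, closedNbr G u z ≠ closedNbr G v z := by
  by_contra hcon
  push Not at hcon
  refine h fun z => ?_
  have := hcon z
  unfold closedNbr at this
  by_cases h1 : z = u ∨ G.Adj u z <;> by_cases h2 : z = v ∨ G.Adj v z <;> simp_all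

/-- Every triangle contains two twins: by `sum_sq_eq`, the linear relation between its three vectors
is also a relation between the closed neighbourhoods. -/
theorem twin_of_triangle (h : IsPlanarGram G p q) {i j k : V} (hij : G.Adj i j) (hjk : G.Adj j k)
    (hik : G.Adj i k) : Twin G i j ∨ Twin G j k ∨ Twin G i k := by
  by_contra hcon
  push Not at hcon
  obtain ⟨n1, n2, n3⟩ := hcon
  set α := planarDet p q j k with hα
  set β := planarDet p q k i with hβ
  set γ := planarDet p q i j with hγ
  have hsum := h.sum_sq_eq (α := α) (β := β) (γ := γ) hij.ne hjk.ne hik.ne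
    (by simp only [hα, hβ, hγ, planarDet]; ring) (by simp only [hα, hβ, hγ, planarDet]; ring)
  simp only [hij, hjk, hik, if_true] at hsum
  set F : V → ℝ := fun v => α * closedNbr G i v + β * closedNbr G j v + γ * closedNbr G k v with hF
  have hFi : F i = α + β + γ := by simp [hF, closedNbr, hij.symm, hik.symm]
  have hFj : F j = α + β + γ := by simp [hF, closedNbr, hij, hjk.symm]
  have hFk : F k = α + β + γ := by simp [hF, closedNbr, hik, hjk]
  have hle : ∑ v ∈ {i, j, k}, F v ^ 2 ≤ ∑ v, F v ^ 2 :=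
    Finset.sum_le_sum_of_subset_of_nonneg (Finset.subset_univ _) fun _ _ _ => sq_nonneg _
  -- the three vertices alone contribute `3 (α + β + γ)²` to a sum equal to `2 (α + β + γ)²`
  rw [Finset.sum_insert (by simp [hij.ne, hik.ne]), Finset.sum_insert (by simp [hjk.ne]),
    Finset.sum_singleton, hFi, hFj, hFk, hsum] at hle
  have hσ : α + β + γ = 0 := by
    have : (α + β + γ) ^ 2 = 0 := by nlinarith [sq_nonneg (α + β + γ)]
    exact pow_eq_zero_iff two_ne_zero |>.mp this
  have hzero : ∀ v, F v = 0 := by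
    have h0 : ∑ v, F v ^ 2 = 0 := by
      rw [hsum]
      linear_combination 2 * (α + β + γ) * hσ
    intro v
    have := (Finset.sum_eq_zero_iff_of_nonneg fun v _ => sq_nonneg (F v)).mp h0 v
      (Finset.mem_univ v)
    exact pow_eq_zero_iff two_ne_zero |>.mp this
  have hval : ∀ u v, closedNbr G u v = 0 ∨ closedNbr G u v = 1 := by
    intro u v
    unfold closedNbr
    split_ifs <;> simp
  -- at a vertex where the closed neighbourhoods of `i` and `j` differ, the relation reads `α = 0`
  -- or `β = 0`, up to subtraction from `α + β + γ = 0`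
  have p1 : α * β = 0 := by
    obtain ⟨z, hz⟩ := exists_mem_ne_of_not_twin n1
    have := hzero z
    simp only [hF] at this
    rcases hval i z with h1 | h1 <;> rcases hval j z with h2 | h2 <;>
      rcases hval k z with h3 | h3 <;> rw [h1, h2, h3] at this <;>
      first
        | exact absurd (h1.trans h2.symm) hz
        | (have h0 : α = 0 := by linarith
           rw [h0, zero_mul])
        | (have h0 : β = 0 := by linarith
           rw [h0, mul_zero])
  have p2 : β * γ = 0 := by
    obtain ⟨z, hz⟩ := exists_mem_ne_of_not_twin n2
    have := hzero z
    simp only [hF] at this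
    rcases hval i z with h1 | h1 <;> rcases hval j z with h2 | h2 <;>
      rcases hval k z with h3 | h3 <;> rw [h1, h2, h3] at this <;>
      first
        | exact absurd (h2.trans h3.symm) hz
        | (have h0 : β = 0 := by linarith
           rw [h0, zero_mul])
        | (have h0 : γ = 0 := by linarith
           rw [h0, mul_zero])
  have p3 : α * γ = 0 := by
    obtain ⟨z, hz⟩ := exists_mem_ne_of_not_twin n3
    have := hzero z
    simp only [hF] at this
    rcases hval i z with h1 | h1 <;> rcases hval j z with h2 | h2 <;>
      rcases hval k z with h3 | h3 <;> rw [h1, h2, h3] at this <;>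
      first
        | exact absurd (h1.trans h3.symm) hz
        | (have h0 : α = 0 := by linarith
           rw [h0, zero_mul])
        | (have h0 : γ = 0 := by linarith
           rw [h0, mul_zero])
  have hγ0 : γ = 0 := by
    have : γ * γ = 0 := by linear_combination γ * hσ - p2 - p3
    exact mul_self_eq_zero.mp this
  exact n1 (h.twin_of_adj_of_det_eq_zero hij hγ0)

/-- The vectors of all neighbours of `v` that are not twins of `v` lie on the same side of the
vector of `v`. -/
theorem det_mul_det_pos (h : IsPlanarGram G p q) {u v w : V} (huv : G.Adj v u) (hvw : G.Adj v w)
    (hu : ¬ Twin G v u) (hw : ¬ Twin G v w) :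
    0 < planarDet p q v u * planarDet p q v w := by
  have du : planarDet p q v u ≠ 0 := fun h0 => hu (h.twin_of_adj_of_det_eq_zero huv h0)
  have dw : planarDet p q v w ≠ 0 := fun h0 => hw (h.twin_of_adj_of_det_eq_zero hvw h0)
  by_cases huw : Twin G u w
  · obtain ⟨h1, h2⟩ := h.eq_of_twin huw
    have : planarDet p q v u = planarDet p q v w := by simp only [planarDet, h1, h2]
    rw [this]
    exact mul_self_pos.mpr dw
  have hnadj : ¬ G.Adj u w := by
    intro hadj
    rcases h.twin_of_triangle huv hadj hvw with h1 | h1 | h1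
    exacts [hu h1, huw h1, hw h1]
  have hne : u ≠ w := by
    rintro rfl
    exact huw (Twin.refl G u)
  set α := planarDet p q v w with hα
  set β := planarDet p q w u with hβ
  set γ := planarDet p q u v with hγ
  have hsum := h.sum_sq_eq (α := α) (β := β) (γ := γ) huv.ne' hvw.ne hne
    (by simp only [hα, hβ, hγ, planarDet]; ring) (by simp only [hα, hβ, hγ, planarDet]; ring)
  simp only [huv.symm, hvw, hnadj, if_true, if_false] at hsum
  set F : V → ℝ := fun z => α * closedNbr G u z + β * closedNbr G v z + γ * closedNbr G w z with hF
  have hFu : F u = α + β := by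
    simp [hF, closedNbr, huv, hne, G.adj_comm w u, hnadj]
  have hFv : F v = α + β + γ := by simp [hF, closedNbr, huv.symm, hvw.symm]
  have hFw : F w = β + γ := by simp [hF, closedNbr, hvw, hne.symm, hnadj]
  have hle : ∑ z ∈ {u, v, w}, F z ^ 2 ≤ ∑ z, F z ^ 2 :=
    Finset.sum_le_sum_of_subset_of_nonneg (Finset.subset_univ _) fun _ _ _ => sq_nonneg _
  -- the values at `u`, `v` and `w` already give `β² + 2 α γ ≤ 0`
  rw [Finset.sum_insert (by simp [huv.ne', hne]), Finset.sum_insert (by simp [hvw.ne]),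
    Finset.sum_singleton, hFu, hFv, hFw, hsum] at hle
  have h1 : planarDet p q v u = -γ := planarDet_swap p q v u
  rw [h1]
  have hγ0 : γ ≠ 0 := fun h0 => du (by rw [h1, h0, neg_zero])
  have h2 : α * γ ≠ 0 := mul_ne_zero dw hγ0
  have h3 : α * γ ≤ 0 := by nlinarith [sq_nonneg β]
  have h4 : α * γ < 0 := lt_of_le_of_ne h3 h2
  linarith

end IsPlanarGram

end Planar

/-! ### The graph is a bipartite graph blown up by cliques -/

section Blowup

open scoped Classical

variable {V : Type*} [Fintype V]

/-- The two sides `S` and `Sᶜ` of a planar Gram representation: adjacent vertices on the same side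
are twins, and every vertex has a neighbour on the other side. -/
structure IsCliqueBlowup (G : SimpleGraph V) (p q : V → ℝ) (S : V → Prop) : Prop
    extends IsPlanarGram G p q where
  twin_of_adj : ∀ {u v}, G.Adj u v → (S u ↔ S v) → Twin G u v
  side_of_twin : ∀ {u v}, Twin G u v → (S u ↔ S v)
  exists_cross : ∀ v, ∃ u, G.Adj v u ∧ ¬ (S v ↔ S u)

/-- The number of twins of `v`, including `v`. -/
noncomputable def twinCard (G : SimpleGraph V) (v : V) : ℕ :=
  (Finset.univ.filter fun z => Twin G v z).card

/-- The neighbours of `v` that are not twins of `v`. -/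
noncomputable def crossNbrs (G : SimpleGraph V) (v : V) : Finset V :=
  Finset.univ.filter fun z => G.Adj v z ∧ ¬ Twin G v z

theorem one_le_twinCard (G : SimpleGraph V) (v : V) : 1 ≤ twinCard G v :=
  Finset.card_pos.mpr ⟨v, by simp [Twin.refl]⟩

theorem Twin.twinCard_eq {G : SimpleGraph V} {u v : V} (h : Twin G u v) :
    twinCard G u = twinCard G v := by
  unfold twinCard
  congr 1
  ext z
  simp only [Finset.mem_filter, Finset.mem_univ, true_and]
  exact ⟨fun hz => h.symm.trans hz, fun hz => h.trans hz⟩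

theorem eq_of_twin_of_twinCard_eq_one {G : SimpleGraph V} {u v : V} (h : Twin G u v)
    (h1 : twinCard G u = 1) : u = v := by
  obtain ⟨a, ha⟩ := Finset.card_eq_one.mp h1
  have hu : u ∈ Finset.univ.filter fun z => Twin G u z := by simp [Twin.refl]
  have hv : v ∈ Finset.univ.filter fun z => Twin G u z := by simp [h]
  rw [ha, Finset.mem_singleton] at hu hv
  rw [hu, hv]

/-- The closed neighbourhood consists of the twins and the neighbours that are not twins. -/
theorem common_self_eq (G : SimpleGraph V) (v : V) :
    common G v v + 1 = twinCard G v + (crossNbrs G v).card := by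
  have e : insert v (Finset.univ.filter fun z => G.Adj v z ∧ G.Adj v z)
      = (Finset.univ.filter fun z => Twin G v z) ∪ crossNbrs G v := by
    ext z
    simp only [Finset.mem_insert, Finset.mem_filter, Finset.mem_univ, true_and, and_self,
      Finset.mem_union, crossNbrs]
    constructor
    · rintro (rfl | hz)
      · exact Or.inl (Twin.refl _ _)
      · by_cases ht : Twin G v z
        exacts [Or.inl ht, Or.inr ⟨hz, ht⟩]
    · rintro (hz | hz)
      · by_cases hne : z = v
        exacts [Or.inl hne, Or.inr (hz.adj (Ne.symm hne))]
      · exact Or.inr hz.1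
  rw [common, ← Finset.card_insert_of_notMem (a := v) (by simp), e,
    Finset.card_union_of_disjoint]
  · rfl
  · rw [Finset.disjoint_left]
    intro z hz hz'
    simp only [crossNbrs, Finset.mem_filter] at hz hz'
    exact hz'.2.2 hz.2

/-- The side `S` consists of the vertices `v` whose neighbours, other than twins, have vectors in
the positive direction from that of `v`. By `det_mul_det_pos` all of these neighbours agree on the
direction, and by antisymmetry of the determinant they belong to the other side. -/
theorem IsPlanarGram.exists_isCliqueBlowup {G : SimpleGraph V} {p q : V → ℝ}
    (h : IsPlanarGram G p q) (hG : G.Preconnected) (hne : ∃ u v, G.Adj u v ∧ ¬ Twin G u v) :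
    ∃ S, IsCliqueBlowup G p q S := by
  have hcross : ∀ v, ∃ u, G.Adj v u ∧ ¬ Twin G v u := by
    intro v
    by_contra hcon
    push Not at hcon
    have hall : ∀ z, Twin G v z := by
      intro z
      obtain ⟨w⟩ := hG v z
      induction w with
      | nil => exact Twin.refl _ _
      | @cons a b c hab _ ih =>
        have hvb := hcon b hab
        refine hvb.trans (ih fun u hu => ?_)
        by_cases hua : u = a
        · subst hua; exact hvb.symm
        · have : G.Adj a u := (hvb.adj_iff hua hu.ne').mpr hu
          exact hvb.symm.trans (hcon u this)
    obtain ⟨a, b, -, hab⟩ := hne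
    exact hab ((hall a).symm.trans (hall b))
  refine ⟨fun v => ∃ u, G.Adj v u ∧ ¬ Twin G v u ∧ 0 < planarDet p q v u, ?_⟩
  have hside : ∀ v u, G.Adj v u → ¬ Twin G v u →
      ((∃ u, G.Adj v u ∧ ¬ Twin G v u ∧ 0 < planarDet p q v u) ↔ 0 < planarDet p q v u) := by
    intro v u hvu ht
    refine ⟨fun ⟨w, hw, ht', hpos⟩ => ?_, fun hpos => ⟨u, hvu, ht, hpos⟩⟩
    exact (pos_iff_pos_of_mul_pos (h.det_mul_det_pos hvu hw ht ht')).mpr hpos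
  have hopp : ∀ v u, G.Adj v u → ¬ Twin G v u →
      ((∃ z, G.Adj v z ∧ ¬ Twin G v z ∧ 0 < planarDet p q v z) ↔
        ¬ ∃ z, G.Adj u z ∧ ¬ Twin G u z ∧ 0 < planarDet p q u z) := by
    intro v u hvu ht
    rw [hside v u hvu ht, hside u v hvu.symm fun ht' => ht ht'.symm, planarDet_swap, not_lt]
    have : planarDet p q u v ≠ 0 := fun h0 =>
      ht (h.twin_of_adj_of_det_eq_zero hvu.symm h0).symm
    constructor
    · intro h1; linarith
    · intro h1
      have := lt_of_le_of_ne h1 this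
      linarith
  refine ⟨h, ?_, ?_, ?_⟩
  · intro u v huv hS
    by_contra ht
    exact iff_not_self (hS.symm.trans (hopp u v huv ht))
  · intro u v huv
    by_cases hne : u = v
    · subst hne; rfl
    obtain ⟨w, hw, ht⟩ := hcross u
    have hvw : w ≠ v := by rintro rfl; exact ht huv
    have hw' : G.Adj v w := (huv.adj_iff hw.ne' hvw).mp hw
    have ht' : ¬ Twin G v w := fun h' => ht (huv.trans h')
    rw [hside u w hw ht, hside v w hw' ht']
    obtain ⟨h1, h2⟩ := h.eq_of_twin huv
    simp only [planarDet, h1, h2]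
  · intro v
    obtain ⟨u, hu, ht⟩ := hcross v
    exact ⟨u, hu, fun hS => iff_not_self (hS.symm.trans (hopp v u hu ht))⟩

namespace IsCliqueBlowup

variable {G : SimpleGraph V} {p q : V → ℝ} {S : V → Prop}

/-- The two sides play the same role. -/
theorem compl (h : IsCliqueBlowup G p q S) : IsCliqueBlowup G p q fun v => ¬ S v where
  toIsPlanarGram := h.toIsPlanarGram
  twin_of_adj huv hS := h.twin_of_adj huv (not_iff_not.mp hS)
  side_of_twin huv := not_congr (h.side_of_twin huv)
  exists_cross v := by
    obtain ⟨u, hu, hS⟩ := h.exists_cross v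
    exact ⟨u, hu, fun h' => hS (not_iff_not.mp h')⟩

theorem mem_crossNbrs (h : IsCliqueBlowup G p q S) {v z : V} :
    z ∈ crossNbrs G v ↔ G.Adj v z ∧ ¬ (S v ↔ S z) := by
  simp only [crossNbrs, Finset.mem_filter, Finset.mem_univ, true_and]
  exact and_congr_right fun hz => not_congr ⟨h.side_of_twin, h.twin_of_adj hz⟩

theorem inner_self_eq (h : IsCliqueBlowup G p q S) (v : V) :
    planarInner p q v v = twinCard G v - 2 + (crossNbrs G v).card := by
  rw [h.inner_self]
  have : (common G v v : ℝ) + 1 = twinCard G v + (crossNbrs G v).card := by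
    exact_mod_cast common_self_eq G v
  linarith

/-- The common neighbours of adjacent vertices on different sides are their twins. -/
theorem inner_cross_of_adj (h : IsCliqueBlowup G p q S) {u v : V} (huv : G.Adj u v)
    (hS : ¬ (S u ↔ S v)) : planarInner p q u v = twinCard G u + twinCard G v - 2 := by
  have ht : ¬ Twin G u v := fun h' => hS (h.side_of_twin h')
  have e : (Finset.univ.filter fun z => G.Adj u z ∧ G.Adj v z)
      = ((Finset.univ.filter fun z => Twin G u z).erase u) ∪
        ((Finset.univ.filter fun z => Twin G v z).erase v) := by
    ext z
    simp only [Finset.mem_filter, Finset.mem_univ, true_and, Finset.mem_union, Finset.mem_erase]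
    constructor
    · rintro ⟨hu, hv⟩
      rcases h.twin_of_triangle huv hv hu with h' | h' | h'
      exacts [absurd h' ht, Or.inr ⟨hv.ne', h'⟩, Or.inl ⟨hu.ne', h'⟩]
    · rintro (⟨hne, hz⟩ | ⟨hne, hz⟩)
      · refine ⟨hz.adj hne.symm, ?_⟩
        have hvz : v ≠ z := by rintro rfl; exact ht hz
        exact ((hz.adj_iff huv.ne' hvz).mp huv).symm
      · refine ⟨?_, hz.adj hne.symm⟩
        have huz : u ≠ z := by rintro rfl; exact ht hz.symm
        exact ((hz.adj_iff huv.ne huz).mp huv.symm).symm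
  rw [h.inner_of_ne huv.ne, common, e, Finset.card_union_of_disjoint, Finset.card_erase_of_mem,
    Finset.card_erase_of_mem]
  · have h1 := one_le_twinCard G u
    have h2 := one_le_twinCard G v
    unfold twinCard at *
    push_cast [Nat.cast_sub h1, Nat.cast_sub h2]
    ring
  · simp [Twin.refl]
  · simp [Twin.refl]
  · rw [Finset.disjoint_left]
    intro z hz hz'
    simp only [Finset.mem_erase, Finset.mem_filter] at hz hz'
    exact ht (hz.2.2.trans hz'.2.2.symm)

/-- A common neighbour of two vertices that are not adjacent is a twin of neither. -/
theorem inner_of_not_adj (h : IsCliqueBlowup G p q S) {u v : V} (hne : u ≠ v)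
    (huv : ¬ G.Adj u v) :
    planarInner p q u v = (crossNbrs G u ∩ crossNbrs G v).card := by
  rw [h.inner_of_ne hne, common]
  congr 2
  ext z
  simp only [crossNbrs, Finset.mem_filter, Finset.mem_univ, true_and, Finset.mem_inter]
  constructor
  · rintro ⟨hu, hv⟩
    refine ⟨⟨hu, fun hz => huv ?_⟩, ⟨hv, fun hz => huv ?_⟩⟩
    · exact ((hz.adj_iff hne.symm hv.ne).mpr hv.symm)
    · exact ((hz.adj_iff hne hu.ne).mpr hu.symm).symm
  · rintro ⟨hu, hv⟩
    exact ⟨hu.1, hv.1⟩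

/-- Vertices on different sides that are not adjacent have perpendicular vectors. -/
theorem inner_cross_of_not_adj (h : IsCliqueBlowup G p q S) {u v : V} (huv : ¬ G.Adj u v)
    (hS : ¬ (S u ↔ S v)) : planarInner p q u v = 0 := by
  rw [h.inner_of_not_adj (by rintro rfl; exact hS Iff.rfl) huv]
  norm_cast
  rw [Finset.card_eq_zero, ← Finset.disjoint_iff_inter_eq_empty, Finset.disjoint_left]
  intro z hz hz'
  rw [h.mem_crossNbrs] at hz hz'
  tauto

theorem inner_same (h : IsCliqueBlowup G p q S) {u v : V} (hS : S u ↔ S v) (ht : ¬ Twin G u v) :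
    planarInner p q u v = (crossNbrs G u ∩ crossNbrs G v).card :=
  h.inner_of_not_adj (by rintro rfl; exact ht (Twin.refl _ _)) fun huv => ht (h.twin_of_adj huv hS)

/-- Vectors of vertices on different sides are never parallel. -/
theorem det_cross_ne_zero (h : IsCliqueBlowup G p q S) {u v : V} (hS : ¬ (S u ↔ S v)) :
    planarDet p q u v ≠ 0 := by
  intro h0
  by_cases huv : G.Adj u v
  · exact hS (h.side_of_twin (h.twin_of_adj_of_det_eq_zero huv h0))
  · have := planarDet_sq p q u v
    rw [h0, h.inner_cross_of_not_adj huv hS] at this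
    have := mul_pos (h.pos u) (h.pos v)
    linarith

/-- Twin classes of vertices on one side are disjoint parts of that side. -/
theorem twinCard_add_le (h : IsCliqueBlowup G p q S) {u v : V} (hu : S u) (hv : S v)
    (ht : ¬ Twin G u v) :
    twinCard G u + twinCard G v ≤ (Finset.univ.filter fun z => S z).card := by
  rw [twinCard, twinCard, ← Finset.card_union_of_disjoint]
  · apply Finset.card_le_card
    intro z hz
    simp only [Finset.mem_union, Finset.mem_filter, Finset.mem_univ, true_and] at hz ⊢
    rcases hz with hz | hz
    exacts [(h.side_of_twin hz).mp hu, (h.side_of_twin hz).mp hv]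
  · rw [Finset.disjoint_left]
    intro z hz hz'
    simp only [Finset.mem_filter] at hz hz'
    exact ht (hz.2.trans hz'.2.symm)

theorem twinCard_le (h : IsCliqueBlowup G p q S) {u : V} (hu : S u) :
    twinCard G u ≤ (Finset.univ.filter fun z => S z).card := by
  apply Finset.card_le_card
  intro z hz
  simp only [Finset.mem_filter, Finset.mem_univ, true_and] at hz ⊢
  exact (h.side_of_twin hz).mp hu

theorem twinCard_le_compl (h : IsCliqueBlowup G p q S) {v : V} (hv : ¬ S v) :
    twinCard G v ≤ (Finset.univ.filter fun z => ¬ S z).card := by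
  convert h.compl.twinCard_le hv

end IsCliqueBlowup

/-- Three planar vectors have a singular Gram matrix. -/
theorem planarInner_det_eq_zero {V : Type*} (p q : V → ℝ) (i j k : V) :
    planarInner p q i i * planarInner p q j j * planarInner p q k k
      + 2 * planarInner p q i j * planarInner p q i k * planarInner p q j k
      - planarInner p q i i * planarInner p q j k ^ 2
      - planarInner p q j j * planarInner p q i k ^ 2
      - planarInner p q k k * planarInner p q i j ^ 2 = 0 := by
  simp only [planarInner]; ring

end Blowup

/-! ### Complete adjacency between the two sides -/

section Complete

open scoped Classical

variable {V : Type*} [Fintype V]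

namespace IsCliqueBlowup

variable {G : SimpleGraph V} {p q : V → ℝ} {S : V → Prop}

theorem crossNbrs_eq_of_complete (h : IsCliqueBlowup G p q S)
    (hc : ∀ u v, S u → ¬ S v → G.Adj u v) {u : V} (hu : S u) :
    crossNbrs G u = Finset.univ.filter fun z => ¬ S z := by
  ext z
  simp only [h.mem_crossNbrs, hu, true_iff, Finset.mem_filter, Finset.mem_univ, true_and]
  exact ⟨fun hz => hz.2, fun hz => ⟨hc u z hu hz, hz⟩⟩

theorem crossNbrs_eq_of_complete' (h : IsCliqueBlowup G p q S)
    (hc : ∀ u v, S u → ¬ S v → G.Adj u v) {v : V} (hv : ¬ S v) :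
    crossNbrs G v = Finset.univ.filter fun z => S z := by
  ext z
  simp only [h.mem_crossNbrs, hv, false_iff, Finset.mem_filter, Finset.mem_univ, true_and, not_not]
  exact ⟨fun hz => hz.2, fun hz => ⟨(hc z v hz hv).symm, hz⟩⟩

/-- The vanishing of the Gram determinant of two vertices on one side and a vertex on the other.
Here `α`, `β`, `γ` are the twin class sizes minus two, and `X`, `Y` the sizes of the sides. -/
theorem gram_det_of_complete (h : IsCliqueBlowup G p q S)
    (hc : ∀ u v, S u → ¬ S v → G.Adj u v) {u u' v : V} (hu : S u) (hu' : S u') (hv : ¬ S v)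
    (ht : ¬ Twin G u u') {α β γ X Y : ℝ} (hα : α = twinCard G u - 2) (hβ : β = twinCard G u' - 2)
    (hγ : γ = twinCard G v - 2) (hX : X = (Finset.univ.filter fun z => S z).card)
    (hY : Y = (Finset.univ.filter fun z => ¬ S z).card) :
    Y * ((α + β) * (X + γ) - (α - β) ^ 2) + α * β * (X + γ) - α * (β + γ + 2) ^ 2
      - β * (α + γ + 2) ^ 2 = 0 := by
  have e := planarInner_det_eq_zero p q u u' v
  rw [h.inner_self_eq, h.inner_self_eq, h.inner_self_eq,
    h.inner_cross_of_adj (hc u v hu hv) (by tauto),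
    h.inner_cross_of_adj (hc u' v hu' hv) (by tauto), h.inner_same (by tauto) ht,
    h.crossNbrs_eq_of_complete hc hu, h.crossNbrs_eq_of_complete hc hu',
    h.crossNbrs_eq_of_complete' hc hv, Finset.inter_self, ← hX, ← hY] at e
  have e1 : (twinCard G u : ℝ) = α + 2 := by linarith
  have e2 : (twinCard G u' : ℝ) = β + 2 := by linarith
  have e3 : (twinCard G v : ℝ) = γ + 2 := by linarith
  rw [e1, e2, e3] at e
  linear_combination e

/-- Two different twin classes on the same side have sizes `2, 2`, or `1` and at least `4`. -/
theorem twinCard_pair (h : IsCliqueBlowup G p q S) (hc : ∀ u v, S u → ¬ S v → G.Adj u v)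
    {u u' : V} (hu : S u) (hu' : S u') (ht : ¬ Twin G u u') :
    (twinCard G u = 2 ∧ twinCard G u' = 2) ∨ (twinCard G u = 1 ∧ 4 ≤ twinCard G u') ∨
      (4 ≤ twinCard G u ∧ twinCard G u' = 1) := by
  obtain ⟨v, -, hv⟩ := h.exists_cross u
  have hv : ¬ S v := by tauto
  have e := h.gram_det_of_complete hc hu hu' hv ht rfl rfl rfl rfl rfl
  have hX := h.twinCard_add_le hu hu' ht
  have hY := h.twinCard_le_compl hv
  -- the Cauchy-Schwarz inequality for the two vectors on one side
  have hCS := planarDet_sq p q u u'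
  have hCS0 := sq_nonneg (planarDet p q u u')
  rw [h.inner_self_eq, h.inner_self_eq, h.inner_same (by tauto) ht,
    h.crossNbrs_eq_of_complete hc hu, h.crossNbrs_eq_of_complete hc hu', Finset.inter_self] at hCS
  have hw := one_le_twinCard G u
  have hw' := one_le_twinCard G u'
  have hwv := one_le_twinCard G v
  generalize (Finset.univ.filter fun z => S z).card = X at *
  generalize (Finset.univ.filter fun z => ¬ S z).card = Y at *
  generalize twinCard G u = a at *
  generalize twinCard G u' = b at *
  generalize twinCard G v = c at *
  rw [hCS] at hCS0
  have hX' : (a : ℝ) + b ≤ X := by exact_mod_cast hX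
  have hY' : (c : ℝ) ≤ Y := by exact_mod_cast hY
  have hc1 : (1 : ℝ) ≤ c := by exact_mod_cast hwv
  have hY1 : (1 : ℝ) ≤ Y := by linarith
  have one_case : ∀ b : ℕ, 1 ≤ b →
      (0 : ℝ) ≤ ((1 : ℕ) - 2 + Y : ℝ) * (b - 2 + Y) - (Y : ℝ) ^ 2 → 4 ≤ b := by
    intro b hb hcs
    by_contra hlt
    have hb3 : (b : ℝ) ≤ 3 := by
      have : b ≤ 3 := by omega
      exact_mod_cast this
    push_cast at hcs
    nlinarith
  rcases Nat.lt_or_ge a 2 with ha | ha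
  · obtain rfl : a = 1 := by omega
    exact Or.inr (Or.inl ⟨rfl, one_case b hw' hCS0⟩)
  rcases Nat.lt_or_ge b 2 with hb | hb
  · obtain rfl : b = 1 := by omega
    exact Or.inr (Or.inr ⟨one_case a hw (by linarith), rfl⟩)
  left
  -- for `α, β ≥ 0` the determinant is at least `2 (γ + 2) (α + β) + α β (γ + 4)`
  have hα : (0 : ℝ) ≤ a - 2 := by
    have : (2 : ℝ) ≤ a := by exact_mod_cast ha
    linarith
  have hβ : (0 : ℝ) ≤ b - 2 := by
    have : (2 : ℝ) ≤ b := by exact_mod_cast hb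
    linarith
  obtain ⟨α, hα'⟩ : ∃ α : ℝ, α = a - 2 := ⟨_, rfl⟩
  obtain ⟨β, hβ'⟩ : ∃ β : ℝ, β = b - 2 := ⟨_, rfl⟩
  obtain ⟨γ, hγ'⟩ : ∃ γ : ℝ, γ = c - 2 := ⟨_, rfl⟩
  rw [← hα', ← hβ', ← hγ'] at e
  rw [← hα'] at hα
  rw [← hβ'] at hβ
  have hγ : -1 ≤ γ := by linarith
  obtain ⟨x, hx, hxX⟩ : ∃ x : ℝ, 0 ≤ x ∧ (X : ℝ) = α + β + 4 + x :=
    ⟨X - (α + β + 4), by linarith, by ring⟩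
  obtain ⟨y, hy, hyY⟩ : ∃ y : ℝ, 0 ≤ y ∧ (Y : ℝ) = γ + 2 + y :=
    ⟨Y - (γ + 2), by linarith, by ring⟩
  rw [hxX, hyY] at e
  have e' : 2 * (γ + 2) * (α + β) + α * β * (γ + 4)
      + (γ + 2) * ((α + β) * x) + α * β * x
      + y * (4 * (α * β) + (4 + γ) * (α + β) + (α + β) * x) = 0 := by
    linear_combination e
  have hab : 0 ≤ α * β := mul_nonneg hα hβ
  have hsx : 0 ≤ (α + β) * x := mul_nonneg (by linarith) hx
  have t1 : 0 ≤ α * β * (γ + 4) := mul_nonneg hab (by linarith)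
  have t2 : 0 ≤ (γ + 2) * ((α + β) * x) := mul_nonneg (by linarith) hsx
  have t3 : 0 ≤ α * β * x := mul_nonneg hab hx
  have t4 : 0 ≤ y * (4 * (α * β) + (4 + γ) * (α + β) + (α + β) * x) := by
    refine mul_nonneg hy (add_nonneg (add_nonneg (by linarith) ?_) hsx)
    exact mul_nonneg (by linarith) (by linarith)
  have t5 : (α + β) ≤ 0 := by
    by_contra hpos
    have := mul_pos (by linarith : (0 : ℝ) < 2 * (γ + 2)) (not_le.mp hpos)
    linarith
  constructor
  · have : (a : ℝ) = 2 := by linarith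
    exact_mod_cast this
  · have : (b : ℝ) = 2 := by linarith
    exact_mod_cast this

/-- If one side is completely joined to the other, it consists of one clique, of cliques of
order 2, or of a vertex and a clique. -/
theorem side_cases (h : IsCliqueBlowup G p q S) (hc : ∀ u v, S u → ¬ S v → G.Adj u v) :
    (∀ u v, S u → S v → Twin G u v) ∨
    ((∀ u, S u → twinCard G u = 2) ∧ ∃ u v, S u ∧ S v ∧ ¬ Twin G u v) ∨
    ∃ u v, S u ∧ S v ∧ ¬ Twin G u v ∧ twinCard G u = 1 ∧ 4 ≤ twinCard G v ∧
      ∀ z, S z → Twin G u z ∨ Twin G v z := by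
  by_cases h0 : ∀ u v, S u → S v → Twin G u v
  · exact Or.inl h0
  right
  push Not at h0
  obtain ⟨u, v, hu, hv, ht⟩ := h0
  have hrest : ∀ u v, S u → S v → ¬ Twin G u v → twinCard G u = 1 → 4 ≤ twinCard G v →
      ∀ z, S z → Twin G u z ∨ Twin G v z := by
    intro u v hu hv ht h1 h4 z hz
    by_contra hcon
    push Not at hcon
    have c1 := h.twinCard_pair hc hu hz hcon.1
    have c2 := h.twinCard_pair hc hv hz hcon.2
    omega
  rcases h.twinCard_pair hc hu hv ht with ⟨h1, h2⟩ | ⟨h1, h4⟩ | ⟨h4, h1⟩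
  · left
    refine ⟨fun z hz => ?_, u, v, hu, hv, ht⟩
    by_cases hz' : Twin G u z
    · rw [← hz'.twinCard_eq, h1]
    · have := h.twinCard_pair hc hu hz hz'
      omega
  · exact Or.inr ⟨u, v, hu, hv, ht, h1, h4, hrest u v hu hv ht h1 h4⟩
  · exact Or.inr ⟨v, u, hv, hu, fun h' => ht h'.symm, h1, h4,
      hrest v u hv hu (fun h' => ht h'.symm) h1 h4⟩

/-- If one side consists of a vertex and a clique, then the other side is a clique, and there are
only three possibilities for the orders of the cliques. -/
theorem vertex_and_clique (h : IsCliqueBlowup G p q S) (hc : ∀ u v, S u → ¬ S v → G.Adj u v)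
    {u u' : V} (hu : S u) (hu' : S u') (ht : ¬ Twin G u u') (h1 : twinCard G u = 1)
    (hall : ∀ z, S z → Twin G u z ∨ Twin G u' z) :
    (∀ v v', ¬ S v → ¬ S v' → Twin G v v') ∧
      ∃ a c, (∀ v, ¬ S v → twinCard G v = c) ∧ twinCard G u' = a ∧
        ((c = 6 ∧ a = 5) ∨ (c = 4 ∧ a = 6) ∨ (c = 3 ∧ a = 8)) := by
  have hX : (Finset.univ.filter fun z => S z).card = 1 + twinCard G u' := by
    rw [← h1, twinCard, twinCard, ← Finset.card_union_of_disjoint]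
    · congr 1
      ext z
      simp only [Finset.mem_union, Finset.mem_filter, Finset.mem_univ, true_and]
      refine ⟨hall z, ?_⟩
      rintro (hz | hz)
      exacts [(h.side_of_twin hz).mp hu, (h.side_of_twin hz).mp hu']
    · rw [Finset.disjoint_left]
      intro z hz hz'
      simp only [Finset.mem_filter] at hz hz'
      exact ht (hz.2.trans hz'.2.symm)
  have key : ∀ v, ¬ S v →
      ((Finset.univ.filter fun z => ¬ S z).card : ℝ) * ((twinCard G v - 2 : ℝ)
        * ((twinCard G u' - 2) - 1) - 4) + ((twinCard G v : ℝ)) ^ 2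
        - (twinCard G u' - 2) * (twinCard G v - 2) * (twinCard G v - 1) = 0 := by
    intro v hv
    have e := h.gram_det_of_complete hc hu hu' hv ht rfl rfl rfl rfl rfl
    rw [hX, h1] at e
    push_cast at e
    linear_combination e
  have hb : 4 ≤ twinCard G u' := by
    rcases h.twinCard_pair hc hu hu' ht with h' | h' | h' <;> omega
  have hb' : (4 : ℝ) ≤ twinCard G u' := by exact_mod_cast hb
  have hcl : ∀ v v', ¬ S v → ¬ S v' → Twin G v v' := by
    have no2 : ∀ v, ¬ S v → twinCard G v ≠ 2 := by
      intro v hv h2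
      have e := key v hv
      have hY := h.twinCard_le_compl hv
      rw [h2] at e hY
      have hY' : (2 : ℝ) ≤ (Finset.univ.filter fun z => ¬ S z).card := by exact_mod_cast hY
      push_cast at e
      linarith
    have no1 : ∀ v, ¬ S v → twinCard G v ≠ 1 := by
      intro v hv h2
      have e := key v hv
      have hY := h.twinCard_le_compl hv
      rw [h2] at e hY
      have hY' : (1 : ℝ) ≤ (Finset.univ.filter fun z => ¬ S z).card := by exact_mod_cast hY
      push_cast at e
      nlinarith
    intro v v' hv hv'
    by_contra htv
    have := no2 v hv
    have := no1 v hv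
    have := no1 v' hv'
    have := h.compl.twinCard_pair (fun a b ha hb => (hc b a (not_not.mp hb) ha).symm) hv hv' htv
    omega
  refine ⟨hcl, ?_⟩
  obtain ⟨v, -, hv⟩ := h.exists_cross u
  have hv : ¬ S v := by tauto
  refine ⟨_, twinCard G v, fun z hz => (hcl z v hz hv).twinCard_eq, rfl, ?_⟩
  have hY : (Finset.univ.filter fun z => ¬ S z).card = twinCard G v := by
    rw [twinCard]
    congr 1
    ext z
    simp only [Finset.mem_filter, Finset.mem_univ, true_and]
    exact ⟨fun hz => hcl v z hv hz, fun hz => (h.compl.side_of_twin hz).mp hv⟩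
  have e := key v hv
  rw [hY] at e
  have hcpos := one_le_twinCard G v
  generalize twinCard G v = c at *
  generalize twinCard G u' = a at *
  obtain ⟨a, rfl⟩ := Nat.exists_eq_add_of_le hb
  have e2 : ((c : ℝ) - 2) * a = 4 := by
    push_cast at e
    linear_combination e
  have hc2 : 2 < c := by
    by_contra hlt
    have : (c : ℝ) ≤ 2 := by
      have : c ≤ 2 := by omega
      exact_mod_cast this
    have ha : (0 : ℝ) ≤ a := by positivity
    nlinarith
  obtain ⟨c, rfl⟩ := Nat.exists_eq_add_of_le hc2
  have e3 : (c + 1) * a = 4 := by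
    have : ((c : ℝ) + 1) * a = 4 := by
      push_cast at e2
      linear_combination e2
    exact_mod_cast this
  have hc4 : c ≤ 3 := by nlinarith [Nat.pos_of_ne_zero (by rintro rfl; simp at e3 : a ≠ 0)]
  interval_cases c <;> omega

end IsCliqueBlowup

end Complete

/-! ### Perpendicular pairs -/

section Perpendicular

open scoped Classical

/-- Two planar vectors expanded in the orthogonal basis formed by the vectors of `u` and `y`. -/
theorem planarInner_expand {V : Type*} {p q : V → ℝ} {u y : V} (h : planarInner p q u y = 0)
    (v w : V) :
    planarInner p q v w * planarInner p q u u * planarInner p q y y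
      = planarInner p q v u * planarInner p q w u * planarInner p q y y
        + planarInner p q v y * planarInner p q w y * planarInner p q u u := by
  simp only [planarInner] at h ⊢
  linear_combination ((p v * p w + q v * q w) * (p u * p y + q u * q y)
    - (p v * p u + q v * q u) * (p y * p w + q y * q w)
    - (p v * p y + q v * q y) * (p u * p w + q u * q w)) * h

/-- Two planar vectors perpendicular to the same nonzero vector are parallel. -/
theorem planarDet_eq_zero_of_perp {V : Type*} {p q : V → ℝ} {u v w : V}
    (hu : 0 < planarInner p q u u) (hv : planarInner p q v u = 0) (hw : planarInner p q w u = 0) :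
    planarDet p q v w = 0 := by
  have : planarDet p q v w * planarInner p q u u = 0 := by
    simp only [planarInner, planarDet] at hv hw ⊢
    linear_combination (p u * q w - q u * p w) * hv + (p v * q u - q v * p u) * hw
  exact (mul_eq_zero.mp this).resolve_right hu.ne'

/-- A configuration in which any two blocks share one point less than the block size, and dually,
is the complement of a perfect matching: this is a count of flags. -/
theorem card_eq_of_near_design {V : Type*} (X Y : Finset V) (R : V → V → Prop) {s t : ℕ}
    (hX : X.Nonempty) (hY : Y.Nonempty) (hs : 2 ≤ s)
    (h1 : ∀ y ∈ Y, (X.filter fun x => R x y).card = s)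
    (h2 : ∀ y ∈ Y, ∀ y' ∈ Y, y ≠ y' → (X.filter fun x => R x y ∧ R x y').card + 1 = s)
    (h3 : ∀ x ∈ X, (Y.filter fun y => R x y).card = t)
    (h4 : ∀ x ∈ X, ∀ x' ∈ X, x ≠ x' → (Y.filter fun y => R x y ∧ R x' y).card + 1 = t) :
    X.card = s + 1 ∧ Y.card = s + 1 ∧ t = s := by
  have key : ∀ (X Y : Finset V) (R : V → V → Prop) (s t : ℕ), Y.Nonempty →
      (∀ y ∈ Y, (X.filter fun x => R x y).card = s) →
      (∀ y ∈ Y, ∀ y' ∈ Y, y ≠ y' → (X.filter fun x => R x y ∧ R x y').card + 1 = s) →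
      (∀ x ∈ X, (Y.filter fun y => R x y).card = t) → s * t + Y.card = Y.card * s + 1 := by
    intro X Y R s t ⟨y, hy⟩ h1 h2 h3
    have e := Finset.sum_card_bipartiteAbove_eq_sum_card_bipartiteBelow
      (s := X.filter fun x => R x y) (t := Y) R
    simp only [Finset.bipartiteAbove, Finset.bipartiteBelow] at e
    rw [Finset.sum_congr rfl (fun x hx => h3 x (Finset.mem_filter.mp hx).1), Finset.sum_const,
      h1 y hy, smul_eq_mul] at e
    rw [e, ← Finset.add_sum_erase _ _ hy]
    have e1 : ∀ y' ∈ Y.erase y,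
        ((X.filter fun x => R x y).filter fun x => R x y').card + 1 = s := by
      intro y' hy'
      rw [Finset.filter_filter]
      exact h2 y hy y' (Finset.mem_of_mem_erase hy') (Finset.ne_of_mem_erase hy').symm
    have e2 : ∑ y' ∈ Y.erase y, (((X.filter fun x => R x y).filter fun x => R x y').card + 1)
        = (Y.erase y).card * s := by
      rw [Finset.sum_congr rfl e1, Finset.sum_const, smul_eq_mul]
    rw [Finset.sum_add_distrib, Finset.sum_const, smul_eq_mul, mul_one] at e2
    rw [Finset.filter_filter]
    simp only [and_self]
    rw [h1 y hy]
    have hc : (Y.erase y).card + 1 = Y.card := Finset.card_erase_add_one hy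
    rw [← hc, add_mul]
    omega
  have e1 := key X Y R s t hY h1 h2 h3
  have e2 := key Y X (fun y x => R x y) t s hX h3 h4 h1
  have e3 := Finset.sum_card_bipartiteAbove_eq_sum_card_bipartiteBelow (s := X) (t := Y) R
  simp only [Finset.bipartiteAbove, Finset.bipartiteBelow] at e3
  rw [Finset.sum_congr rfl h3, Finset.sum_congr rfl h1, Finset.sum_const, Finset.sum_const,
    smul_eq_mul, smul_eq_mul] at e3
  rw [mul_comm t s] at e2
  have hXY : X.card = Y.card := by omega
  have hY0 : 0 < Y.card := hY.card_pos
  have hts : t = s := by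
    rw [hXY] at e3
    exact Nat.eq_of_mul_eq_mul_left hY0 e3
  subst hts
  have : Y.card = t + 1 := by
    obtain ⟨k, rfl⟩ := Nat.exists_eq_add_of_le hs
    have h5 : (k + 1) * Y.card = (k + 1) * (k + 3) := by nlinarith
    have := Nat.eq_of_mul_eq_mul_left (by omega) h5
    omega
  exact ⟨by omega, this, rfl⟩

variable {V : Type*} [Fintype V]

namespace IsCliqueBlowup

variable {G : SimpleGraph V} {p q : V → ℝ} {S : V → Prop}

theorem twinCard_le_card_crossNbrs (h : IsCliqueBlowup G p q S) {u v : V} (huv : G.Adj u v)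
    (hS : ¬ (S u ↔ S v)) : twinCard G u ≤ (crossNbrs G v).card := by
  apply Finset.card_le_card
  intro z hz
  simp only [Finset.mem_filter, Finset.mem_univ, true_and] at hz
  have hz' := h.side_of_twin hz
  have hvz : v ≠ z := by
    rintro rfl
    exact hS hz'
  rw [h.mem_crossNbrs]
  exact ⟨((hz.adj_iff huv.ne' hvz).mp huv).symm, by tauto⟩

/-- If the vectors of `u` and `y`, on different sides, are perpendicular, then no vector on the
side of `u` is perpendicular to that of `u`: it would be parallel to that of `y`. -/
theorem inner_same_pos (h : IsCliqueBlowup G p q S) {u y v : V} (hy : ¬ S y)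
    (huy : planarInner p q u y = 0) (hv : S v) : 0 < planarInner p q v u := by
  refine lt_of_le_of_ne (h.inner_nonneg v u) fun h0 => ?_
  refine h.det_cross_ne_zero (u := v) (v := y) (by tauto)
    (planarDet_eq_zero_of_perp (h.pos u) h0.symm ?_)
  rw [planarInner_comm, huy]

/-- A vertex whose vector is not on the boundary is adjacent to the whole other side. -/
theorem inner_pos_of_interior (h : IsCliqueBlowup G p q S) {u y : V} (hu : S u)
    (huy : planarInner p q u y = 0) {v z : V} (hvy : planarInner p q v y ≠ 0)
    (hz : ¬ S z) : 0 < planarInner p q v z := by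
  have hvy' : 0 < planarInner p q v y := lt_of_le_of_ne (h.inner_nonneg v y) hvy.symm
  have hzy : 0 < planarInner p q z y :=
    h.compl.inner_same_pos (not_not.mpr hu) (by rw [planarInner_comm, huy]) hz
  have e := planarInner_expand huy v z
  have h1 : 0 ≤ planarInner p q v u * planarInner p q z u * planarInner p q y y :=
    mul_nonneg (mul_nonneg (h.inner_nonneg _ _) (h.inner_nonneg _ _)) (h.inner_nonneg _ _)
  have h2 : 0 < planarInner p q v y * planarInner p q z y * planarInner p q u u :=
    mul_pos (mul_pos hvy' hzy) (h.pos u)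
  have h3 : 0 < planarInner p q v z * (planarInner p q u u * planarInner p q y y) := by
    rw [← mul_assoc]; linarith
  exact pos_of_mul_pos_left h3 (mul_pos (h.pos u) (h.pos y)).le

theorem adj_of_inner_cross_pos (h : IsCliqueBlowup G p q S) {v z : V} (hS : ¬ (S v ↔ S z))
    (hpos : 0 < planarInner p q v z) : G.Adj v z := by
  by_contra hn
  exact hpos.ne' (h.inner_cross_of_not_adj hn hS)

/-- There cannot be interior vectors on both sides. -/
theorem not_interior_both (h : IsCliqueBlowup G p q S) {u y : V} (hu : S u) (hy : ¬ S y)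
    (huy : planarInner p q u y = 0) {v z : V} (hv : S v) (hvy : planarInner p q v y ≠ 0)
    (hz : ¬ S z) (hzu : planarInner p q z u ≠ 0) : False := by
  have huy' : planarInner p q y u = 0 := by rw [planarInner_comm, huy]
  have hvz : G.Adj v z := h.adj_of_inner_cross_pos (by tauto)
    (h.inner_pos_of_interior hu huy hvy hz)
  have hvadj : ∀ y', ¬ S y' → G.Adj v y' := fun y' hy' => h.adj_of_inner_cross_pos (by tauto)
    (h.inner_pos_of_interior hu huy hvy hy')
  have hzadj : ∀ u', S u' → G.Adj z u' := fun u' hu' => h.adj_of_inner_cross_pos (by tauto)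
    (h.compl.inner_pos_of_interior hy huy' hzu (not_not.mpr hu'))
  have tzy : ¬ Twin G z y := by
    intro ht
    obtain ⟨h1, h2⟩ := h.eq_of_twin ht
    exact hzu (by rw [← huy']; simp only [planarInner, h1, h2])
  have tvu : ¬ Twin G v u := by
    intro ht
    obtain ⟨h1, h2⟩ := h.eq_of_twin ht
    exact hvy (by rw [← huy]; simp only [planarInner, h1, h2])
  have e := planarInner_expand huy v z
  have i1 : planarInner p q v u = (crossNbrs G u).card := by
    rw [h.inner_same (by tauto) tvu, Finset.inter_eq_right.mpr]
    intro x hx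
    rw [h.mem_crossNbrs] at hx ⊢
    exact ⟨hvadj x (by tauto), by tauto⟩
  have i2 : planarInner p q z y = (crossNbrs G y).card := by
    rw [h.inner_same (by tauto) tzy, Finset.inter_eq_right.mpr]
    intro x hx
    rw [h.mem_crossNbrs] at hx ⊢
    exact ⟨hzadj x (by tauto), by tauto⟩
  have i3 := h.inner_cross_of_adj (hvadj y hy) (by tauto)
  have i4 := h.inner_cross_of_adj (hzadj u hu) (by tauto)
  have i5 := h.inner_cross_of_adj hvz (by tauto)
  have i6 := h.inner_self_eq u
  have i7 := h.inner_self_eq y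
  have p3 : 0 < planarInner p q v y := lt_of_le_of_ne (h.inner_nonneg v y) hvy.symm
  have p4 : 0 < planarInner p q z u := lt_of_le_of_ne (h.inner_nonneg z u) hzu.symm
  have p6 := h.pos u
  have p7 := h.pos y
  have b1 : (twinCard G v : ℝ) ≤ (crossNbrs G y).card := by
    exact_mod_cast h.twinCard_le_card_crossNbrs (hvadj y hy) (by tauto)
  have b2 : (twinCard G z : ℝ) ≤ (crossNbrs G u).card := by
    exact_mod_cast h.twinCard_le_card_crossNbrs (hzadj u hu) (by tauto)
  have n1 := one_le_twinCard G y
  have n2 := one_le_twinCard G u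
  have n3 := one_le_twinCard G v
  have n4 := one_le_twinCard G z
  rw [i1, i2] at e
  rw [i3] at p3 e
  rw [i4] at p4 e
  rw [i5] at e
  rw [i6] at p6 e
  rw [i7] at p7 e
  -- the inner product of `v` and `z` is `(twinCard G v - 1) + (twinCard G z - 1)`, and in the
  -- orthogonal basis each coordinate contributes more than one of these summands
  have key : ∀ (w w' : ℕ) (ν : ℝ), 1 ≤ w' → 1 ≤ w → (w : ℝ) ≤ ν → (0 : ℝ) < w + w' - 2 →
      0 < ((w : ℝ) + w' - 2) * ν - (w - 1) * (w' - 2 + ν) := by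
    intro w w' ν hw' hw hwν hpos
    rcases Nat.lt_or_ge w' 2 with hlt | hge
    · obtain rfl : w' = 1 := by omega
      push_cast at hpos ⊢
      nlinarith
    · have h2 : (2 : ℝ) ≤ w' := by exact_mod_cast hge
      have h1 : (1 : ℝ) ≤ w := by exact_mod_cast hw
      nlinarith [mul_nonneg (by linarith : (0 : ℝ) ≤ w' - 2) (by linarith : (0 : ℝ) ≤ ν - w)]
  have k1 := mul_pos (key _ _ _ n1 n3 b1 p3) p6
  have k2 := mul_pos (key _ _ _ n2 n4 b2 p4) p7
  nlinarith

end IsCliqueBlowup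

end Perpendicular

/-! ### A boundary vector on one side only -/

section Interior

open scoped Classical

variable {V : Type*} [Fintype V]

/-- The combinatorial structure of the graphs of type (vi): the side `S` consists of a clique of
order `a` and a coclique `T` of order `m`, the other side is a coclique of order `m` joined to the
clique, and between the two cocliques only a perfect matching is missing. -/
structure IsCliqueCoclique (G : SimpleGraph V) (S T : V → Prop) (a m : ℕ) : Prop where
  sub : ∀ {v}, T v → S v
  clique : ∀ {u v}, S u → S v → ¬ T u → ¬ T v → u ≠ v → G.Adj u v
  join : ∀ {u v}, S u → ¬ T u → ¬ S v → G.Adj u v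
  not_adj_mixed : ∀ {u v}, S u → ¬ T u → T v → ¬ G.Adj u v
  not_adj_left : ∀ {u v}, T u → T v → ¬ G.Adj u v
  not_adj_right : ∀ {u v}, ¬ S u → ¬ S v → ¬ G.Adj u v
  existsUnique_left : ∀ {u}, T u → ∃! v, ¬ S v ∧ ¬ G.Adj u v
  existsUnique_right : ∀ {v}, ¬ S v → ∃! u, T u ∧ ¬ G.Adj u v
  card_clique : (Finset.univ.filter fun v => S v ∧ ¬ T v).card = a
  card_left : (Finset.univ.filter fun v => T v).card = m
  card_right : (Finset.univ.filter fun v => ¬ S v).card = m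

theorem existsUnique_of_card_filter {V : Type*} {Y : Finset V} {P : V → Prop} {s : ℕ}
    (hY : Y.card = s + 1) (h : (Y.filter P).card = s) : ∃! v, v ∈ Y ∧ ¬ P v := by
  have h1 := Finset.card_filter_add_card_filter_not (s := Y) P
  have h2 : (Y.filter fun v => ¬ P v).card = 1 := by omega
  obtain ⟨v, hv⟩ := Finset.card_eq_one.mp h2
  refine ⟨v, ?_, fun z hz => ?_⟩
  · exact Finset.mem_filter.mp (hv ▸ Finset.mem_singleton_self v)
  · exact Finset.mem_singleton.mp (hv ▸ Finset.mem_filter.mpr hz)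

/-- The equation forces `k + 4 ≤ Y`, and then its left side is too large. It arises from an interior
vertex in a clique of order `2`, by computing the length of its vector in an orthogonal basis. -/
theorem no_pair_of_norm_eq {Y k n : ℕ}
    (h : (Y * (k + 1)) * (n + 3) = (k + 2) ^ 2 * (n + 3) + (k + 1)) : False := by
  have hYk : k + 4 ≤ Y := by
    by_contra hcon
    have : (Y * (k + 1)) * (n + 3) ≤ ((k + 3) * (k + 1)) * (n + 3) :=
      Nat.mul_le_mul_right _ (Nat.mul_le_mul_right _ (by omega))
    nlinarith
  obtain ⟨j, rfl⟩ := Nat.exists_eq_add_of_le hYk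
  have h1 : j * (k + 1) * (n + 3) + k * (n + 3) = k + 1 := by nlinarith
  rcases Nat.eq_zero_or_pos k with rfl | hk
  · rcases Nat.eq_zero_or_pos j with rfl | hj <;> nlinarith
  · nlinarith [Nat.zero_le (j * (k + 1) * (n + 3)), Nat.zero_le (k * n)]

/-- Two clique orders, both at least `3`, that satisfy the relations below would each have to be
larger than the other. -/
theorem no_two_cliques {N M a b : ℝ} (hN : 0 < N) (hM : 0 < M) (ha : 3 ≤ a) (hb : 3 ≤ b)
    (f1 : (a - 2) * (N * M) = (a - 1) * (a - b) * N)
    (f2 : (b - 2) * (N * M) = (b - 1) * (b - a) * N) : False := by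
  have p1 := mul_pos hN hM
  have g1 : 0 < (a - 1) * (a - b) * N := by
    rw [← f1]; exact mul_pos (by linarith) p1
  have g2 : 0 < (b - 1) * (b - a) * N := by
    rw [← f2]; exact mul_pos (by linarith) p1
  have g3 : 0 < a - b :=
    pos_of_mul_pos_right (pos_of_mul_pos_left g1 hN.le) (by linarith)
  have g4 : 0 < b - a :=
    pos_of_mul_pos_right (pos_of_mul_pos_left g2 hN.le) (by linarith)
  linarith

namespace IsCliqueBlowup

variable {G : SimpleGraph V} {p q : V → ℝ} {S : V → Prop}

theorem common_eq_card_crossNbrs {v : V} (hv : twinCard G v = 1) :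
    common G v v = (crossNbrs G v).card := by
  have := common_self_eq G v
  omega

/-- Adjacent vertices on different sides with perpendicular vectors have no twins. -/
theorem twinCard_eq_one_of_perp (h : IsCliqueBlowup G p q S) {u v : V} (huv : G.Adj u v)
    (hS : ¬ (S u ↔ S v)) (h0 : planarInner p q u v = 0) :
    twinCard G u = 1 ∧ twinCard G v = 1 := by
  rw [h.inner_cross_of_adj huv hS] at h0
  have h1 := one_le_twinCard G u
  have h2 := one_le_twinCard G v
  have : twinCard G u + twinCard G v = 2 := by
    have : (twinCard G u : ℝ) + twinCard G v = 2 := by linarith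
    exact_mod_cast this
  omega

set_option maxHeartbeats 1000000 in
/-- Let `u₀` and `y₀`, on different sides, have perpendicular vectors, and let all vectors of the
other side be parallel to that of `y₀`, while some vector on the side `S` is not perpendicular to
it. The vertices of `S` whose vectors are perpendicular to the other side form the coclique `T`,
and the remaining ones turn out to form a single clique. The cocliques `T` and `Sᶜ` form a
configuration as in `card_eq_of_near_design`. -/
theorem isCliqueCoclique (h : IsCliqueBlowup G p q S) {u₀ y₀ v₀ : V} (hu₀ : S u₀)
    (h₀ : planarInner p q u₀ y₀ = 0) (hv₀ : S v₀) (hv₀y : planarInner p q v₀ y₀ ≠ 0)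
    (hno : ∀ z, ¬ S z → planarInner p q z u₀ = 0) :
    ∃ T a m, IsCliqueCoclique G S T a m ∧ ((a = 3 ∧ m = 5) ∨ (a = 4 ∧ m = 4)) := by
  -- `T u`: the vector of `u` is perpendicular to the (parallel) vectors of the other side
  set T : V → Prop := fun u => S u ∧ planarInner p q u y₀ = 0 with hT
  have hTu₀ : T u₀ := ⟨hu₀, h₀⟩
  have hpar : ∀ y y', ¬ S y → ¬ S y' → planarDet p q y y' = 0 := fun y y' hy hy' =>
    planarDet_eq_zero_of_perp (h.pos u₀) (hno y hy) (hno y' hy')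
  have hTperp : ∀ u y, T u → ¬ S y → planarInner p q u y = 0 := by
    intro u y hu hy
    have e := planarInner_expand h₀ u y
    rw [hu.2, hno y hy, mul_zero, zero_mul, zero_mul, zero_mul, zero_add, mul_assoc] at e
    exact (mul_eq_zero.mp e).resolve_right (mul_pos (h.pos _) (h.pos _)).ne'
  have hintpos : ∀ u y, S u → ¬ T u → ¬ S y → 0 < planarInner p q u y := by
    intro u y hu hTu hy
    exact h.inner_pos_of_interior hu₀ h₀ (fun h0 => hTu ⟨hu, h0⟩) hy
  have hjoin : ∀ u y, S u → ¬ T u → ¬ S y → G.Adj u y := fun u y hu hTu hy =>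
    h.adj_of_inner_cross_pos (by tauto) (hintpos u y hu hTu hy)
  have hTpar : ∀ u u', T u → T u' → planarDet p q u u' = 0 := fun u u' hu hu' =>
    planarDet_eq_zero_of_perp (h.pos y₀) hu.2 hu'.2
  have hTtwin : ∀ u u', Twin G u u' → T u → T u' := by
    intro u u' ht hu
    obtain ⟨h1, h2⟩ := h.eq_of_twin ht
    refine ⟨(h.side_of_twin ht).mp hu.1, ?_⟩
    rw [← hu.2]
    simp only [planarInner, h1, h2]
  have hTadj : ∀ u y, T u → G.Adj u y → ¬ S y → twinCard G u = 1 ∧ twinCard G y = 1 := by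
    intro u y hu huy hy
    exact h.twinCard_eq_one_of_perp huy (by have := hu.1; tauto) (hTperp u y hu hy)
  have hTcross : ∀ u, T u → ∃ y, G.Adj u y ∧ ¬ S y := by
    intro u hu
    obtain ⟨y, hy, hS⟩ := h.exists_cross u
    exact ⟨y, hy, by have := hu.1; tauto⟩
  have hT1 : ∀ u, T u → twinCard G u = 1 := by
    intro u hu
    obtain ⟨y, hy, hS⟩ := hTcross u hu
    exact (hTadj u y hu hy hS).1
  have hv₀T : ¬ T v₀ := fun h' => hv₀y h'.2
  -- the neighbours of the vertices on the other side
  have hnbr : ∀ y, ¬ S y → crossNbrs G y = (Finset.univ.filter fun v => S v ∧ ¬ T v) ∪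
      ((Finset.univ.filter fun v => T v).filter fun v => G.Adj v y) := by
    intro y hy
    ext z
    simp only [h.mem_crossNbrs, Finset.mem_union, Finset.mem_filter, Finset.mem_univ, true_and]
    constructor
    · rintro ⟨hyz, hS⟩
      by_cases hz : T z
      exacts [Or.inr ⟨hz, hyz.symm⟩, Or.inl ⟨by tauto, hz⟩]
    · rintro (⟨hz, hzT⟩ | ⟨hz, hzy⟩)
      · exact ⟨(hjoin z y hz hzT hy).symm, by tauto⟩
      · exact ⟨hzy.symm, by have := hz.1; tauto⟩
  set P := (Finset.univ.filter fun v => S v ∧ ¬ T v).card with hP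
  set s : V → ℕ := fun y => ((Finset.univ.filter fun v => T v).filter fun v => G.Adj v y).card
    with hs
  have hcard : ∀ y, ¬ S y → (crossNbrs G y).card = P + s y := by
    intro y hy
    rw [hnbr y hy, Finset.card_union_of_disjoint]
    rw [Finset.disjoint_left]
    intro z hz hz'
    simp only [Finset.mem_filter] at hz hz'
    exact hz.2.2 hz'.1.2
  have hcard2 : ∀ y y', ¬ S y → ¬ S y' → (crossNbrs G y ∩ crossNbrs G y').card
      = P + ((Finset.univ.filter fun v => T v).filter fun v => G.Adj v y ∧ G.Adj v y').card := by
    intro y y' hy hy'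
    rw [hnbr y hy, hnbr y' hy', hP, ← Finset.card_union_of_disjoint]
    · congr 1
      ext z
      simp only [Finset.mem_union, Finset.mem_inter, Finset.mem_filter, Finset.mem_univ, true_and]
      tauto
    · rw [Finset.disjoint_left]
      intro z hz hz'
      simp only [Finset.mem_filter] at hz hz'
      exact hz.2.2 hz'.1.2
  have hwP : twinCard G v₀ ≤ P := by
    apply Finset.card_le_card
    intro z hz
    simp only [Finset.mem_filter, Finset.mem_univ, true_and] at hz ⊢
    exact ⟨(h.side_of_twin hz).mp hv₀, fun hz' => hv₀T (hTtwin _ _ hz.symm hz')⟩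
  obtain ⟨y₁, hy₁adj, hy₁⟩ := hTcross u₀ hTu₀
  obtain ⟨hwu₀, hwy₁⟩ := hTadj u₀ y₁ hTu₀ hy₁adj hy₁
  have hw2 : ∀ u, S u → ¬ T u → 2 ≤ twinCard G u := by
    intro u hu hTu
    have := hintpos u y₁ hu hTu hy₁
    rw [h.inner_cross_of_adj (hjoin u y₁ hu hTu hy₁) (by tauto), hwy₁] at this
    have : (1 : ℝ) < twinCard G u := by push_cast at this; linarith
    exact_mod_cast this
  have hP2 : 2 ≤ P := (hw2 v₀ hv₀ hv₀T).trans hwP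
  have hs1 : ∀ y u, T u → G.Adj u y → 1 ≤ s y := by
    intro y u hu huy
    exact Finset.card_pos.mpr ⟨u, by simp [hu, huy]⟩
  -- two different neighbours of a vertex of `T`
  have hdeg : ∀ y y', ¬ S y → ¬ S y' → twinCard G y = 1 → twinCard G y' = 1 → 1 ≤ s y → 1 ≤ s y' →
      y ≠ y' → s y = s y' ∧
      ((Finset.univ.filter fun v => T v).filter fun v => G.Adj v y ∧ G.Adj v y').card + 1
        = s y := by
    intro y y' hy hy' hw hw' hsy hsy' hne
    have ht : ¬ Twin G y y' := fun ht => hne (eq_of_twin_of_twinCard_eq_one ht hw)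
    have c1 := common_eq_card_crossNbrs hw
    have c2 := common_eq_card_crossNbrs hw'
    have c3 := h.inner_same (by tauto) ht
    rw [h.inner_of_ne hne] at c3
    have c3 : common G y y' = (crossNbrs G y ∩ crossNbrs G y').card := by exact_mod_cast c3
    rw [hcard y hy] at c1
    rw [hcard y' hy'] at c2
    rw [hcard2 y y' hy hy'] at c3
    rcases le_total (common G y y) (common G y' y') with hle | hle
    · rcases h.parallel hne (hpar y y' hy hy') hle with h' | h' <;> omega
    · have := h.parallel hne.symm (hpar y' y hy' hy) hle
      rw [common_comm G y' y] at this
      rcases this with h' | h' <;> omega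
  have hν : ∀ u, T u → 2 ≤ (crossNbrs G u).card := by
    intro u hu
    rw [← common_eq_card_crossNbrs (hT1 u hu)]
    exact h.two_le_common_self u
  have hs2 : 2 ≤ s y₁ := by
    obtain ⟨y₂, hy₂, hne⟩ := Finset.exists_mem_ne (hν u₀ hTu₀) y₁
    rw [h.mem_crossNbrs] at hy₂
    have hy₂S : ¬ S y₂ := by tauto
    obtain ⟨-, e⟩ := hdeg y₁ y₂ hy₁ hy₂S hwy₁ (hTadj u₀ y₂ hTu₀ hy₂.1 hy₂S).2
      (hs1 y₁ u₀ hTu₀ hy₁adj) (hs1 y₂ u₀ hTu₀ hy₂.1) hne.symm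
    have : 0 < ((Finset.univ.filter fun v => T v).filter
        fun v => G.Adj v y₁ ∧ G.Adj v y₂).card :=
      Finset.card_pos.mpr ⟨u₀, by simp [hTu₀, hy₁adj, hy₂.1]⟩
    omega
  -- the norm of an interior vector in the orthogonal basis
  set Y := (Finset.univ.filter fun v => ¬ S v).card with hY
  have hcrossint : ∀ v, S v → ¬ T v → crossNbrs G v = Finset.univ.filter fun v => ¬ S v := by
    intro v hv hvT
    ext z
    simp only [h.mem_crossNbrs, Finset.mem_filter, Finset.mem_univ, true_and]
    exact ⟨fun hz => by tauto, fun hz => ⟨hjoin v z hv hvT hz, by tauto⟩⟩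
  have hnorm : ∀ v u, S v → ¬ T v → T u → ((twinCard G v : ℝ) - 2 + Y)
      * ((crossNbrs G u).card - 1) * (P + s y₁ - 1)
      = (crossNbrs G u).card ^ 2 * (P + s y₁ - 1)
        + (twinCard G v - 1) ^ 2 * ((crossNbrs G u).card - 1) := by
    intro v u hv hvT hu
    have e := planarInner_expand (hTperp u y₁ hu hy₁) v v
    have ht : ¬ Twin G v u := fun ht => hvT (hTtwin _ _ ht.symm hu)
    rw [h.inner_self_eq, h.inner_self_eq, h.inner_self_eq, hT1 u hu, hwy₁,
      h.inner_same (by have := hu.1; tauto) ht,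
      h.inner_cross_of_adj (hjoin v y₁ hv hvT hy₁) (by tauto), hwy₁, hcrossint v hv hvT,
      hcard y₁ hy₁, Finset.inter_eq_right.mpr] at e
    · push_cast at e
      linear_combination e
    · intro z hz
      rw [h.mem_crossNbrs] at hz
      have := hu.1
      simp only [Finset.mem_filter, Finset.mem_univ, true_and]
      tauto
  -- a clique of order 2 is too small
  have hw3 : ∀ v, S v → ¬ T v → twinCard G v ≠ 2 := by
    intro v hv hvT hw
    have e := hnorm v u₀ hv hvT hTu₀
    rw [hw] at e
    obtain ⟨k, hk⟩ := Nat.exists_eq_add_of_le (hν u₀ hTu₀)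
    obtain ⟨n, hn⟩ : ∃ n, P + s y₁ = n + 4 := ⟨P + s y₁ - 4, by omega⟩
    have hn' : (P : ℝ) + s y₁ = n + 4 := by exact_mod_cast hn
    rw [hk] at e
    have e2 : ((Y : ℝ) * (k + 1)) * (n + 3) = (k + 2) ^ 2 * (n + 3) + (k + 1) := by
      have : (P : ℝ) + s y₁ - 1 = n + 3 := by linarith
      rw [this] at e
      push_cast at e
      linear_combination e
    have e3 : (Y * (k + 1)) * (n + 3) = (k + 2) ^ 2 * (n + 3) + (k + 1) := by exact_mod_cast e2
    exact no_pair_of_norm_eq e3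
  have hTwint : ∀ u v, S u → S v → ¬ T u → ¬ T v → Twin G u v := by
    intro u v hu hv hTu hTv
    by_contra ht
    have e1 := planarInner_expand (hTperp u₀ y₁ hTu₀ hy₁) u u
    have e2 := planarInner_expand (hTperp u₀ y₁ hTu₀ hy₁) u v
    have e3 := planarInner_expand (hTperp u₀ y₁ hTu₀ hy₁) v v
    have t1 : ¬ Twin G u u₀ := fun ht => hTu (hTtwin _ _ ht.symm hTu₀)
    have t2 : ¬ Twin G v u₀ := fun ht => hTv (hTtwin _ _ ht.symm hTu₀)
    have hsub : (Finset.univ.filter fun v => ¬ S v) ∩ crossNbrs G u₀ = crossNbrs G u₀ := by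
      rw [Finset.inter_eq_right]
      intro z hz
      rw [h.mem_crossNbrs] at hz
      simp only [Finset.mem_filter, Finset.mem_univ, true_and]
      tauto
    rw [h.inner_self_eq u, h.inner_same (by tauto) t1, hcrossint u hu hTu, hsub,
      h.inner_cross_of_adj (hjoin u y₁ hu hTu hy₁) (by tauto), hwy₁] at e1
    rw [h.inner_self_eq v, h.inner_same (by tauto) t2, hcrossint v hv hTv, hsub,
      h.inner_cross_of_adj (hjoin v y₁ hv hTv hy₁) (by tauto), hwy₁] at e3
    rw [h.inner_same (by tauto) ht, hcrossint u hu hTu, hcrossint v hv hTv, Finset.inter_self,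
      h.inner_same (by tauto) t1, h.inner_same (by tauto) t2, hcrossint v hv hTv,
      hcrossint u hu hTu, hsub,
      h.inner_cross_of_adj (hjoin v y₁ hv hTv hy₁) (by tauto),
      h.inner_cross_of_adj (hjoin u y₁ hu hTu hy₁) (by tauto), hwy₁] at e2
    have a1 : (3 : ℝ) ≤ twinCard G u := by
      have := hw2 u hu hTu
      have := hw3 u hu hTu
      have : 3 ≤ twinCard G u := by omega
      exact_mod_cast this
    have a2 : (3 : ℝ) ≤ twinCard G v := by
      have := hw2 v hv hTv
      have := hw3 v hv hTv
      have : 3 ≤ twinCard G v := by omega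
      exact_mod_cast this
    push_cast at e1 e2 e3
    exact no_two_cliques (h.pos u₀) (h.pos y₁) a1 a2 (by linear_combination e1 - e2)
      (by linear_combination e3 - e2)
  have hPw : P = twinCard G v₀ := by
    rw [hP, twinCard]
    congr 1
    ext z
    simp only [Finset.mem_filter, Finset.mem_univ, true_and]
    exact ⟨fun hz => hTwint v₀ z hv₀ hz.1 hv₀T hz.2, fun hz =>
      ⟨(h.side_of_twin hz).mp hv₀, fun hz' => hv₀T (hTtwin _ _ hz.symm hz')⟩⟩
  have hP3 : 3 ≤ P := by
    have := hw3 v₀ hv₀ hv₀T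
    omega
  -- every vertex on the other side has a neighbour in `T`
  have hsY : ∀ y, ¬ S y → ∃ u, T u ∧ G.Adj u y := by
    intro y hy
    by_contra hcon
    push Not at hcon
    have hs0 : s y = 0 := by
      rw [hs, Finset.card_eq_zero, Finset.filter_eq_empty_iff]
      intro z hz
      exact hcon z (Finset.mem_filter.mp hz).2
    have hne : y ≠ y₁ := by
      rintro rfl
      omega
    have ht : ¬ Twin G y y₁ := fun ht => hne (eq_of_twin_of_twinCard_eq_one ht.symm hwy₁).symm
    have c1 := common_self_eq G y
    have c2 := common_eq_card_crossNbrs hwy₁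
    have c3 := h.inner_same (by tauto) ht
    rw [h.inner_of_ne hne] at c3
    have c3 : common G y y₁ = (crossNbrs G y ∩ crossNbrs G y₁).card := by exact_mod_cast c3
    have c4 : ((Finset.univ.filter fun v => T v).filter
        fun v => G.Adj v y ∧ G.Adj v y₁).card ≤ s y :=
      Finset.card_le_card fun z hz => by
        simp only [Finset.mem_filter] at hz ⊢
        exact ⟨hz.1, hz.2.1⟩
    have c5 := one_le_twinCard G y
    rw [hcard y hy] at c1
    rw [hcard y₁ hy₁] at c2
    rw [hcard2 y y₁ hy hy₁] at c3
    rcases le_total (common G y y) (common G y₁ y₁) with hle | hle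
    · rcases h.parallel hne (hpar y y₁ hy hy₁) hle with h' | h' <;> omega
    · have := h.parallel hne.symm (hpar y₁ y hy₁ hy) hle
      rw [common_comm G y₁ y] at this
      rcases this with h' | h' <;> omega
  have hwY : ∀ y, ¬ S y → twinCard G y = 1 := by
    intro y hy
    obtain ⟨u, hu, huy⟩ := hsY y hy
    exact (hTadj u y hu huy hy).2
  have hsY1 : ∀ y, ¬ S y → 1 ≤ s y := by
    intro y hy
    obtain ⟨u, hu, huy⟩ := hsY y hy
    exact hs1 y u hu huy
  have hsall : ∀ y, ¬ S y → s y = s y₁ := by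
    intro y hy
    by_cases hne : y = y₁
    · rw [hne]
    · exact (hdeg y y₁ hy hy₁ (hwY y hy) hwy₁ (hsY1 y hy) (hsY1 y₁ hy₁) hne).1
  -- all vertices of `T` have the same degree
  have hνall : ∀ u, T u → (crossNbrs G u).card = (crossNbrs G u₀).card := by
    intro u hu
    have e1 := hnorm v₀ u hv₀ hv₀T hu
    have e2 := hnorm v₀ u₀ hv₀ hv₀T hTu₀
    obtain ⟨k, hk⟩ := Nat.exists_eq_add_of_le (hν u hu)
    obtain ⟨l, hl⟩ := Nat.exists_eq_add_of_le (hν u₀ hTu₀)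
    rw [hk] at e1
    rw [hl] at e2
    have hpos : (0 : ℝ) < P + s y₁ - 1 := by
      have : (3 : ℝ) ≤ P := by exact_mod_cast hP3
      have : (2 : ℝ) ≤ s y₁ := by exact_mod_cast hs2
      linarith
    have e3 : ((k : ℝ) - l) * (k + l + k * l) * (P + s y₁ - 1) = 0 := by
      push_cast at e1 e2
      linear_combination (k + 1) * e2 - (l + 1) * e1
    have e4 := (mul_eq_zero.mp e3).resolve_right hpos.ne'
    rcases mul_eq_zero.mp e4 with e5 | e5
    · have : (k : ℝ) = l := by linarith
      have : k = l := by exact_mod_cast this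
      omega
    · have : k + l + k * l = 0 := by exact_mod_cast e5
      omega
  have hTnbr : ∀ u, T u → crossNbrs G u
      = (Finset.univ.filter fun v => ¬ S v).filter fun y => G.Adj u y := by
    intro u hu
    ext z
    have := hu.1
    simp only [h.mem_crossNbrs, Finset.mem_filter, Finset.mem_univ, true_and]
    tauto
  obtain ⟨r1, r2, r3⟩ := card_eq_of_near_design (Finset.univ.filter fun v => T v)
    (Finset.univ.filter fun v => ¬ S v) G.Adj (s := s y₁) (t := (crossNbrs G u₀).card)
    ⟨u₀, by simp [hTu₀]⟩ ⟨y₁, by simp [hy₁]⟩ hs2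
    (fun y hy => hsall y (Finset.mem_filter.mp hy).2)
    (fun y hy y' hy' hne => by
      have hy := (Finset.mem_filter.mp hy).2
      have hy' := (Finset.mem_filter.mp hy').2
      rw [← hsall y hy]
      exact (hdeg y y' hy hy' (hwY y hy) (hwY y' hy') (hsY1 y hy) (hsY1 y' hy') hne).2)
    (fun u hu => by
      have hu := (Finset.mem_filter.mp hu).2
      rw [← hTnbr u hu, hνall u hu])
    (fun u hu u' hu' hne => by
      have hu := (Finset.mem_filter.mp hu).2
      have hu' := (Finset.mem_filter.mp hu').2
      have ht : ¬ Twin G u u' := fun ht => hne (eq_of_twin_of_twinCard_eq_one ht (hT1 u hu))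
      have c1 := common_eq_card_crossNbrs (hT1 u hu)
      have c2 := common_eq_card_crossNbrs (hT1 u' hu')
      have c3 := h.inner_same (by have := hu.1; have := hu'.1; tauto) ht
      rw [h.inner_of_ne hne] at c3
      have c3 : common G u u' = (crossNbrs G u ∩ crossNbrs G u').card := by exact_mod_cast c3
      rw [hνall u hu] at c1
      rw [hνall u' hu'] at c2
      rw [hTnbr u hu, hTnbr u' hu', ← Finset.filter_and] at c3
      rcases h.parallel hne (hTpar u u' hu hu') (by omega) with h' | h' <;> omega)
  have hnot : ∀ u v, S u → S v → ¬ Twin G u v → ¬ G.Adj u v := fun u v hu hv ht hadj =>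
    ht (h.twin_of_adj hadj (by tauto))
  refine ⟨T, P, s y₁ + 1, ⟨fun hv => hv.1, ?_, fun {u v} hu hTu hv => hjoin u v hu hTu hv, ?_, ?_,
    ?_, ?_, ?_, by convert rfl, by convert r1, by convert r2⟩, ?_⟩
  · intro u v hu hv hTu hTv hne
    exact (hTwint u v hu hv hTu hTv).adj hne
  · intro u v hu hTu hv
    exact hnot u v hu hv.1 fun ht => hTu (hTtwin _ _ ht.symm hv)
  · intro u v hu hv hadj
    exact hnot u v hu.1 hv.1
      (fun ht => hadj.ne (eq_of_twin_of_twinCard_eq_one ht (hT1 u hu))) hadj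
  · intro u v hu hv hadj
    exact hadj.ne (eq_of_twin_of_twinCard_eq_one (h.twin_of_adj hadj (by tauto)) (hwY u hu))
  · intro u hu
    have := existsUnique_of_card_filter (P := fun y => G.Adj u y) r2
      (by rw [← hTnbr u hu, hνall u hu, r3])
    simpa using this
  · intro y hy
    have := existsUnique_of_card_filter (P := fun u => G.Adj u y) r1 (hsall y hy)
    simpa using this
  · have e := hnorm v₀ u₀ hv₀ hv₀T hTu₀
    rw [r3, ← hPw, show Y = s y₁ + 1 from r2] at e
    obtain ⟨z, hz⟩ := Nat.exists_eq_add_of_le hs2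
    obtain ⟨a, ha⟩ := Nat.exists_eq_add_of_le hP3
    rw [hz, ha] at e ⊢
    have e2 : (a + 3) * z = 2 * (z + 1) := by
      have hz1 : (z : ℝ) + 2 ≠ 0 := by positivity
      have : ((a : ℝ) + 3) * z = 2 * (z + 1) := by
        push_cast at e
        apply mul_left_cancel₀ hz1
        linear_combination e
      exact_mod_cast this
    have hz2 : z ≤ 2 := by nlinarith
    interval_cases z <;> omega

end IsCliqueBlowup

end Interior

/-! ### Bipartite graphs -/

section Bipartite

open scoped Classical

variable {V : Type*} [Fintype V]

/-- The structure of the complete bipartite graph with a perfect matching removed. -/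
structure IsCrown (G : SimpleGraph V) (S : V → Prop) (m : ℕ) : Prop where
  not_adj : ∀ {u v}, (S u ↔ S v) → ¬ G.Adj u v
  existsUnique_left : ∀ {u}, S u → ∃! v, ¬ S v ∧ ¬ G.Adj u v
  existsUnique_right : ∀ {v}, ¬ S v → ∃! u, S u ∧ ¬ G.Adj u v
  card_left : (Finset.univ.filter fun v => S v).card = m
  card_right : (Finset.univ.filter fun v => ¬ S v).card = m

/-- The structure of the bipartite graphs with vertex degrees 2 and 5: the vertices of degree 5 on
either side are the vertices satisfying `T`, and `a`, `b` count the vertices of degree 2 and 5 on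
each side. The numbers `k₂`, `k₅` count the neighbours of degree 5 of a vertex of degree 2 and
5. -/
structure IsTwoFive (G : SimpleGraph V) (S T : V → Prop) (a b k₂ k₅ : ℕ) : Prop where
  not_adj : ∀ {u v}, (S u ↔ S v) → ¬ G.Adj u v
  card_nbrs₂ : ∀ {u}, ¬ T u → (Finset.univ.filter fun v => (¬ (S u ↔ S v) ∧ ¬ T v) ∧
    G.Adj u v).card + k₂ = 2
  card_nbrs₅ : ∀ {u}, T u → (Finset.univ.filter fun v => (¬ (S u ↔ S v) ∧ ¬ T v) ∧
    G.Adj u v).card + k₅ = 5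
  card_nbrs₂' : ∀ {u}, ¬ T u → (Finset.univ.filter fun v => (¬ (S u ↔ S v) ∧ T v) ∧
    G.Adj u v).card = k₂
  card_nbrs₅' : ∀ {u}, T u → (Finset.univ.filter fun v => (¬ (S u ↔ S v) ∧ T v) ∧
    G.Adj u v).card = k₅
  card_left₂ : (Finset.univ.filter fun v => S v ∧ ¬ T v).card = a
  card_left₅ : (Finset.univ.filter fun v => S v ∧ T v).card = b
  card_right₂ : (Finset.univ.filter fun v => ¬ S v ∧ ¬ T v).card = a
  card_right₅ : (Finset.univ.filter fun v => ¬ S v ∧ T v).card = b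

namespace IsCliqueBlowup

variable {G : SimpleGraph V} {p q : V → ℝ} {S : V → Prop}

theorem not_adj_same (h : IsCliqueBlowup G p q S) (h1 : ∀ v, twinCard G v = 1) {u v : V}
    (hS : S u ↔ S v) : ¬ G.Adj u v := fun hadj =>
  hadj.ne (eq_of_twin_of_twinCard_eq_one (h.twin_of_adj hadj hS) (h1 u))

theorem two_le_card_crossNbrs (h : IsCliqueBlowup G p q S) (h1 : ∀ v, twinCard G v = 1) (v : V) :
    2 ≤ (crossNbrs G v).card := by
  rw [← common_eq_card_crossNbrs (h1 v)]
  exact h.two_le_common_self v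

/-- In the bipartite case, with parallel vectors on each side, `parallel` restricts the degrees of
two vertices on the same side and their number of common neighbours. -/
theorem card_inter_cases (h : IsCliqueBlowup G p q S) (h1 : ∀ v, twinCard G v = 1)
    (hpar : ∀ u v, (S u ↔ S v) → planarDet p q u v = 0) {u v : V} (hS : S u ↔ S v) (hne : u ≠ v) :
    ((crossNbrs G u).card = (crossNbrs G v).card ∧
      (crossNbrs G u ∩ crossNbrs G v).card + 1 = (crossNbrs G u).card) ∨
    ((crossNbrs G u).card = 2 ∧ (crossNbrs G v).card = 5 ∧
      (crossNbrs G u ∩ crossNbrs G v).card = 2) ∨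
    ((crossNbrs G u).card = 5 ∧ (crossNbrs G v).card = 2 ∧
      (crossNbrs G u ∩ crossNbrs G v).card = 2) := by
  have ht : ¬ Twin G u v := fun ht => hne (eq_of_twin_of_twinCard_eq_one ht (h1 u))
  have c1 := common_eq_card_crossNbrs (h1 u)
  have c2 := common_eq_card_crossNbrs (h1 v)
  have c3 := h.inner_same hS ht
  rw [h.inner_of_ne hne] at c3
  have c3 : common G u v = (crossNbrs G u ∩ crossNbrs G v).card := by exact_mod_cast c3
  rcases le_total (common G u u) (common G v v) with hle | hle
  · rcases h.parallel hne (hpar u v hS) hle with h' | h' <;> omega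
  · have := h.parallel hne.symm (hpar v u hS.symm) hle
    rw [common_comm G v u] at this
    rcases this with h' | h' <;> omega

/-- If degrees are constant on either side, the two sides form a configuration as in
`card_eq_of_near_design`. -/
theorem isCrown_of_regular (h : IsCliqueBlowup G p q S) (h1 : ∀ v, twinCard G v = 1)
    (hpar : ∀ u v, (S u ↔ S v) → planarDet p q u v = 0) [Nonempty V]
    (hreg : ∀ u v, (S u ↔ S v) → (crossNbrs G u).card = (crossNbrs G v).card) :
    ∃ m, 3 ≤ m ∧ IsCrown G S m := by
  have hinter : ∀ u v, (S u ↔ S v) → u ≠ v →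
      (crossNbrs G u ∩ crossNbrs G v).card + 1 = (crossNbrs G u).card := by
    intro u v hS hne
    have := hreg u v hS
    rcases h.card_inter_cases h1 hpar hS hne with h' | h' | h' <;> omega
  obtain ⟨x₀, y₀, hx₀, hy₀⟩ : ∃ x y, S x ∧ ¬ S y := by
    obtain ⟨v⟩ := ‹Nonempty V›
    obtain ⟨u, -, hu⟩ := h.exists_cross v
    by_cases hv : S v
    · exact ⟨v, u, hv, by tauto⟩
    · exact ⟨u, v, by tauto, hv⟩
  have hnx : ∀ x, S x → crossNbrs G x
      = (Finset.univ.filter fun v => ¬ S v).filter fun y => G.Adj x y := by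
    intro x hx
    ext z
    simp only [h.mem_crossNbrs, Finset.mem_filter, Finset.mem_univ, true_and]
    tauto
  have hny : ∀ y, ¬ S y → crossNbrs G y
      = (Finset.univ.filter fun v => S v).filter fun x => G.Adj x y := by
    intro x hx
    ext z
    simp only [h.mem_crossNbrs, Finset.mem_filter, Finset.mem_univ, true_and, G.adj_comm z x]
    tauto
  have hs := h.two_le_card_crossNbrs h1 y₀
  obtain ⟨r1, r2, r3⟩ := card_eq_of_near_design (Finset.univ.filter fun v => S v)
    (Finset.univ.filter fun v => ¬ S v) G.Adj (s := (crossNbrs G y₀).card)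
    (t := (crossNbrs G x₀).card) ⟨x₀, by simp [hx₀]⟩ ⟨y₀, by simp [hy₀]⟩ hs
    (fun y hy => by
      have hy := (Finset.mem_filter.mp hy).2
      rw [← hny y hy, hreg y y₀ (by tauto)])
    (fun y hy y' hy' hne => by
      have hy := (Finset.mem_filter.mp hy).2
      have hy' := (Finset.mem_filter.mp hy').2
      rw [Finset.filter_and, ← hny y hy, ← hny y' hy', hinter y y' (by tauto) hne,
        hreg y y₀ (by tauto)])
    (fun x hx => by
      have hx := (Finset.mem_filter.mp hx).2
      rw [← hnx x hx, hreg x x₀ (by tauto)])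
    (fun x hx x' hx' hne => by
      have hx := (Finset.mem_filter.mp hx).2
      have hx' := (Finset.mem_filter.mp hx').2
      rw [Finset.filter_and, ← hnx x hx, ← hnx x' hx', hinter x x' (by tauto) hne,
        hreg x x₀ (by tauto)])
  refine ⟨(crossNbrs G y₀).card + 1, by omega, h.not_adj_same h1, ?_, ?_, r1, r2⟩
  · intro u hu
    have := existsUnique_of_card_filter (P := fun y => G.Adj u y) r2
      (by rw [← hnx u hu, hreg u x₀ (by tauto), r3])
    simpa using this
  · intro y hy
    have := existsUnique_of_card_filter (P := fun u => G.Adj u y) r1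
      (by rw [← hny y hy, hreg y y₀ (by tauto)])
    simpa using this

/-- A count of the paths of length two starting at `x`. -/
theorem sum_card_inter (h : IsCliqueBlowup G p q S) (x : V) :
    ∑ x' ∈ (Finset.univ.filter fun v => S v ↔ S x).erase x,
        (crossNbrs G x ∩ crossNbrs G x').card + (crossNbrs G x).card
      = ∑ y ∈ crossNbrs G x, (crossNbrs G y).card := by
  have e := Finset.sum_card_bipartiteAbove_eq_sum_card_bipartiteBelow
    (s := crossNbrs G x) (t := Finset.univ.filter fun v => S v ↔ S x) G.Adj
  simp only [Finset.bipartiteAbove, Finset.bipartiteBelow] at e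
  have e1 : ∀ y ∈ crossNbrs G x, ((Finset.univ.filter fun v => S v ↔ S x).filter
      fun z => G.Adj y z) = crossNbrs G y := by
    intro y hy
    rw [h.mem_crossNbrs] at hy
    ext z
    simp only [h.mem_crossNbrs, Finset.mem_filter, Finset.mem_univ, true_and]
    tauto
  have e2 : ∀ x' ∈ (Finset.univ.filter fun v => S v ↔ S x),
      ((crossNbrs G x).filter fun y => G.Adj y x') = crossNbrs G x ∩ crossNbrs G x' := by
    intro x' hx'
    have hx' := (Finset.mem_filter.mp hx').2
    ext z
    simp only [h.mem_crossNbrs, Finset.mem_filter, Finset.mem_inter, G.adj_comm z x']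
    tauto
  rw [Finset.sum_congr rfl fun y hy => congrArg Finset.card (e1 y hy),
    Finset.sum_congr rfl fun y hy => congrArg Finset.card (e2 y hy)] at e
  rw [e, ← Finset.add_sum_erase _ _ (show x ∈ Finset.univ.filter fun v => S v ↔ S x by simp),
    Finset.inter_self, add_comm]

/-- Two different degrees on one side can only be 2 and 5, and then no other degree occurs there. -/
theorem card_eq_two_or_five (h : IsCliqueBlowup G p q S) (h1 : ∀ v, twinCard G v = 1)
    (hpar : ∀ u v, (S u ↔ S v) → planarDet p q u v = 0) {u v : V} (hS : S u ↔ S v)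
    (hne : (crossNbrs G u).card ≠ (crossNbrs G v).card) {z : V} (hz : S z ↔ S u) :
    (crossNbrs G z).card = 2 ∨ (crossNbrs G z).card = 5 := by
  have huv : u ≠ v := by rintro rfl; exact hne rfl
  have c0 := h.card_inter_cases h1 hpar hS huv
  by_cases hzu : z = u
  · subst hzu; omega
  · have := h.card_inter_cases h1 hpar hz hzu
    omega

/-- On a side with degrees 2 and 5, the path count reads as follows; here `a` and `b` are the
numbers of vertices of degree 2 and 5. -/
theorem sum_card_two_five (h : IsCliqueBlowup G p q S) (h1 : ∀ v, twinCard G v = 1)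
    (hpar : ∀ u v, (S u ↔ S v) → planarDet p q u v = 0) {x : V}
    (hx : ∀ z, (S z ↔ S x) → (crossNbrs G z).card = 2 ∨ (crossNbrs G z).card = 5) {a b : ℕ}
    (ha : (Finset.univ.filter fun v => (S v ↔ S x) ∧ ¬ (crossNbrs G v).card = 5).card = a)
    (hb : (Finset.univ.filter fun v => (S v ↔ S x) ∧ (crossNbrs G v).card = 5).card = b) :
    ((crossNbrs G x).card = 2 → ∑ y ∈ crossNbrs G x, (crossNbrs G y).card = a + 2 * b + 1) ∧
    ((crossNbrs G x).card = 5 → ∑ y ∈ crossNbrs G x, (crossNbrs G y).card = 2 * a + 4 * b + 1) := by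
  have e := h.sum_card_inter x
  have hval : ∀ c : ℕ, ∀ z ∈ (Finset.univ.filter fun v => S v ↔ S x).erase x,
      (crossNbrs G x).card = c → (crossNbrs G x ∩ crossNbrs G z).card
        = if (crossNbrs G z).card = 5 then (if c = 5 then 4 else 2)
          else (if c = 5 then 2 else 1) := by
    intro c z hz hc
    have hzx := Finset.ne_of_mem_erase hz
    have hzS := (Finset.mem_filter.mp (Finset.mem_of_mem_erase hz)).2
    have c1 := h.card_inter_cases h1 hpar hzS.symm hzx.symm
    have c2 := hx z hzS
    have c3 := hx x Iff.rfl
    split_ifs <;> omega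
  have hsum : ∀ (c : ℕ) (_ : (crossNbrs G x).card = c) (f g : ℕ),
      ∑ z ∈ (Finset.univ.filter fun v => S v ↔ S x),
        (if (crossNbrs G z).card = 5 then f else g) = b * f + a * g := by
    intro c _ f g
    rw [Finset.sum_ite, Finset.sum_const, Finset.sum_const, Finset.filter_filter,
      Finset.filter_filter, ha, hb, smul_eq_mul, smul_eq_mul]
  have hxm : x ∈ Finset.univ.filter fun v => S v ↔ S x := by simp
  constructor
  · intro hc
    rw [Finset.sum_congr rfl fun z hz => hval 2 z hz hc] at e
    have := hsum 2 hc 2 1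
    rw [← Finset.add_sum_erase _ _ hxm, hc] at this
    simp only [hc] at e
    norm_num at e this
    omega
  · intro hc
    rw [Finset.sum_congr rfl fun z hz => hval 5 z hz hc] at e
    have := hsum 5 hc 4 2
    rw [← Finset.add_sum_erase _ _ hxm, hc] at this
    simp only [hc] at e
    norm_num at e this
    omega

end IsCliqueBlowup

end Bipartite

section Bipartite

open scoped Classical

variable {V : Type*} [Fintype V]

/-- The numbers of vertices of degree 2 and 5 (`a`, `b` on one side and `c`, `d` on the other), and
the numbers of their neighbours of either degree, are determined by counting edges and paths of
length two. -/
theorem two_five_arith {a b c d x₂ x₅ x₂' x₅' y₂ y₅ y₂' y₅' : ℕ} (ha0 : 0 < a) (hc0 : 0 < c)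
    (kx : x₅ + x₂ = 2) (kx' : x₅' + x₂' = 5) (ky : y₅ + y₂ = 2) (ky' : y₅' + y₂' = 5)
    (mx : 5 * x₅ + 2 * x₂ = a + 2 * b + 1) (mx' : 5 * x₅' + 2 * x₂' = 2 * a + 4 * b + 1)
    (my : 5 * y₅ + 2 * y₂ = c + 2 * d + 1) (my' : 5 * y₅' + 2 * y₂' = 2 * c + 4 * d + 1)
    (f22 : a * x₂ = c * y₂) (f25 : a * x₅ = d * y₂') (f55 : b * x₅' = d * y₅') :
    (a = 4 ∧ b = 1 ∧ c = 4 ∧ d = 1 ∧ x₅ = 1 ∧ x₅' = 1 ∧ y₅ = 1 ∧ y₅' = 1) ∨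
      (a = 3 ∧ b = 3 ∧ c = 3 ∧ d = 3 ∧ x₅ = 2 ∧ x₅' = 3 ∧ y₅ = 2 ∧ y₅' = 3) := by
  have hx : x₅' + 1 = 2 * x₅ := by omega
  have hy : y₅' + 1 = 2 * y₅ := by omega
  have hx2 : x₅ ≤ 2 := by omega
  have hy2 : y₅ ≤ 2 := by omega
  obtain rfl | rfl : x₅ = 1 ∨ x₅ = 2 := by omega
  all_goals obtain rfl | rfl : y₅ = 1 ∨ y₅ = 2 := by omega
  · obtain ⟨rfl, rfl, rfl, rfl⟩ : x₂ = 1 ∧ x₂' = 4 ∧ y₂ = 1 ∧ y₂' = 4 := by omega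
    omega
  · obtain ⟨rfl, rfl⟩ : x₂ = 1 ∧ y₂ = 0 := by omega
    omega
  · obtain ⟨rfl, rfl⟩ : x₂ = 0 ∧ y₂ = 1 := by omega
    omega
  · obtain ⟨rfl, rfl, rfl, rfl⟩ : x₂ = 0 ∧ x₅' = 3 ∧ y₂' = 2 ∧ y₅' = 3 := by omega
    omega

/-- Counting the edges between two classes of vertices in two ways. -/
theorem card_mul_eq_card_mul_of_adj {G : SimpleGraph V} (P Q : V → Prop)
    [DecidablePred P] [DecidablePred Q] (m n : ℕ)
    (hP : ∀ z, P z → (Finset.univ.filter fun v => Q v ∧ G.Adj z v).card = m)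
    (hQ : ∀ z, Q z → (Finset.univ.filter fun v => P v ∧ G.Adj z v).card = n) :
    (Finset.univ.filter fun v => P v).card * m = (Finset.univ.filter fun v => Q v).card * n := by
  refine Finset.card_mul_eq_card_mul G.Adj (fun z hz => ?_) (fun z hz => ?_)
  · rw [← hP z (Finset.mem_filter.mp hz).2, Finset.bipartiteAbove, Finset.filter_filter]
  · rw [← hQ z (Finset.mem_filter.mp hz).2, Finset.bipartiteBelow, Finset.filter_filter]
    simp only [G.adj_comm _ z]

namespace IsCliqueBlowup

variable {G : SimpleGraph V} {p q : V → ℝ} {S : V → Prop}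

set_option maxHeartbeats 1000000 in
/-- If some side has two different degrees, then so does the other, by the path counts; the numbers
of vertices and of neighbours of either degree are then given by `two_five_arith`. -/
theorem isTwoFive_of_not_regular (h : IsCliqueBlowup G p q S) (h1 : ∀ v, twinCard G v = 1)
    (hpar : ∀ u v, (S u ↔ S v) → planarDet p q u v = 0) {u v : V} (hS : S u ↔ S v)
    (hne : (crossNbrs G u).card ≠ (crossNbrs G v).card) :
    ∃ T, IsTwoFive G S T 4 1 1 1 ∨ IsTwoFive G S T 3 3 2 3 := by
  obtain ⟨T, hT⟩ : ∃ T : V → Prop, ∀ v, T v ↔ (crossNbrs G v).card = 5 :=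
    ⟨_, fun _ => Iff.rfl⟩
  -- both degrees occur on the side of `u`
  have hside : ∀ {u v : V}, (S u ↔ S v) → (crossNbrs G u).card ≠ (crossNbrs G v).card →
      ∃ x x', (S x ↔ S u) ∧ (S x' ↔ S u) ∧ (crossNbrs G x).card = 2 ∧
        (crossNbrs G x').card = 5 := by
    intro u v hS hne
    rcases h.card_eq_two_or_five h1 hpar hS hne Iff.rfl with hu | hu <;>
    rcases h.card_eq_two_or_five h1 hpar hS hne hS.symm with hv | hv
    · omega
    · exact ⟨u, v, Iff.rfl, hS.symm, hu, hv⟩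
    · exact ⟨v, u, hS.symm, Iff.rfl, hv, hu⟩
    · omega
  obtain ⟨x, x', hx, hx', hx2, hx5⟩ := hside hS hne
  have hdegu : ∀ z, (S z ↔ S u) → (crossNbrs G z).card = 2 ∨ (crossNbrs G z).card = 5 :=
    fun z hz => h.card_eq_two_or_five h1 hpar hS hne hz
  -- the other side is not regular
  obtain ⟨u', v', hu', hS', hne'⟩ : ∃ u' v', ¬ (S u' ↔ S u) ∧ (S u' ↔ S v') ∧
      (crossNbrs G u').card ≠ (crossNbrs G v').card := by
    by_contra hcon
    push Not at hcon
    obtain ⟨y, -, hy⟩ := h.exists_cross u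
    have hreg : ∀ x, (S x ↔ S u) → ∑ z ∈ crossNbrs G x, (crossNbrs G z).card
        = (crossNbrs G x).card * (crossNbrs G y).card := by
      intro x hx
      rw [Finset.sum_congr rfl (g := fun _ => (crossNbrs G y).card), Finset.sum_const, smul_eq_mul]
      intro z hz
      rw [h.mem_crossNbrs] at hz
      exact hcon z y (by tauto) (by tauto)
    have f1 := (h.sum_card_two_five h1 hpar (x := x) (fun z hz => hdegu z (hz.trans hx))
      rfl rfl).1 hx2
    have f2 := (h.sum_card_two_five h1 hpar (x := x') (fun z hz => hdegu z (hz.trans hx'))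
      rfl rfl).2 hx5
    rw [hreg x hx, hx2] at f1
    rw [hreg x' hx', hx5] at f2
    simp only [hx, hx'] at f1 f2
    omega
  have hoth : ∀ z, ¬ (S z ↔ S u) → (S z ↔ S u') := by
    intro z hz
    clear * - hz hu'
    tauto
  have hopp : ∀ z, (S z ↔ S u) → ∀ v, (¬ (S z ↔ S v)) ↔ (S v ↔ S u') := by
    intro z hz v
    clear * - hz hu'
    tauto
  have hopp' : ∀ z, (S z ↔ S u') → ∀ v, (¬ (S z ↔ S v)) ↔ (S v ↔ S u) := by
    intro z hz v
    clear * - hz hu'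
    tauto
  obtain ⟨y, y', hy, hy', hy2, hy5⟩ := hside hS' hne'
  have hdegu' : ∀ z, (S z ↔ S u') → (crossNbrs G z).card = 2 ∨ (crossNbrs G z).card = 5 :=
    fun z hz => h.card_eq_two_or_five h1 hpar hS' hne' hz
  have hall : ∀ z, (crossNbrs G z).card = 2 ∨ (crossNbrs G z).card = 5 := by
    intro z
    by_cases hz : S z ↔ S u
    exacts [hdegu z hz, hdegu' z (hoth z hz)]
  -- the numbers of neighbours of degree 2 and 5
  obtain ⟨n₂, hn₂⟩ : ∃ n₂ : V → ℕ, ∀ x, n₂ x = (Finset.univ.filter fun v =>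
    (¬ (S x ↔ S v) ∧ ¬ T v) ∧ G.Adj x v).card := ⟨_, fun _ => rfl⟩
  obtain ⟨n₅, hn₅⟩ : ∃ n₅ : V → ℕ, ∀ x, n₅ x = (Finset.univ.filter fun v =>
    (¬ (S x ↔ S v) ∧ T v) ∧ G.Adj x v).card := ⟨_, fun _ => rfl⟩
  have hf₅ : ∀ x, (crossNbrs G x).filter (fun v => T v)
      = Finset.univ.filter fun v => (¬ (S x ↔ S v) ∧ T v) ∧ G.Adj x v := by
    intro x
    ext z
    simp only [Finset.mem_filter, h.mem_crossNbrs, Finset.mem_univ, true_and]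
    tauto
  have hf₂ : ∀ x, (crossNbrs G x).filter (fun v => ¬ T v)
      = Finset.univ.filter fun v => (¬ (S x ↔ S v) ∧ ¬ T v) ∧ G.Adj x v := by
    intro x
    ext z
    simp only [Finset.mem_filter, h.mem_crossNbrs, Finset.mem_univ, true_and]
    tauto
  have hadd : ∀ x, n₅ x + n₂ x = (crossNbrs G x).card := by
    intro x
    rw [← Finset.card_filter_add_card_filter_not (s := crossNbrs G x) fun v => T v, hf₅, hf₂, hn₂,
      hn₅]
  have hsum : ∀ x, ∑ z ∈ crossNbrs G x, (crossNbrs G z).card = 5 * n₅ x + 2 * n₂ x := by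
    intro x
    rw [← Finset.sum_filter_add_sum_filter_not (crossNbrs G x) (fun v => T v), hf₅, hf₂, hn₂, hn₅]
    congr 1
    · rw [mul_comm]
      exact Finset.sum_const_nat fun z hz => (hT z).mp (Finset.mem_filter.mp hz).2.1.2
    · rw [mul_comm]
      exact Finset.sum_const_nat fun z hz =>
        (hall z).resolve_right (mt (hT z).mpr (Finset.mem_filter.mp hz).2.1.2)
  obtain ⟨a, ha⟩ : ∃ a, a = (Finset.univ.filter fun v => (S v ↔ S u) ∧ ¬ T v).card := ⟨_, rfl⟩
  obtain ⟨b, hb⟩ : ∃ b, b = (Finset.univ.filter fun v => (S v ↔ S u) ∧ T v).card := ⟨_, rfl⟩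
  obtain ⟨c, hc⟩ : ∃ c, c = (Finset.univ.filter fun v => (S v ↔ S u') ∧ ¬ T v).card := ⟨_, rfl⟩
  obtain ⟨d, hd⟩ : ∃ d, d = (Finset.univ.filter fun v => (S v ↔ S u') ∧ T v).card := ⟨_, rfl⟩
  have hu2 : ∀ z, (S z ↔ S u) → (crossNbrs G z).card = 2 → 5 * n₅ z + 2 * n₂ z = a + 2 * b + 1 := by
    intro z hz hz2
    rw [← hsum z]
    exact (h.sum_card_two_five h1 hpar (x := z) (fun t ht => hdegu t (ht.trans hz))
      (by simp only [hz, ha, hT]) (by simp only [hz, hb, hT])).1 hz2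
  have hu5 : ∀ z, (S z ↔ S u) → (crossNbrs G z).card = 5 →
      5 * n₅ z + 2 * n₂ z = 2 * a + 4 * b + 1 := by
    intro z hz hz2
    rw [← hsum z]
    exact (h.sum_card_two_five h1 hpar (x := z) (fun t ht => hdegu t (ht.trans hz))
      (by simp only [hz, ha, hT]) (by simp only [hz, hb, hT])).2 hz2
  have hu'2 : ∀ z, (S z ↔ S u') → (crossNbrs G z).card = 2 →
      5 * n₅ z + 2 * n₂ z = c + 2 * d + 1 := by
    intro z hz hz2
    rw [← hsum z]
    exact (h.sum_card_two_five h1 hpar (x := z) (fun t ht => hdegu' t (ht.trans hz))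
      (by simp only [hz, hc, hT]) (by simp only [hz, hd, hT])).1 hz2
  have hu'5 : ∀ z, (S z ↔ S u') → (crossNbrs G z).card = 5 →
      5 * n₅ z + 2 * n₂ z = 2 * c + 4 * d + 1 := by
    intro z hz hz2
    rw [← hsum z]
    exact (h.sum_card_two_five h1 hpar (x := z) (fun t ht => hdegu' t (ht.trans hz))
      (by simp only [hz, hc, hT]) (by simp only [hz, hd, hT])).2 hz2
  have hnT : ∀ z, ¬ T z → (crossNbrs G z).card = 2 := fun z hz =>
    (hall z).resolve_right (mt (hT z).mpr hz)
  have kx := hadd x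
  have kx' := hadd x'
  have ky := hadd y
  have ky' := hadd y'
  have mx := hu2 x hx hx2
  have mx' := hu5 x' hx' hx5
  have my := hu'2 y (hy.trans Iff.rfl) hy2
  have my' := hu'5 y' hy' hy5
  have sx : ∀ z, (S z ↔ S u) → ¬ T z → n₅ z = n₅ x ∧ n₂ z = n₂ x := by
    intro z hz hzT
    have := hadd z
    have := hnT z hzT
    have := hu2 z hz this
    omega
  have sx' : ∀ z, (S z ↔ S u) → T z → n₅ z = n₅ x' ∧ n₂ z = n₂ x' := by
    intro z hz hzT
    have := hadd z
    have := hu5 z hz ((hT z).mp hzT)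
    have := (hT z).mp hzT
    omega
  have sy : ∀ z, (S z ↔ S u') → ¬ T z → n₅ z = n₅ y ∧ n₂ z = n₂ y := by
    intro z hz hzT
    have := hadd z
    have := hnT z hzT
    have := hu'2 z hz this
    omega
  have sy' : ∀ z, (S z ↔ S u') → T z → n₅ z = n₅ y' ∧ n₂ z = n₂ y' := by
    intro z hz hzT
    have := hadd z
    have := hu'5 z hz ((hT z).mp hzT)
    have := (hT z).mp hzT
    omega
  have f22 : a * n₂ x = c * n₂ y := by
    rw [ha, hc]
    exact card_mul_eq_card_mul_of_adj (G := G)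
      (fun v => (S v ↔ S u) ∧ ¬ T v) (fun v => (S v ↔ S u') ∧ ¬ T v) (n₂ x) (n₂ y)
      (fun z hz => by rw [← (sx z hz.1 hz.2).2]; simp only [hn₂, hopp z hz.1])
      (fun z hz => by rw [← (sy z hz.1 hz.2).2]; simp only [hn₂, hopp' z hz.1])
  have f25 : a * n₅ x = d * n₂ y' := by
    rw [ha, hd]
    exact card_mul_eq_card_mul_of_adj (G := G)
      (fun v => (S v ↔ S u) ∧ ¬ T v) (fun v => (S v ↔ S u') ∧ T v) (n₅ x) (n₂ y')
      (fun z hz => by rw [← (sx z hz.1 hz.2).1]; simp only [hn₅, hopp z hz.1])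
      (fun z hz => by rw [← (sy' z hz.1 hz.2).2]; simp only [hn₂, hopp' z hz.1])
  have f55 : b * n₅ x' = d * n₅ y' := by
    rw [hb, hd]
    exact card_mul_eq_card_mul_of_adj (G := G)
      (fun v => (S v ↔ S u) ∧ T v) (fun v => (S v ↔ S u') ∧ T v) (n₅ x') (n₅ y')
      (fun z hz => by rw [← (sx' z hz.1 hz.2).1]; simp only [hn₅, hopp z hz.1])
      (fun z hz => by rw [← (sy' z hz.1 hz.2).1]; simp only [hn₅, hopp' z hz.1])
  have ha0 : 0 < a := ha ▸ Finset.card_pos.mpr ⟨x, by simp [hx, hT, hx2]⟩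
  have hc0 : 0 < c := hc ▸ Finset.card_pos.mpr ⟨y, by
    simp only [Finset.mem_filter, Finset.mem_univ, true_and, hT, hy2]; exact ⟨hy, by norm_num⟩⟩
  rw [hx2] at kx
  rw [hx5] at kx'
  rw [hy2] at ky
  rw [hy5] at ky'
  have hsol := two_five_arith ha0 hc0 kx kx' ky ky' mx mx' my my' f22 f25 f55
  have hT₂ : ∀ z, ¬ T z → n₅ z = n₅ x ∨ n₅ z = n₅ y := by
    intro z hz
    by_cases hzu : S z ↔ S u
    exacts [Or.inl (sx z hzu hz).1, Or.inr (sy z (hoth z hzu) hz).1]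
  have hT₅ : ∀ z, T z → n₅ z = n₅ x' ∨ n₅ z = n₅ y' := by
    intro z hz
    by_cases hzu : S z ↔ S u
    exacts [Or.inl (sx' z hzu hz).1, Or.inr (sy' z (hoth z hzu) hz).1]
  have hmk : ∀ a' b' k₂ k₅, a = a' → c = a' → b = b' → d = b' → n₅ x = k₂ → n₅ y = k₂ →
      n₅ x' = k₅ → n₅ y' = k₅ → IsTwoFive G S T a' b' k₂ k₅ := by
    intro a' b' k₂ k₅ e1 e2 e3 e4 e5 e6 e7 e8
    refine ⟨h.not_adj_same h1, ?_, ?_, ?_, ?_, ?_, ?_, ?_, ?_⟩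
    · intro z hz
      have := hadd z
      have := hnT z hz
      have : n₅ z = k₂ := by rcases hT₂ z hz with h' | h' <;> omega
      rw [← hn₂]
      omega
    · intro z hz
      have := hadd z
      have := (hT z).mp hz
      have : n₅ z = k₅ := by rcases hT₅ z hz with h' | h' <;> omega
      rw [← hn₂]
      omega
    · intro z hz
      have : n₅ z = k₂ := by rcases hT₂ z hz with h' | h' <;> omega
      rw [← hn₅, this]
    · intro z hz
      have : n₅ z = k₅ := by rcases hT₅ z hz with h' | h' <;> omega
      rw [← hn₅, this]
    all_goals by_cases hSu : S u
    all_goals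
      have hSu' : S u' ↔ ¬ S u := by clear * - hu'; tauto
      simp only [hSu, hSu', iff_true, iff_false, not_true_eq_false,
        not_false_eq_true] at ha hb hc hd
      omega
  rcases hsol with ⟨e1, e2, e3, e4, e5, e6, e7, e8⟩ | ⟨e1, e2, e3, e4, e5, e6, e7, e8⟩
  · exact ⟨T, Or.inl (hmk 4 1 1 1 e1 e3 e2 e4 e5 e7 e6 e8)⟩
  · exact ⟨T, Or.inr (hmk 3 3 2 3 e1 e3 e2 e4 e5 e7 e6 e8)⟩

end IsCliqueBlowup

end Bipartite

section Bipartite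

open scoped Classical

variable {V : Type*} [Fintype V]

namespace IsCliqueBlowup

variable {G : SimpleGraph V} {p q : V → ℝ} {S : V → Prop}

/-- If the two sides are not completely joined, then some cross pair of vectors is perpendicular,
and the vectors of the vertices lie on the boundary rays of a quadrant, except possibly those
of one clique. -/
theorem of_not_complete (h : IsCliqueBlowup G p q S) {u₀ y₀ : V} (hu₀ : S u₀) (hy₀ : ¬ S y₀)
    (h₀ : ¬ G.Adj u₀ y₀) :
    (∃ T a m, (IsCliqueCoclique G S T a m ∨ IsCliqueCoclique G (fun v => ¬ S v) T a m) ∧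
      ((a = 3 ∧ m = 5) ∨ (a = 4 ∧ m = 4))) ∨
    (∃ m, 3 ≤ m ∧ IsCrown G S m) ∨
    ∃ T, IsTwoFive G S T 4 1 1 1 ∨ IsTwoFive G S T 3 3 2 3 := by
  have hne : ¬ (S u₀ ↔ S y₀) := by tauto
  have huy := h.inner_cross_of_not_adj h₀ hne
  have hyu : planarInner p q y₀ u₀ = 0 := by rw [planarInner_comm, huy]
  by_cases hint : ∃ v, S v ∧ planarInner p q v y₀ ≠ 0
  · obtain ⟨v, hv, hvy⟩ := hint
    left
    obtain ⟨T, a, m, hT, ham⟩ := h.isCliqueCoclique hu₀ huy hv hvy fun z hz => by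
      by_contra hzu
      exact h.not_interior_both hu₀ hy₀ huy hv hvy hz hzu
    exact ⟨T, a, m, Or.inl hT, ham⟩
  by_cases hint' : ∃ z, ¬ S z ∧ planarInner p q z u₀ ≠ 0
  · obtain ⟨z, hz, hzu⟩ := hint'
    left
    obtain ⟨T, a, m, hT, ham⟩ := h.compl.isCliqueCoclique hy₀ hyu hz hzu fun v hv => by
      by_contra hvy
      exact hint ⟨v, not_not.mp hv, hvy⟩
    exact ⟨T, a, m, Or.inr hT, ham⟩
  right
  push Not at hint hint'
  have hcross : ∀ u v, ¬ (S u ↔ S v) → planarInner p q u v = 0 := by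
    have : ∀ u v, S u → ¬ S v → planarInner p q u v = 0 := by
      intro u v hu hv
      have e := planarInner_expand huy u v
      rw [hint u hu, hint' v hv, mul_zero, zero_mul, zero_mul, zero_mul, add_zero, mul_assoc] at e
      exact (mul_eq_zero.mp e).resolve_right (mul_pos (h.pos _) (h.pos _)).ne'
    intro u v huv
    by_cases hu : S u
    · exact this u v hu (by tauto)
    · rw [planarInner_comm]
      exact this v u (by tauto) hu
  have h1 : ∀ v, twinCard G v = 1 := by
    intro v
    obtain ⟨u, hadj, hS⟩ := h.exists_cross v
    exact (h.twinCard_eq_one_of_perp hadj hS (hcross v u hS)).1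
  have hpar : ∀ u v, (S u ↔ S v) → planarDet p q u v = 0 := by
    intro u v hS
    obtain ⟨w, -, hw⟩ := h.exists_cross u
    exact planarDet_eq_zero_of_perp (h.pos w) (hcross u w hw) (hcross v w (by tauto))
  by_cases hreg : ∀ u v, (S u ↔ S v) → (crossNbrs G u).card = (crossNbrs G v).card
  · have : Nonempty V := ⟨u₀⟩
    exact Or.inl (h.isCrown_of_regular h1 hpar hreg)
  · push Not at hreg
    obtain ⟨u, v, hS, hne⟩ := hreg
    exact Or.inr (h.isTwoFive_of_not_regular h1 hpar hS hne)

end IsCliqueBlowup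

end Bipartite

/-! ### Enumerations of the vertices, and isomorphisms -/

theorem graphOfMatrix_adj {V : Type*} {M : Matrix V V ℤ} {i j : V} :
    (graphOfMatrix M).Adj i j ↔ i ≠ j ∧ (M i j = 1 ∨ M j i = 1) := Iff.rfl

theorem allOnes_apply {m n : Type*} (i : m) (j : n) : allOnes m n i j = 1 := rfl

theorem JsubI_apply {n : ℕ} (i j : Fin n) : JsubI n i j = if i = j then 0 else 1 := by
  rw [JsubI, Matrix.sub_apply, allOnes_apply, Matrix.one_apply]
  split_ifs <;> rfl

theorem JsubI_eq_one_iff {n : ℕ} {i j : Fin n} : JsubI n i j = 1 ↔ i ≠ j := by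
  rw [JsubI_apply]
  split_ifs with h <;> simp [h]

theorem reverseId_apply {n : ℕ} (i j : Fin n) :
    reverseId n i j = if j = i.rev then 1 else 0 := rfl

theorem reverseId_eq_one_iff {n : ℕ} {i j : Fin n} : reverseId n i j = 1 ↔ j = i.rev := by
  rw [reverseId_apply]
  split_ifs with h <;> simp [h]

theorem one_apply_eq_one_iff {n : Type*} [DecidableEq n] {i j : n} :
    (1 : Matrix n n ℤ) i j = 1 ↔ i = j := by
  rw [Matrix.one_apply]
  split_ifs with h <;> simp [h]

theorem eq_rev_comm {n : ℕ} {i j : Fin n} : i = j.rev ↔ j = i.rev :=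
  ⟨fun h => by rw [h, Fin.rev_rev], fun h => by rw [h, Fin.rev_rev]⟩

/-- `φ` enumerates, without repetition, the elements satisfying `P`. -/
structure Enumerates {ι V : Type*} (φ : ι → V) (P : V → Prop) : Prop where
  injective : Function.Injective φ
  iff_exists : ∀ v, P v ↔ ∃ i, φ i = v

namespace Enumerates

variable {ι κ V : Type*} {φ : ι → V} {ψ : κ → V} {P Q R : V → Prop}

theorem apply (h : Enumerates φ P) (i : ι) : P (φ i) := (h.iff_exists _).mpr ⟨i, rfl⟩

theorem sumElim (h : Enumerates φ P) (h' : Enumerates ψ Q) (hR : ∀ v, R v ↔ P v ∨ Q v)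
    (hdisj : ∀ v, P v → ¬ Q v) : Enumerates (Sum.elim φ ψ) R where
  injective := h.injective.sumElim h'.injective fun i j e =>
    hdisj _ (h.apply i) (e ▸ h'.apply j)
  iff_exists v := by
    rw [hR, h.iff_exists, h'.iff_exists, Sum.exists]
    rfl

/-- An enumeration of the vertices of `G` that turns the adjacency of `G` into that of `H` gives an
isomorphism. -/
theorem nonempty_iso (h : Enumerates φ P) (hP : ∀ v, P v) {G : SimpleGraph V} {H : SimpleGraph ι}
    (hadj : ∀ i j, H.Adj i j ↔ G.Adj (φ i) (φ j)) : Nonempty (G ≃g H) := by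
  let e : ι ≃ V := Equiv.ofBijective φ ⟨h.injective, fun v => (h.iff_exists v).mp (hP v)⟩
  exact ⟨(⟨e, fun {i j} => (hadj i j).symm⟩ : H ≃g G).symm⟩

theorem exists_of_card [Fintype V] [DecidablePred P] {n : ℕ}
    (h : (Finset.univ.filter fun v => P v).card = n) : ∃ φ : Fin n → V, Enumerates φ P := by
  let e := (Finset.equivFinOfCardEq h).symm
  refine ⟨fun i => e i, fun i j hij => e.injective (Subtype.ext hij), fun v => ⟨fun hv => ?_, ?_⟩⟩
  · exact ⟨e.symm ⟨v, by simpa using hv⟩, by simp⟩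
  · rintro ⟨i, rfl⟩
    exact (Finset.mem_filter.mp (e i).2).2

/-- Two sets matched by a relation are enumerated compatibly with the matching. -/
theorem exists_of_existsUnique (h : Enumerates φ P) {r : V → V → Prop}
    (hr : ∀ v, P v → ∃! w, Q w ∧ r v w) (hr' : ∀ w, Q w → ∃! v, P v ∧ r v w) :
    ∃ ψ : ι → V, Enumerates ψ Q ∧ ∀ i j, r (φ i) (ψ j) ↔ i = j := by
  choose! f hf hf' using hr
  have key : ∀ i j, r (φ i) (f (φ j)) ↔ i = j := by
    intro i j
    refine ⟨fun hij => ?_, fun hij => hij ▸ (hf _ (h.apply i)).2⟩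
    have hj := hf _ (h.apply j)
    exact h.injective ((hr' _ hj.1).unique ⟨h.apply i, hij⟩ ⟨h.apply j, hj.2⟩)
  refine ⟨fun i => f (φ i), ⟨fun i j hij => ?_, fun w => ⟨fun hw => ?_, ?_⟩⟩, key⟩
  · rw [← key i j, ← hij]
    exact (hf _ (h.apply i)).2
  · obtain ⟨v, ⟨hv, hvw⟩, -⟩ := hr' w hw
    obtain ⟨i, rfl⟩ := (h.iff_exists v).mp hv
    exact ⟨i, (hf' _ hv w ⟨hw, hvw⟩).symm⟩
  · rintro ⟨i, rfl⟩
    exact (hf _ (h.apply i)).1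

end Enumerates

theorem cycleType_of_involution {α : Type*} [Fintype α] [DecidableEq α] (τ : Equiv.Perm α)
    (h2 : ∀ x, τ (τ x) = x) (hfix : ∀ x, τ x ≠ x) :
    ∃ k, Fintype.card α = 2 * k ∧ τ.cycleType = Multiset.replicate k 2 := by
  have hord : orderOf τ ∣ 2 := orderOf_dvd_of_pow_eq_one <| Equiv.ext fun x => by
    rw [pow_two, Equiv.Perm.mul_apply, h2, Equiv.Perm.one_apply]
  have hall : ∀ n ∈ τ.cycleType, n = 2 := fun n hn =>
    le_antisymm (Nat.le_of_dvd two_pos ((Equiv.Perm.dvd_of_mem_cycleType hn).trans hord))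
      (Equiv.Perm.two_le_of_mem_cycleType hn)
  have hrep := Multiset.eq_replicate_card.mpr hall
  refine ⟨τ.cycleType.card, ?_, hrep⟩
  have hsum := τ.sum_cycleType
  have hsupp : τ.support = Finset.univ := by
    ext x
    simp [hfix x]
  rw [hsupp, Finset.card_univ, hrep, Multiset.sum_replicate, smul_eq_mul, mul_comm] at hsum
  exact hsum.symm

/-- A fixed-point-free involution is, up to relabelling, the reversal of `Fin (2 * k)`. -/
theorem exists_equiv_rev_of_involution {α : Type*} [Fintype α] [DecidableEq α] (τ : Equiv.Perm α)
    (h2 : ∀ x, τ (τ x) = x) (hfix : ∀ x, τ x ≠ x) :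
    ∃ k, ∃ e : Fin (2 * k) ≃ α, ∀ i, τ (e i) = e i.rev := by
  obtain ⟨k, hk, -⟩ := cycleType_of_involution τ h2 hfix
  obtain ⟨k', hk', hrev⟩ := cycleType_of_involution (Fin.revPerm (n := 2 * k))
    (fun x => by simp) fun x hx => by
      have := congrArg Fin.val hx
      rw [Fin.revPerm_apply, Fin.val_rev] at this
      omega
  rw [Fintype.card_fin] at hk'
  obtain rfl : k = k' := by omega
  let e₀ : Fin (2 * k) ≃ α := (Fintype.equivFinOfCardEq hk).symm
  obtain ⟨k', hk', hτ'⟩ := cycleType_of_involution (e₀.symm.permCongr τ)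
    (fun x => by simp [h2]) fun x hx => hfix (e₀ x) (by simpa using congrArg e₀ hx)
  rw [Fintype.card_fin] at hk'
  obtain rfl : k = k' := by omega
  have hconj : IsConj (Fin.revPerm (n := 2 * k)) (e₀.symm.permCongr τ) := by
    rw [Equiv.Perm.isConj_iff_cycleType_eq, hrev, hτ']
  obtain ⟨c, hc⟩ := isConj_iff.mp hconj
  refine ⟨k, c.trans e₀, fun i => ?_⟩
  have := Equiv.congr_fun hc (c i)
  simp at this
  simp [this]

/-- A set in which every element has a unique neighbour, enumerated so that reversal maps each
element to its neighbour. -/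
theorem Enumerates.exists_of_matching {V : Type*} [Fintype V] {P : V → Prop} {G : SimpleGraph V}
    (h : ∀ v, P v → ∃! w, P w ∧ G.Adj v w) :
    ∃ k, ∃ φ : Fin (2 * k) → V, Enumerates φ P ∧ ∀ i j, G.Adj (φ i) (φ j) ↔ j = i.rev := by
  classical
  choose! f hf hf' using h
  have hff : ∀ v, P v → f (f v) = v := fun v hv =>
    (hf' _ (hf v hv).1 v ⟨hv, (hf v hv).2.symm⟩).symm
  let g : {v // P v} → {v // P v} := fun v => ⟨f v, (hf v v.2).1⟩
  have hg : Function.Involutive g := fun v => Subtype.ext (hff v v.2)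
  obtain ⟨k, e, he⟩ := exists_equiv_rev_of_involution hg.toPerm hg fun v hv =>
    (hf v v.2).2.ne (congrArg Subtype.val hv).symm
  have he' : ∀ i, f (e i) = e i.rev := fun i => congrArg Subtype.val (he i)
  refine ⟨k, fun i => e i, ⟨fun i j hij => e.injective (Subtype.ext hij), fun v => ⟨fun hv =>
    ⟨e.symm ⟨v, hv⟩, by simp⟩, ?_⟩⟩, fun i j => ?_⟩
  · rintro ⟨i, rfl⟩
    exact (e i).2
  · constructor
    · intro hij
      have := hf' _ (e i).2 _ ⟨(e j).2, hij⟩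
      rw [he'] at this
      exact e.injective (Subtype.ext this)
    · rintro rfl
      change G.Adj (e i) (e i.rev)
      rw [← he']
      exact (hf _ (e i).2).2

/-! ### The list of graphs -/

/-- The union of two cliques, of orders `c + 1` and `c + a`, that share `c` vertices. -/
def typeV (c a : ℕ) : SimpleGraph (Fin c ⊕ (Fin 1 ⊕ Fin a)) :=
  graphOfMatrix
    (Matrix.fromBlocks (JsubI c) (allOnes _ _) (allOnes _ _) (Matrix.fromBlocks 0 0 0 (JsubI a)))

/-- The parameters of the graphs in the class `𝒢`; the constructor `crown` stands for complete
bipartite graphs with a perfect matching removed, and `five` for the graphs `typeV`. -/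
inductive Shape
  | crown (m : ℕ)
  | two (a k : ℕ)
  | three (l m : ℕ)
  | fourA
  | fourB
  | five (c a : ℕ)
  | six (a m : ℕ)

/-- The values of the parameters that occur. -/
def Shape.Valid : Shape → Prop
  | crown m => 3 ≤ m
  | two a k => 1 ≤ a ∧ 2 ≤ k
  | three l m => 2 ≤ m ∧ m ≤ l
  | fourA => True
  | fourB => True
  | five c a => (c = 6 ∧ a = 5) ∨ (c = 4 ∧ a = 6) ∨ (c = 3 ∧ a = 8)
  | six a m => (a = 3 ∧ m = 5) ∨ (a = 4 ∧ m = 4)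

/-- `G` is isomorphic to the graph with the given parameters. -/
def Shape.Rep (c : Shape) {V : Type*} (G : SimpleGraph V) : Prop :=
  match c with
  | crown m => Nonempty (G ≃g bipartiteGraphOf (JsubI m))
  | two a k => Nonempty (G ≃g typeII a k)
  | three l m => Nonempty (G ≃g typeIII l m)
  | fourA => Nonempty (G ≃g typeIVa)
  | fourB => Nonempty (G ≃g typeIVb)
  | five c a => Nonempty (G ≃g typeV c a)
  | six a m => Nonempty (G ≃g typeVI a m)

section Recognition

open scoped Classical

variable {V : Type*} [Fintype V] {G : SimpleGraph V} {S T : V → Prop}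

omit [Fintype V] in
theorem Enumerates.sumElim_compl {ι κ : Type*} {φ : ι → V} {ψ : κ → V} (hφ : Enumerates φ S)
    (hψ : Enumerates ψ fun v => ¬ S v) : Enumerates (Sum.elim φ ψ) fun _ => True :=
  hφ.sumElim hψ (fun v => by simp [em]) fun _ h h' => h' h

theorem IsCrown.rep {m : ℕ} (h : IsCrown G S m) : (Shape.crown m).Rep G := by
  obtain ⟨φ, hφ⟩ := Enumerates.exists_of_card h.card_left
  obtain ⟨ψ, hψ, hr⟩ := hφ.exists_of_existsUnique (Q := fun v => ¬ S v)
    (r := fun u v => ¬ G.Adj u v) (fun _ => h.existsUnique_left) fun _ => h.existsUnique_right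
  have hr' : ∀ i j, G.Adj (φ i) (ψ j) ↔ i ≠ j := fun i j => by rw [ne_eq, ← hr i j, not_not]
  refine (hφ.sumElim_compl hψ).nonempty_iso (fun _ => trivial) ?_
  rintro (i | i) (j | j)
  · simpa [bipartiteGraphOf, graphOfMatrix_adj] using
      h.not_adj (iff_of_true (hφ.apply i) (hφ.apply j))
  · simp [bipartiteGraphOf, graphOfMatrix_adj, JsubI_eq_one_iff, hr']
  · simp [bipartiteGraphOf, graphOfMatrix_adj, JsubI_eq_one_iff, G.adj_comm (ψ i), hr']
  · simpa [bipartiteGraphOf, graphOfMatrix_adj] using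
      h.not_adj (iff_of_false (hψ.apply i) (hψ.apply j))

theorem IsCliqueCoclique.rep {a m : ℕ} (h : IsCliqueCoclique G S T a m) :
    (Shape.six a m).Rep G := by
  obtain ⟨θ, hθ⟩ := Enumerates.exists_of_card h.card_clique
  obtain ⟨φ, hφ⟩ := Enumerates.exists_of_card h.card_left
  obtain ⟨ψ, hψ, hr⟩ := hφ.exists_of_existsUnique (Q := fun v => ¬ S v)
    (r := fun u v => ¬ G.Adj u v) (fun _ => h.existsUnique_left) fun _ => h.existsUnique_right
  have hr' : ∀ i j, G.Adj (φ i) (ψ j) ↔ i ≠ j := fun i j => by rw [ne_eq, ← hr i j, not_not]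
  refine ((hθ.sumElim hψ (R := fun v => ¬ T v) (fun v => ?_) fun v hv => not_not.mpr
    hv.1).sumElim hφ (R := fun _ => True) (fun v => ?_) fun v => id).nonempty_iso
    (fun _ => trivial) ?_
  · have := @h.sub v
    tauto
  · simp [em']
  have e1 : ∀ i j, G.Adj (θ i) (θ j) ↔ i ≠ j := fun i j =>
    ⟨fun e => by rintro rfl; exact e.ne rfl, fun e =>
      h.clique (hθ.apply i).1 (hθ.apply j).1 (hθ.apply i).2 (hθ.apply j).2 (hθ.injective.ne e)⟩
  have e2 : ∀ i j, ¬ G.Adj (θ i) (φ j) := fun i j =>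
    h.not_adj_mixed (hθ.apply i).1 (hθ.apply i).2 (hφ.apply j)
  have e3 : ∀ i j, G.Adj (θ i) (ψ j) := fun i j =>
    h.join (hθ.apply i).1 (hθ.apply i).2 (hψ.apply j)
  have e4 : ∀ i j, ¬ G.Adj (φ i) (φ j) := fun i j => h.not_adj_left (hφ.apply i) (hφ.apply j)
  have e5 : ∀ i j, ¬ G.Adj (ψ i) (ψ j) := fun i j => h.not_adj_right (hψ.apply i) (hψ.apply j)
  rintro ((i | i) | i) ((j | j) | j) <;>
    simp [typeVI, graphOfMatrix_adj, allOnes_apply, JsubI_eq_one_iff, hr', e1, e2, e3, e4, e5,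
      G.adj_comm (φ _) (θ _), G.adj_comm (ψ _) (θ _), G.adj_comm (ψ _) (φ _), eq_comm]

theorem adj_of_card_filter_le {P : V → Prop} [DecidablePred P] {u : V}
    (h : (Finset.univ.filter fun v => P v).card
      ≤ (Finset.univ.filter fun v => P v ∧ G.Adj u v).card) {v : V} (hv : P v) : G.Adj u v := by
  have := Finset.eq_of_subset_of_card_le
    (Finset.monotone_filter_right Finset.univ fun v _ (h : P v ∧ G.Adj u v) => h.1) h
  have hv' : v ∈ Finset.univ.filter fun v => P v := by simp [hv]
  rw [← this] at hv'
  exact (Finset.mem_filter.mp hv').2.2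

theorem existsUnique_not_adj {P : V → Prop} [DecidablePred P] {u : V}
    (h : (Finset.univ.filter fun v => P v).card
      = (Finset.univ.filter fun v => P v ∧ G.Adj u v).card + 1) : ∃! v, P v ∧ ¬ G.Adj u v := by
  have := existsUnique_of_card_filter (P := fun v => G.Adj u v) h
    (by rw [Finset.filter_filter])
  simpa using this

/-- The vertices of degree 2 on the two sides are matched, and all other pairs from different sides
that involve a vertex of degree 5 are adjacent. -/
theorem IsTwoFive.rep_fourA (h : IsTwoFive G S T 4 1 1 1) : Shape.fourA.Rep G := by
  obtain ⟨φ₂, hφ₂⟩ := Enumerates.exists_of_card h.card_left₂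
  obtain ⟨φ₅, hφ₅⟩ := Enumerates.exists_of_card h.card_left₅
  obtain ⟨ψ₅, hψ₅⟩ := Enumerates.exists_of_card h.card_right₅
  have hone : ∀ (P : V → Prop) [DecidablePred P],
      (Finset.univ.filter fun v => P v).card = 1 → ∃! v, P v := by
    intro P _ hP
    obtain ⟨v, hv⟩ := Finset.card_eq_one.mp hP
    have hv' : ∀ w, P w ↔ w = v := fun w => by simpa using congrArg (w ∈ ·) hv
    exact ⟨v, (hv' v).mpr rfl, fun w hw => (hv' w).mp hw⟩
  obtain ⟨ψ₂, hψ₂, hr⟩ := hφ₂.exists_of_existsUnique (Q := fun v => ¬ S v ∧ ¬ T v) (r := G.Adj)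
    (fun v hv => by
      have := h.card_nbrs₂ hv.2
      simp only [hv.1, true_iff] at this
      exact hone _ (by simpa using this))
    (fun v hv => by
      have := h.card_nbrs₂ hv.2
      simp only [hv.1, false_iff, not_not, G.adj_comm v] at this
      exact hone _ (by simpa using this))
  have e1 : ∀ i j, G.Adj (φ₂ i) (ψ₅ j) := fun i j => by
    have := h.card_nbrs₂' (hφ₂.apply i).2
    simp only [(hφ₂.apply i).1, true_iff] at this
    exact adj_of_card_filter_le (by rw [h.card_right₅, this]) (hψ₅.apply j)
  have e2 : ∀ i j, G.Adj (φ₅ i) (ψ₅ j) := fun i j => by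
    have := h.card_nbrs₅' (hφ₅.apply i).2
    simp only [(hφ₅.apply i).1, true_iff] at this
    exact adj_of_card_filter_le (by rw [h.card_right₅, this]) (hψ₅.apply j)
  have e3 : ∀ i j, G.Adj (φ₅ j) (ψ₂ i) := fun i j => by
    have := h.card_nbrs₂' (hψ₂.apply i).2
    simp only [(hψ₂.apply i).1, false_iff, not_not] at this
    exact (adj_of_card_filter_le (P := fun v => S v ∧ T v) (by rw [h.card_left₅, this])
      (hφ₅.apply j)).symm
  refine ((hφ₅.sumElim hφ₂ (R := S) (fun v => ?_) fun v hv hv' => hv'.2 hv.2).sumElim_compl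
    (hψ₅.sumElim hψ₂ (fun v => ?_) fun v hv hv' => hv'.2 hv.2)).nonempty_iso (fun _ => trivial) ?_
  · by_cases hv : T v <;> simp [hv]
  · by_cases hv : T v <;> simp [hv]
  have n1 : ∀ i j, ¬ G.Adj (φ₅ i) (φ₅ j) := fun i j =>
    h.not_adj (iff_of_true (hφ₅.apply i).1 (hφ₅.apply j).1)
  have n2 : ∀ i j, ¬ G.Adj (φ₅ i) (φ₂ j) := fun i j =>
    h.not_adj (iff_of_true (hφ₅.apply i).1 (hφ₂.apply j).1)
  have n3 : ∀ i j, ¬ G.Adj (φ₂ i) (φ₂ j) := fun i j =>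
    h.not_adj (iff_of_true (hφ₂.apply i).1 (hφ₂.apply j).1)
  have m1 : ∀ i j, ¬ G.Adj (ψ₅ i) (ψ₅ j) := fun i j =>
    h.not_adj (iff_of_false (hψ₅.apply i).1 (hψ₅.apply j).1)
  have m2 : ∀ i j, ¬ G.Adj (ψ₅ i) (ψ₂ j) := fun i j =>
    h.not_adj (iff_of_false (hψ₅.apply i).1 (hψ₂.apply j).1)
  have m3 : ∀ i j, ¬ G.Adj (ψ₂ i) (ψ₂ j) := fun i j =>
    h.not_adj (iff_of_false (hψ₂.apply i).1 (hψ₂.apply j).1)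
  rintro ((i | i) | (i | i)) ((j | j) | (j | j)) <;>
    simp [typeIVa, bipartiteGraphOf, graphOfMatrix_adj, allOnes_apply, one_apply_eq_one_iff, hr, e1,
      e2, e3, n1, n2, n3, m1, m2, m3, G.adj_comm (φ₂ _) (φ₅ _), G.adj_comm (ψ₅ _) (φ₅ _),
      G.adj_comm (ψ₅ _) (φ₂ _), G.adj_comm (ψ₂ _) (φ₅ _), G.adj_comm (ψ₂ _) (φ₂ _),
      G.adj_comm (ψ₂ _) (ψ₅ _), eq_iff_true_of_subsingleton]

/-- The vertices of degree 5 on either side are not adjacent to exactly one vertex of degree 2 on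
the other side; every vertex of degree 2 is joined to all but one of the vertices of degree 5 on
the other side, and to no vertex of degree 2. -/
theorem IsTwoFive.rep_fourB (h : IsTwoFive G S T 3 3 2 3) : Shape.fourB.Rep G := by
  obtain ⟨φ₂, hφ₂⟩ := Enumerates.exists_of_card h.card_left₂
  obtain ⟨φ₅, hφ₅⟩ := Enumerates.exists_of_card h.card_left₅
  obtain ⟨ψ₂, hψ₂, hr⟩ := hφ₅.exists_of_existsUnique (Q := fun v => ¬ S v ∧ ¬ T v)
    (r := fun u v => ¬ G.Adj u v)
    (fun v hv => by
      have := h.card_nbrs₅ hv.2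
      simp only [hv.1, true_iff] at this
      exact existsUnique_not_adj (by rw [h.card_right₂]; omega))
    (fun v hv => by
      have := h.card_nbrs₂' hv.2
      simp only [hv.1, false_iff, not_not] at this
      simp only [G.adj_comm _ v]
      exact existsUnique_not_adj (by rw [h.card_left₅, this]))
  obtain ⟨ψ₅, hψ₅, hs⟩ := hφ₂.exists_of_existsUnique (Q := fun v => ¬ S v ∧ T v)
    (r := fun u v => ¬ G.Adj u v)
    (fun v hv => by
      have := h.card_nbrs₂' hv.2
      simp only [hv.1, true_iff] at this
      exact existsUnique_not_adj (by rw [h.card_right₅, this]))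
    (fun v hv => by
      have := h.card_nbrs₅ hv.2
      simp only [hv.1, false_iff, not_not] at this
      simp only [G.adj_comm _ v]
      exact existsUnique_not_adj (by rw [h.card_left₂]; omega))
  have hr' : ∀ i j, G.Adj (φ₅ i) (ψ₂ j) ↔ i ≠ j := fun i j => by rw [ne_eq, ← hr i j, not_not]
  have hs' : ∀ i j, G.Adj (φ₂ i) (ψ₅ j) ↔ i ≠ j := fun i j => by rw [ne_eq, ← hs i j, not_not]
  have e1 : ∀ i j, G.Adj (φ₅ i) (ψ₅ j) := fun i j => by
    have := h.card_nbrs₅' (hφ₅.apply i).2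
    simp only [(hφ₅.apply i).1, true_iff] at this
    exact adj_of_card_filter_le (by rw [h.card_right₅, this]) (hψ₅.apply j)
  have e2 : ∀ i j, ¬ G.Adj (φ₂ i) (ψ₂ j) := fun i j hadj => by
    have := h.card_nbrs₂ (hφ₂.apply i).2
    have hmem : ψ₂ j ∈ Finset.univ.filter fun v =>
        (¬ (S (φ₂ i) ↔ S v) ∧ ¬ T v) ∧ G.Adj (φ₂ i) v := by
      simp [hadj, (hφ₂.apply i).1, (hψ₂.apply j).1, (hψ₂.apply j).2]
    have := Finset.card_pos.mpr ⟨_, hmem⟩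
    omega
  refine ((hφ₅.sumElim hφ₂ (R := S) (fun v => ?_) fun v hv hv' => hv'.2 hv.2).sumElim_compl
    (hψ₂.sumElim hψ₅ (fun v => ?_) fun v hv hv' => hv.2 hv'.2)).nonempty_iso (fun _ => trivial) ?_
  · by_cases hv : T v <;> simp [hv]
  · by_cases hv : T v <;> simp [hv]
  have n1 : ∀ i j, ¬ G.Adj (φ₅ i) (φ₅ j) := fun i j =>
    h.not_adj (iff_of_true (hφ₅.apply i).1 (hφ₅.apply j).1)
  have n2 : ∀ i j, ¬ G.Adj (φ₅ i) (φ₂ j) := fun i j =>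
    h.not_adj (iff_of_true (hφ₅.apply i).1 (hφ₂.apply j).1)
  have n3 : ∀ i j, ¬ G.Adj (φ₂ i) (φ₂ j) := fun i j =>
    h.not_adj (iff_of_true (hφ₂.apply i).1 (hφ₂.apply j).1)
  have m1 : ∀ i j, ¬ G.Adj (ψ₅ i) (ψ₅ j) := fun i j =>
    h.not_adj (iff_of_false (hψ₅.apply i).1 (hψ₅.apply j).1)
  have m2 : ∀ i j, ¬ G.Adj (ψ₅ i) (ψ₂ j) := fun i j =>
    h.not_adj (iff_of_false (hψ₅.apply i).1 (hψ₂.apply j).1)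
  have m3 : ∀ i j, ¬ G.Adj (ψ₂ i) (ψ₂ j) := fun i j =>
    h.not_adj (iff_of_false (hψ₂.apply i).1 (hψ₂.apply j).1)
  rintro ((i | i) | (i | i)) ((j | j) | (j | j)) <;>
    simp [typeIVb, bipartiteGraphOf, graphOfMatrix_adj, allOnes_apply, JsubI_eq_one_iff, hr', hs',
      e1, e2, n1, n2, n3, m1, m2, m3, G.adj_comm (φ₂ _) (φ₅ _), G.adj_comm (ψ₅ _) (φ₅ _),
      G.adj_comm (ψ₅ _) (φ₂ _), G.adj_comm (ψ₂ _) (φ₅ _), G.adj_comm (ψ₂ _) (φ₂ _),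
      G.adj_comm (ψ₂ _) (ψ₅ _)]

namespace IsCliqueBlowup

variable {p q : V → ℝ}

theorem existsUnique_of_twinCard_eq_two (h : IsCliqueBlowup G p q S) {v : V} (hv : S v)
    (h2 : twinCard G v = 2) : ∃! w, S w ∧ G.Adj v w := by
  have hcard : ((Finset.univ.filter fun z => Twin G v z).erase v).card = 1 := by
    rw [Finset.card_erase_of_mem (by simp [Twin.refl])]
    exact Nat.sub_eq_of_eq_add h2
  obtain ⟨w, hw⟩ := Finset.card_eq_one.mp hcard
  have hw' : ∀ z, (z ≠ v ∧ Twin G v z) ↔ z = w := fun z => by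
    simpa using congrArg (z ∈ ·) hw
  have hw₀ := (hw' w).mpr rfl
  refine ⟨w, ⟨(h.side_of_twin hw₀.2).mp hv, hw₀.2.adj hw₀.1.symm⟩, fun z hz => ?_⟩
  exact (hw' z).mp ⟨hz.2.ne', h.twin_of_adj hz.2 (iff_of_true hv hz.1)⟩

/-- A side consisting of at least two cliques of order 2. -/
theorem exists_enumeration_of_twinCard_eq_two (h : IsCliqueBlowup G p q S)
    (h2 : ∀ u, S u → twinCard G u = 2) (hne : ∃ u v, S u ∧ S v ∧ ¬ Twin G u v) :
    ∃ k, 2 ≤ k ∧ ∃ φ : Fin (2 * k) → V, Enumerates φ S ∧ ∀ i j, G.Adj (φ i) (φ j) ↔ j = i.rev := by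
  obtain ⟨k, φ, hφ, hadj⟩ := Enumerates.exists_of_matching (G := G) (P := S) fun v hv =>
    h.existsUnique_of_twinCard_eq_two hv (h2 v hv)
  refine ⟨k, ?_, φ, hφ, hadj⟩
  obtain ⟨u, v, hu, hv, ht⟩ := hne
  obtain ⟨i, rfl⟩ := (hφ.iff_exists u).mp hu
  obtain ⟨j, rfl⟩ := (hφ.iff_exists v).mp hv
  by_contra hk
  have hij : i ≠ j := by rintro rfl; exact ht (Twin.refl _ _)
  refine ht (h.twin_of_adj ((hadj i j).mpr ?_) (iff_of_true hu hv))
  have := i.2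
  have := j.2
  have := Fin.val_ne_of_ne hij
  ext
  rw [Fin.val_rev]
  omega

/-- A clique completely joined to cliques of order 2 is of type (ii). -/
theorem rep_two (h : IsCliqueBlowup G p q S) (hc : ∀ u v, S u → ¬ S v → G.Adj u v)
    (h1 : ∀ u v, S u → S v → Twin G u v) (h2 : ∀ v, ¬ S v → twinCard G v = 2)
    (hne : ∃ u v, ¬ S u ∧ ¬ S v ∧ ¬ Twin G u v) : ∃ a k, (Shape.two a k).Valid ∧
      (Shape.two a k).Rep G := by
  obtain ⟨k, hk, ψ, hψ, hadj⟩ := h.compl.exists_enumeration_of_twinCard_eq_two h2 hne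
  obtain ⟨φ, hφ⟩ := Enumerates.exists_of_card (P := S) rfl
  have hS : ∃ u, S u := by
    obtain ⟨v, -, hv, -⟩ := hne
    obtain ⟨u, -, hu⟩ := h.exists_cross v
    exact ⟨u, by tauto⟩
  refine ⟨_, k, ⟨?_, hk⟩, (hφ.sumElim_compl hψ).nonempty_iso (fun _ => trivial) ?_⟩
  · obtain ⟨u, hu⟩ := hS
    exact Finset.card_pos.mpr ⟨u, by simp [hu]⟩
  have e1 : ∀ i j, G.Adj (φ i) (φ j) ↔ i ≠ j := fun i j =>
    ⟨fun e => by rintro rfl; exact e.ne rfl, fun e =>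
      (h1 _ _ (hφ.apply i) (hφ.apply j)).adj (hφ.injective.ne e)⟩
  have e2 : ∀ i j, G.Adj (φ i) (ψ j) := fun i j => hc _ _ (hφ.apply i) (hψ.apply j)
  have e3 : ∀ i : Fin (2 * k), i ≠ i.rev := fun i hi => ((hadj i i).mpr hi).ne rfl
  rintro (i | i) (j | j)
  · simp [typeII, graphOfMatrix_adj, JsubI_eq_one_iff, e1, eq_comm]
  · simp [typeII, graphOfMatrix_adj, allOnes_apply, e2]
  · simp [typeII, graphOfMatrix_adj, allOnes_apply, (e2 _ _).symm]
  · simp only [typeII, graphOfMatrix_adj, Matrix.fromBlocks_apply₂₂, reverseId_eq_one_iff,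
      Sum.elim_inr, hadj, eq_rev_comm (i := i), or_self]
    exact ⟨fun h => h.2, fun h => ⟨fun e => e3 i ((Sum.inr_injective e).trans h), h⟩⟩

/-- Two sides that consist of cliques of order 2 form a graph of type (iii). -/
theorem rep_three (h : IsCliqueBlowup G p q S) (hc : ∀ u v, S u → ¬ S v → G.Adj u v)
    (h1 : ∀ u, S u → twinCard G u = 2) (hne : ∃ u v, S u ∧ S v ∧ ¬ Twin G u v)
    (h2 : ∀ v, ¬ S v → twinCard G v = 2) (hne' : ∃ u v, ¬ S u ∧ ¬ S v ∧ ¬ Twin G u v) :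
    ∃ l m, (Shape.three l m).Valid ∧ (Shape.three l m).Rep G := by
  obtain ⟨l, hl, φ, hφ, hadj⟩ := h.exists_enumeration_of_twinCard_eq_two h1 hne
  obtain ⟨m, hm, ψ, hψ, hadj'⟩ := h.compl.exists_enumeration_of_twinCard_eq_two h2 hne'
  have key : ∀ {l m : ℕ} {φ : Fin (2 * l) → V} {ψ : Fin (2 * m) → V} {P : V → Prop},
      Enumerates (Sum.elim φ ψ) P → (∀ v, P v) → (∀ i j, G.Adj (φ i) (φ j) ↔ j = i.rev) →
      (∀ i j, G.Adj (ψ i) (ψ j) ↔ j = i.rev) → (∀ i j, G.Adj (φ i) (ψ j)) →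
      (Shape.three l m).Rep G := by
    intro l m φ ψ P he hP hadj hadj' e2
    refine he.nonempty_iso hP ?_
    have e3 : ∀ i : Fin (2 * l), i ≠ i.rev := fun i hi => ((hadj i i).mpr hi).ne rfl
    have e4 : ∀ i : Fin (2 * m), i ≠ i.rev := fun i hi => ((hadj' i i).mpr hi).ne rfl
    rintro (i | i) (j | j)
    · simp only [typeIII, graphOfMatrix_adj, Matrix.fromBlocks_apply₁₁, reverseId_eq_one_iff,
        Sum.elim_inl, hadj, eq_rev_comm (i := i), or_self]
      exact ⟨fun h => h.2, fun h => ⟨fun e => e3 i ((Sum.inl_injective e).trans h), h⟩⟩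
    · simp [typeIII, graphOfMatrix_adj, allOnes_apply, e2]
    · simp [typeIII, graphOfMatrix_adj, allOnes_apply, (e2 _ _).symm]
    · simp only [typeIII, graphOfMatrix_adj, Matrix.fromBlocks_apply₂₂, reverseId_eq_one_iff,
        Sum.elim_inr, hadj', eq_rev_comm (i := i), or_self]
      exact ⟨fun h => h.2, fun h => ⟨fun e => e4 i ((Sum.inr_injective e).trans h), h⟩⟩
  have e2 : ∀ i j, G.Adj (φ i) (ψ j) := fun i j => hc _ _ (hφ.apply i) (hψ.apply j)
  rcases le_total m l with hml | hml
  · exact ⟨l, m, ⟨hm, hml⟩, key (hφ.sumElim_compl hψ) (fun _ => trivial) hadj hadj' e2⟩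
  · exact ⟨m, l, ⟨hl, hml⟩, key (hψ.sumElim hφ (R := fun _ => True) (fun v => by simp [em'])
      fun v => id) (fun _ => trivial) hadj' hadj fun i j => (e2 j i).symm⟩

/-- If one side consists of a vertex and a clique, the graph is one of the three sporadic ones. -/
theorem rep_five (h : IsCliqueBlowup G p q S) (hc : ∀ u v, S u → ¬ S v → G.Adj u v)
    {u u' : V} (hu : S u) (hu' : S u') (ht : ¬ Twin G u u') (h1 : twinCard G u = 1)
    (hall : ∀ z, S z → Twin G u z ∨ Twin G u' z) :
    ∃ c a, (Shape.five c a).Valid ∧ (Shape.five c a).Rep G := by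
  obtain ⟨hcl, a, c, hcc, ha, hval⟩ := h.vertex_and_clique hc hu hu' ht h1 hall
  refine ⟨c, a, hval, ?_⟩
  obtain ⟨φ, hφ⟩ := Enumerates.exists_of_card ha
  obtain ⟨ω, hω⟩ := Enumerates.exists_of_card h1
  obtain ⟨v, -, hv⟩ := h.exists_cross u
  have hv : ¬ S v := by tauto
  obtain ⟨ψ, hψ⟩ := Enumerates.exists_of_card (hcc v hv)
  have hψS : ∀ z, Twin G v z ↔ ¬ S z := fun z =>
    ⟨fun hz => (h.compl.side_of_twin hz).mp hv, fun hz => hcl v z hv hz⟩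
  have hS : ∀ z, S z ↔ Twin G u z ∨ Twin G u' z := fun z =>
    ⟨hall z, fun hz => hz.elim (fun hz => (h.side_of_twin hz).mp hu)
      fun hz => (h.side_of_twin hz).mp hu'⟩
  have e1 : ∀ i j, G.Adj (ψ i) (ψ j) ↔ i ≠ j := fun i j =>
    ⟨fun e => by rintro rfl; exact e.ne rfl, fun e =>
      ((hψ.apply i).symm.trans (hψ.apply j)).adj (hψ.injective.ne e)⟩
  have e2 : ∀ i j, G.Adj (φ i) (φ j) ↔ i ≠ j := fun i j =>
    ⟨fun e => by rintro rfl; exact e.ne rfl, fun e =>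
      ((hφ.apply i).symm.trans (hφ.apply j)).adj (hφ.injective.ne e)⟩
  have e3 : ∀ i j, G.Adj (ψ i) (φ j) := fun i j =>
    (hc _ _ ((hS _).mpr (Or.inr (hφ.apply j))) ((hψS _).mp (hψ.apply i))).symm
  have e4 : ∀ i j, G.Adj (ψ i) (ω j) := fun i j =>
    (hc _ _ ((hS _).mpr (Or.inl (hω.apply j))) ((hψS _).mp (hψ.apply i))).symm
  have e5 : ∀ i j, ¬ G.Adj (ω i) (φ j) := fun i j hadj => by
    have hs : S (ω i) ↔ S (φ j) := iff_of_true ((hS _).mpr (Or.inl (hω.apply i)))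
      ((hS _).mpr (Or.inr (hφ.apply j)))
    exact ht (((hω.apply i).trans (h.twin_of_adj hadj hs)).trans (hφ.apply j).symm)
  have e6 : ∀ i j, ¬ G.Adj (ω i) (ω j) := fun i j hadj =>
    hadj.ne (congrArg ω (Subsingleton.elim i j))
  refine (hψ.sumElim (hω.sumElim hφ hS fun z hz hz' => ht (hz.trans hz'.symm))
    (R := fun _ => True) (fun z => ?_) fun z hz => (hψS z).mp hz).nonempty_iso (fun _ => trivial) ?_
  · simp [hψS, em']
  rintro (i | (i | i)) (j | (j | j)) <;>
    simp [typeV, graphOfMatrix_adj, allOnes_apply, JsubI_eq_one_iff, e1, e2, e3, e4, e5, e6,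
      G.adj_comm (φ _) (ψ _), G.adj_comm (ω _) (ψ _), G.adj_comm (φ _) (ω _), eq_comm]

/-- Every connected graph with a planar Gram representation, given by its two sides, is listed. -/
theorem exists_shape (h : IsCliqueBlowup G p q S) [Nonempty V] :
    ∃ c : Shape, c.Valid ∧ c.Rep G := by
  by_cases hc : ∀ u v, S u → ¬ S v → G.Adj u v
  · have hc' : ∀ u v, ¬ S u → ¬ ¬ S v → G.Adj u v :=
      fun a b ha hb => (hc b a (not_not.mp hb) ha).symm
    rcases h.side_cases hc with h1 | ⟨h1, hne⟩ | ⟨u, v, hu, hv, ht, h1, -, hall⟩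
    · rcases h.compl.side_cases hc' with h2 | ⟨h2, hne'⟩ | ⟨u, v, hu, hv, ht, h2, -, hall⟩
      · exfalso
        have huniv : ∀ u z : V, z = u ∨ G.Adj u z := by
          intro u z
          by_cases hz : z = u
          · exact Or.inl hz
          refine Or.inr ?_
          by_cases hSu : S u <;> by_cases hSz : S z
          exacts [(h1 u z hSu hSz).adj (Ne.symm hz), hc u z hSu hSz, (hc z u hSz hSu).symm,
            (h2 u z hSu hSz).adj (Ne.symm hz)]
        obtain ⟨v⟩ := ‹Nonempty V›
        obtain ⟨u, -, hu⟩ := h.exists_cross v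
        exact hu (h.side_of_twin fun z => iff_of_true (huniv v z) (huniv u z))
      · obtain ⟨a, k, hv, hr⟩ := h.rep_two hc h1 h2 hne'
        exact ⟨_, hv, hr⟩
      · obtain ⟨c, a, hv, hr⟩ := h.compl.rep_five hc' hu hv ht h2 hall
        exact ⟨_, hv, hr⟩
    · rcases h.compl.side_cases hc' with h2 | ⟨h2, hne'⟩ | ⟨u, v, hu, hv, ht, h2, -, hall⟩
      · obtain ⟨a, k, hv, hr⟩ := h.compl.rep_two hc' h2 (by simpa using h1) (by simpa using hne)
        exact ⟨_, hv, hr⟩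
      · obtain ⟨l, m, hv, hr⟩ := h.rep_three hc h1 hne h2 hne'
        exact ⟨_, hv, hr⟩
      · obtain ⟨c, a, hv, hr⟩ := h.compl.rep_five hc' hu hv ht h2 hall
        exact ⟨_, hv, hr⟩
    · obtain ⟨c, a, hv, hr⟩ := h.rep_five hc hu hv ht h1 hall
      exact ⟨_, hv, hr⟩
  · push Not at hc
    obtain ⟨u, v, hu, hv, huv⟩ := hc
    rcases h.of_not_complete hu hv huv with ⟨T, a, m, hT | hT, ham⟩ | ⟨m, hm, hcr⟩ | ⟨T, hT | hT⟩
    · exact ⟨.six a m, ham, hT.rep⟩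
    · exact ⟨.six a m, ham, hT.rep⟩
    · exact ⟨.crown m, hm, hcr.rep⟩
    · exact ⟨.fourA, trivial, hT.rep_fourA⟩
    · exact ⟨.fourB, trivial, hT.rep_fourB⟩

end IsCliqueBlowup

end Recognition

/-! ### The spectra of the listed graphs -/

section Types

variable {V : Type*}

theorem adjMatrix_graphOfMatrix {M : Matrix V V ℤ} (hM : M.IsAdjMatrix)
    [DecidableRel (graphOfMatrix M).Adj] :
    (graphOfMatrix M).adjMatrix ℝ = M.map (Int.cast : ℤ → ℝ) := by
  ext i j
  have hij : (graphOfMatrix M).Adj i j ↔ M i j = 1 := by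
    rw [graphOfMatrix_adj, hM.symm.apply, or_self]
    refine ⟨fun h => h.2, fun h => ⟨?_, h⟩⟩
    rintro rfl
    simp [hM.apply_diag] at h
  rw [SimpleGraph.adjMatrix_apply, Matrix.map_apply]
  rcases hM.zero_or_one i j with h | h <;> simp [hij, h]

/-- The integral version of `hasSpectralType_of_plane`. -/
theorem hasSpectralType_graphOfMatrix [Fintype V] [DecidableEq V] {M : Matrix V V ℤ}
    (hM : M.IsAdjMatrix) (f g : V → ℤ) (a b c d α β γ : ℤ) {τ ρ : ℤ}
    (hf : ∀ i, (M *ᵥ f) i = a * f i + b * g i) (hg : ∀ i, (M *ᵥ g) i = c * f i + d * g i)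
    (hτ : a + d = τ) (hρ : a * d - b * c = ρ) (h1 : ρ < -1 - τ) (h2 : ρ < -1 + τ)
    (hfg : ∃ i j, f i * g j - f j * g i ≠ 0)
    (hB : ∀ i j, (M * M) i j - (1 : Matrix V V ℤ) i j
      = f i * (α * f j + β * g j) + g i * (β * f j + γ * g j)) :
    HasSpectralType (graphOfMatrix M) τ ρ := by
  classical
  have hA := adjMatrix_graphOfMatrix hM
  have hmul : ∀ x : V → ℤ, ∀ i, ((graphOfMatrix M).adjMatrix ℝ *ᵥ fun j => (x j : ℝ)) i
      = ((M *ᵥ x) i : ℤ) := by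
    intro x i
    rw [hA]
    simp [Matrix.mulVec, dotProduct]
  refine hasSpectralType_of_plane (f := fun i => (f i : ℝ)) (g := fun i => (g i : ℝ)) (a := a)
    (b := b) (c := c) (d := d) (α := α) (β := β) (γ := γ) ?_ ?_ (by exact_mod_cast hτ)
    (by exact_mod_cast hρ) (by exact_mod_cast h1) (by exact_mod_cast h2) ?_ ?_
  · ext i
    rw [hmul, hf]
    simp
  · ext i
    rw [hmul, hg]
    simp
  · obtain ⟨i, j, hij⟩ := hfg
    exact ⟨i, j, by exact_mod_cast hij⟩
  · intro i j
    have e : ((graphOfMatrix M).adjMatrix ℝ * (graphOfMatrix M).adjMatrix ℝ) i j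
        = ((M * M) i j : ℤ) := by
      rw [hA]
      simp [Matrix.mul_apply]
    have e' : (1 : Matrix V V ℝ) i j = ((1 : Matrix V V ℤ) i j : ℤ) := by
      rw [Matrix.one_apply, Matrix.one_apply]
      split_ifs <;> simp
    rw [e, e']
    exact_mod_cast hB i j

theorem isSymm_JsubI (n : ℕ) : (JsubI n).IsSymm := by
  ext i j
  simp only [Matrix.transpose_apply, JsubI_apply, eq_comm]

theorem isSymm_reverseId (n : ℕ) : (reverseId n).IsSymm := by
  ext i j
  simp only [Matrix.transpose_apply, reverseId_apply, eq_rev_comm]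

theorem transpose_allOnes (m n : Type*) : (allOnes m n)ᵀ = allOnes n m := rfl

theorem isAdjMatrix_JsubI (n : ℕ) : (JsubI n).IsAdjMatrix where
  zero_or_one i j := by
    rw [JsubI_apply]
    split_ifs <;> simp
  symm := isSymm_JsubI n
  apply_diag i := by simp [JsubI_apply]

theorem isAdjMatrix_reverseId (k : ℕ) : (reverseId (2 * k)).IsAdjMatrix where
  zero_or_one i j := by
    rw [reverseId_apply]
    split_ifs <;> simp
  symm := isSymm_reverseId _
  apply_diag i := by
    rw [reverseId_apply, if_neg]
    intro h
    have := congrArg Fin.val h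
    rw [Fin.val_rev] at this
    omega

theorem isAdjMatrix_fromBlocks {m n : Type*} {A : Matrix m m ℤ} {B : Matrix m n ℤ}
    {C : Matrix n m ℤ} {D : Matrix n n ℤ} (hA : A.IsAdjMatrix) (hC : Bᵀ = C)
    (hB : ∀ i j, B i j = 0 ∨ B i j = 1) (hD : D.IsAdjMatrix) :
    (Matrix.fromBlocks A B C D).IsAdjMatrix where
  zero_or_one := by
    subst hC
    rintro (i | i) (j | j)
    exacts [hA.zero_or_one i j, hB i j, hB j i, hD.zero_or_one i j]
  symm := by
    subst hC
    exact Matrix.IsSymm.fromBlocks hA.symm rfl hD.symm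
  apply_diag := by
    rintro (i | i)
    exacts [hA.apply_diag i, hD.apply_diag i]

theorem allOnes_eq_zero_or_one {m n : Type*} (i : m) (j : n) :
    allOnes m n i j = 0 ∨ allOnes m n i j = 1 := Or.inr rfl

theorem allOnes_mul_allOnes (m : Type*) (n : ℕ) (l : Type*) :
    allOnes m (Fin n) * allOnes (Fin n) l = (n : ℤ) • allOnes m l := by
  ext i j
  simp [Matrix.mul_apply, allOnes_apply]

theorem JsubI_mul_allOnes (n : ℕ) (l : Type*) :
    JsubI n * allOnes (Fin n) l = ((n : ℤ) - 1) • allOnes (Fin n) l := by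
  rw [JsubI, Matrix.sub_mul, Matrix.one_mul, allOnes_mul_allOnes, sub_smul, one_smul]

theorem allOnes_mul_JsubI (n : ℕ) (l : Type*) :
    allOnes l (Fin n) * JsubI n = ((n : ℤ) - 1) • allOnes l (Fin n) := by
  rw [JsubI, Matrix.mul_sub, Matrix.mul_one, allOnes_mul_allOnes, sub_smul, one_smul]

theorem JsubI_mul_JsubI (n : ℕ) :
    JsubI n * JsubI n = ((n : ℤ) - 2) • allOnes (Fin n) (Fin n) + 1 := by
  nth_rewrite 2 [JsubI]
  rw [Matrix.mul_sub, Matrix.mul_one, JsubI_mul_allOnes, JsubI, sub_smul, sub_smul, one_smul,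
    two_smul]
  abel

theorem reverseId_mul (n : ℕ) {l : Type*} (M : Matrix (Fin n) l ℤ) (i : Fin n) (j : l) :
    (reverseId n * M) i j = M i.rev j := by
  simp [Matrix.mul_apply, reverseId_apply]

theorem reverseId_mul_reverseId (n : ℕ) : reverseId n * reverseId n = 1 := by
  ext i j
  rw [reverseId_mul, reverseId_apply, Fin.rev_rev, Matrix.one_apply]
  simp only [eq_comm]

theorem reverseId_mul_allOnes (n : ℕ) (l : Type*) :
    reverseId n * allOnes (Fin n) l = allOnes (Fin n) l := by
  ext i j
  rw [reverseId_mul, allOnes_apply, allOnes_apply]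

theorem allOnes_mul_reverseId (n : ℕ) (l : Type*) :
    allOnes l (Fin n) * reverseId n = allOnes l (Fin n) := by
  rw [← transpose_allOnes, ← (isSymm_reverseId n).eq, ← Matrix.transpose_mul,
    reverseId_mul_allOnes]

theorem allOnes_mulVec (m : Type*) (n : ℕ) (x : ℤ) :
    allOnes m (Fin n) *ᵥ (fun _ => x) = fun _ => n * x := by
  ext i
  simp [Matrix.mulVec, dotProduct, allOnes_apply]

theorem JsubI_mulVec (n : ℕ) (x : ℤ) : JsubI n *ᵥ (fun _ => x) = fun _ => (n - 1) * x := by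
  rw [JsubI, Matrix.sub_mulVec, Matrix.one_mulVec, allOnes_mulVec]
  ext i
  simp only [Pi.sub_apply]
  ring

theorem reverseId_mulVec (n : ℕ) (x : ℤ) : reverseId n *ᵥ (fun _ => x) = fun _ => x := by
  ext i
  simp [Matrix.mulVec, dotProduct, reverseId_apply]

theorem adjSpectrum_disjointEdges (k : ℕ) :
    ∀ x ∈ adjSpectrum (disjointEdges k), x = 1 ∨ x = -1 := by
  classical
  refine adjSpectrum_eq_one_or_of_sq _ ?_
  rw [disjointEdges, adjMatrix_graphOfMatrix (isAdjMatrix_reverseId k)]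
  have h : (reverseId (2 * k)).map (Int.castRingHom ℝ) * (reverseId (2 * k)).map (Int.castRingHom ℝ)
      = 1 := by
    rw [← Matrix.map_mul, reverseId_mul_reverseId, Matrix.map_one _ (map_zero _) (map_one _)]
  exact h

theorem isAdjMatrix_typeII (a k : ℕ) : (Matrix.fromBlocks (JsubI a) (allOnes _ _) (allOnes _ _)
    (reverseId (2 * k))).IsAdjMatrix :=
  isAdjMatrix_fromBlocks (isAdjMatrix_JsubI a) rfl allOnes_eq_zero_or_one (isAdjMatrix_reverseId k)

/-- Here and for the other infinite families, `f` and `g` are the indicators of the two blocks of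
vertices: the partition into these blocks is equitable, and `A² - 1` is constant on them. -/
theorem hasSpectralType_typeII {a k : ℕ} (ha : 1 ≤ a) (hk : 2 ≤ k) :
    HasSpectralType (typeII a k) (a : ℤ) (a - 1 - 2 * k * a : ℤ) := by
  have ha' : (1 : ℤ) ≤ a := by exact_mod_cast ha
  have hk' : (2 : ℤ) ≤ k := by exact_mod_cast hk
  have hka := mul_le_mul_of_nonneg_right hk' (by linarith : (0 : ℤ) ≤ a)
  refine hasSpectralType_graphOfMatrix (isAdjMatrix_typeII a k)
    (Sum.elim (fun _ => 1) fun _ => 0) (Sum.elim (fun _ => 0) fun _ => 1) (a - 1) a (2 * k) 1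
    (a - 2 + 2 * k) a a ?_ ?_ (by ring) (by ring) (by linarith) (by linarith)
    ⟨Sum.inl ⟨0, by omega⟩, Sum.inr ⟨0, by omega⟩, by simp⟩ ?_
  · rw [Matrix.fromBlocks_mulVec]
    rintro (i | i) <;> simp [JsubI_mulVec, allOnes_mulVec, reverseId_mulVec, Function.comp_def]
  · rw [Matrix.fromBlocks_mulVec]
    rintro (i | i) <;> simp [JsubI_mulVec, allOnes_mulVec, reverseId_mulVec, Function.comp_def]
  · rw [Matrix.fromBlocks_multiply, ← Matrix.fromBlocks_one, JsubI_mul_JsubI, allOnes_mul_allOnes,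
      JsubI_mul_allOnes, allOnes_mul_reverseId, allOnes_mul_JsubI, reverseId_mul_allOnes,
      allOnes_mul_allOnes, reverseId_mul_reverseId]
    rintro (i | i) (j | j) <;> simp [allOnes_apply, -zsmul_eq_mul, -nsmul_eq_mul]
    ring

theorem isAdjMatrix_typeIII (l m : ℕ) : (Matrix.fromBlocks (reverseId (2 * l)) (allOnes _ _)
    (allOnes _ _) (reverseId (2 * m))).IsAdjMatrix :=
  isAdjMatrix_fromBlocks (isAdjMatrix_reverseId l) rfl allOnes_eq_zero_or_one
    (isAdjMatrix_reverseId m)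

theorem hasSpectralType_typeIII {l m : ℕ} (hl : 2 ≤ l) (hm : 2 ≤ m) :
    HasSpectralType (typeIII l m) (2 : ℤ) (1 - 4 * l * m : ℤ) := by
  have hl' : (2 : ℤ) ≤ l := by exact_mod_cast hl
  have hm' : (2 : ℤ) ≤ m := by exact_mod_cast hm
  have hlm := mul_le_mul hl' hm' zero_le_two (by linarith)
  refine hasSpectralType_graphOfMatrix (isAdjMatrix_typeIII l m)
    (Sum.elim (fun _ => 1) fun _ => 0) (Sum.elim (fun _ => 0) fun _ => 1) 1 (2 * l) (2 * m) 1
    (2 * m) 2 (2 * l) ?_ ?_ (by ring) (by ring) (by linarith) (by linarith)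
    ⟨Sum.inl ⟨0, by omega⟩, Sum.inr ⟨0, by omega⟩, by simp⟩ ?_
  · rw [Matrix.fromBlocks_mulVec]
    rintro (i | i) <;> simp [allOnes_mulVec, reverseId_mulVec, Function.comp_def]
  · rw [Matrix.fromBlocks_mulVec]
    rintro (i | i) <;> simp [allOnes_mulVec, reverseId_mulVec, Function.comp_def]
  · rw [Matrix.fromBlocks_multiply, ← Matrix.fromBlocks_one, allOnes_mul_allOnes,
      allOnes_mul_reverseId, reverseId_mul_allOnes, allOnes_mul_reverseId, reverseId_mul_allOnes,
      allOnes_mul_allOnes, reverseId_mul_reverseId, reverseId_mul_reverseId]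
    rintro (i | i) (j | j) <;> simp [allOnes_apply, -zsmul_eq_mul]

theorem hasSpectralType_crown {m : ℕ} (hm : 3 ≤ m) :
    HasSpectralType (bipartiteGraphOf (JsubI m)) (0 : ℤ) (-(m - 1) ^ 2 : ℤ) := by
  have hm' : (3 : ℤ) ≤ m := by exact_mod_cast hm
  refine hasSpectralType_graphOfMatrix (isAdjMatrix_fromBlocks .zero rfl
    (isAdjMatrix_JsubI m).zero_or_one .zero)
    (Sum.elim (fun _ => 1) fun _ => 0) (Sum.elim (fun _ => 0) fun _ => 1) 0 (m - 1) (m - 1) 0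
    (m - 2) 0 (m - 2) ?_ ?_ (by ring) (by ring) (by nlinarith) (by nlinarith)
    ⟨Sum.inl ⟨0, by omega⟩, Sum.inr ⟨0, by omega⟩, by simp⟩ ?_
  · rw [Matrix.fromBlocks_mulVec, (isSymm_JsubI m).eq]
    rintro (i | i) <;> simp [JsubI_mulVec, Function.comp_def]
  · rw [Matrix.fromBlocks_mulVec, (isSymm_JsubI m).eq]
    rintro (i | i) <;> simp [JsubI_mulVec, Function.comp_def]
  · rw [Matrix.fromBlocks_multiply, ← Matrix.fromBlocks_one, (isSymm_JsubI m).eq, JsubI_mul_JsubI]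
    rintro (i | i) (j | j) <;> simp [allOnes_apply, -zsmul_eq_mul]

/-- The entry of a matrix; unlike the application `M i j`, this is a term whose type is visibly the
type of the entries, so that statements about the entries can be decided. -/
def matrixEntry (M : Matrix V V ℤ) (i j : V) : ℤ := M i j

/-- A version of `hasSpectralType_graphOfMatrix` whose hypotheses can be checked by evaluation. -/
theorem hasSpectralType_of_entries [Fintype V] [DecidableEq V] (M : Matrix V V ℤ)
    (f g : V → ℤ) (a b c d α β γ : ℤ) {τ ρ : ℤ}
    (h01 : ∀ i j, matrixEntry M i j = 0 ∨ matrixEntry M i j = 1)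
    (hsymm : ∀ i j, matrixEntry M i j = matrixEntry M j i) (hdiag : ∀ i, matrixEntry M i i = 0)
    (hf : ∀ i, ∑ j, matrixEntry M i j * f j = a * f i + b * g i)
    (hg : ∀ i, ∑ j, matrixEntry M i j * g j = c * f i + d * g i)
    (hτ : a + d = τ) (hρ : a * d - b * c = ρ) (h1 : ρ < -1 - τ) (h2 : ρ < -1 + τ)
    (hfg : ∃ i j, f i * g j - f j * g i ≠ 0)
    (hB : ∀ i j, (∑ k, matrixEntry M i k * matrixEntry M k j) - (if i = j then 1 else 0)
      = f i * (α * f j + β * g j) + g i * (β * f j + γ * g j)) :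
    HasSpectralType (graphOfMatrix M) τ ρ :=
  hasSpectralType_graphOfMatrix ⟨h01, Matrix.IsSymm.ext fun i j => hsymm j i, hdiag⟩ f g
    a b c d α β γ hf hg hτ hρ h1 h2 hfg fun i j => by
      rw [Matrix.one_apply]
      exact hB i j

/-- Here and for the other single graphs, `f` and `g` span the column space of `A² - 1`. -/
theorem hasSpectralType_typeIVa : HasSpectralType typeIVa (0 : ℤ) (-9 : ℤ) :=
  hasSpectralType_of_entries _
    (Sum.elim (Sum.elim (fun _ => 2) fun _ => 1) fun _ => 0)
    (Sum.elim (fun _ => 0) (Sum.elim (fun _ => 2) fun _ => 1)) 0 3 3 0 1 0 1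
    (by decide +kernel) (by decide +kernel) (by decide +kernel) (by decide +kernel)
    (by decide +kernel) (by norm_num) (by norm_num) (by norm_num) (by norm_num)
    (by decide +kernel) (by decide +kernel)

theorem hasSpectralType_typeIVb : HasSpectralType typeIVb (0 : ℤ) (-16 : ℤ) :=
  hasSpectralType_of_entries _
    (Sum.elim (Sum.elim (fun _ => 2) fun _ => 1) fun _ => 0)
    (Sum.elim (fun _ => 0) (Sum.elim (fun _ => 1) fun _ => 2)) 0 4 4 0 1 0 1
    (by decide +kernel) (by decide +kernel) (by decide +kernel) (by decide +kernel)
    (by decide +kernel) (by norm_num) (by norm_num) (by norm_num) (by norm_num)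
    (by decide +kernel) (by decide +kernel)

theorem hasSpectralType_typeV_six_five : HasSpectralType (typeV 6 5) (8 : ℤ) (-24 : ℤ) :=
  hasSpectralType_of_entries _
    (Sum.elim (fun _ => 10) (Sum.elim (fun _ => 5) fun _ => 9))
    (Sum.elim (fun _ => 3) (Sum.elim (fun _ => 2) fun _ => 3)) 4 20 2 4 1 (-3) 10
    (by decide +kernel) (by decide +kernel) (by decide +kernel) (by decide +kernel)
    (by decide +kernel) (by norm_num) (by norm_num) (by norm_num) (by norm_num)
    (by decide +kernel) (by decide +kernel)

theorem hasSpectralType_typeV_four_six : HasSpectralType (typeV 4 6) (7 : ℤ) (-20 : ℤ) :=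
  hasSpectralType_of_entries _
    (Sum.elim (fun _ => 3) (Sum.elim (fun _ => 3) fun _ => 4))
    (Sum.elim (fun _ => 2) (Sum.elim (fun _ => 1) fun _ => 2)) (-4) 24 (-1) 11 1 (-2) 6
    (by decide +kernel) (by decide +kernel) (by decide +kernel) (by decide +kernel)
    (by decide +kernel) (by norm_num) (by norm_num) (by norm_num) (by norm_num)
    (by decide +kernel) (by decide +kernel)

theorem hasSpectralType_typeV_three_eight : HasSpectralType (typeV 3 8) (8 : ℤ) (-21 : ℤ) :=
  hasSpectralType_of_entries _
    (Sum.elim (fun _ => 2) (Sum.elim (fun _ => 2) fun _ => 3))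
    (Sum.elim (fun _ => 3) (Sum.elim (fun _ => 1) fun _ => 3)) (-3) 12 (-1) 11 1 (-1) 2
    (by decide +kernel) (by decide +kernel) (by decide +kernel) (by decide +kernel)
    (by decide +kernel) (by norm_num) (by norm_num) (by norm_num) (by norm_num)
    (by decide +kernel) (by decide +kernel)

theorem hasSpectralType_typeVI_three_five : HasSpectralType (typeVI 3 5) (1 : ℤ) (-32 : ℤ) :=
  hasSpectralType_of_entries _
    (Sum.elim (Sum.elim (fun _ => 3) fun _ => 1) fun _ => 2)
    (Sum.elim (Sum.elim (fun _ => 4) fun _ => 0) fun _ => 3) 17 (-10) 24 (-16) 6 (-4) 3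
    (by decide +kernel) (by decide +kernel) (by decide +kernel) (by decide +kernel)
    (by decide +kernel) (by norm_num) (by norm_num) (by norm_num) (by norm_num)
    (by decide +kernel) (by decide +kernel)

theorem hasSpectralType_typeVI_four_four : HasSpectralType (typeVI 4 4) (2 : ℤ) (-27 : ℤ) :=
  hasSpectralType_of_entries _
    (Sum.elim (Sum.elim (fun _ => 2) fun _ => 1) fun _ => 1)
    (Sum.elim (Sum.elim (fun _ => 1) fun _ => 2) fun _ => 0) 3 4 6 (-1) 2 (-1) 2
    (by decide +kernel) (by decide +kernel) (by decide +kernel) (by decide +kernel)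
    (by decide +kernel) (by norm_num) (by norm_num) (by norm_num) (by norm_num)
    (by decide +kernel) (by decide +kernel)

end Types

/-! ### Main eigenvalues and orders of the listed graphs -/

section Invariants

/-- The sum of the two main eigenvalues of the graph. -/
def Shape.tr : Shape → ℤ
  | crown _ => 0
  | two a _ => a
  | three _ _ => 2
  | fourA => 0
  | fourB => 0
  | five c a => if c = 4 ∧ a = 6 then 7 else 8
  | six a _ => if a = 3 then 1 else 2

/-- The product of the two main eigenvalues of the graph. -/
def Shape.dt : Shape → ℤ
  | crown m => -(m - 1) ^ 2
  | two a k => a - 1 - 2 * k * a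
  | three l m => 1 - 4 * l * m
  | fourA => -9
  | fourB => -16
  | five c _ => if c = 6 then -24 else if c = 4 then -20 else -21
  | six a _ => if a = 3 then -32 else -27

/-- The number of vertices of the graph. -/
def Shape.order : Shape → ℕ
  | crown m => 2 * m
  | two a k => a + 2 * k
  | three l m => 2 * l + 2 * m
  | fourA => 10
  | fourB => 12
  | five c a => c + 1 + a
  | six a m => a + 2 * m

variable {V W : Type*} [Fintype V] [Fintype W]

theorem HasSpectralType.congr {G : SimpleGraph V} {H : SimpleGraph W} {τ ρ : ℝ} (e : G ≃g H)
    (h : HasSpectralType H τ ρ) : HasSpectralType G τ ρ :=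
  h.of_cospectral (adjSpectrum_congr e.symm)

theorem Shape.Rep.hasSpectralType {c : Shape} (hc : c.Valid) {G : SimpleGraph V} (h : c.Rep G) :
    HasSpectralType G c.tr c.dt := by
  cases c with
  | crown m => exact (hasSpectralType_crown hc).congr h.some
  | two a k => exact (hasSpectralType_typeII hc.1 hc.2).congr h.some
  | three l m => exact (hasSpectralType_typeIII (hc.1.trans hc.2) hc.1).congr h.some
  | fourA => exact hasSpectralType_typeIVa.congr h.some
  | fourB => exact hasSpectralType_typeIVb.congr h.some
  | five c a =>
    rcases hc with ⟨rfl, rfl⟩ | ⟨rfl, rfl⟩ | ⟨rfl, rfl⟩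
    exacts [hasSpectralType_typeV_six_five.congr h.some,
      hasSpectralType_typeV_four_six.congr h.some, hasSpectralType_typeV_three_eight.congr h.some]
  | six a m =>
    rcases hc with ⟨rfl, rfl⟩ | ⟨rfl, rfl⟩
    exacts [hasSpectralType_typeVI_three_five.congr h.some,
      hasSpectralType_typeVI_four_four.congr h.some]

theorem Shape.Rep.card_eq {c : Shape} {G : SimpleGraph V} (h : c.Rep G) :
    Fintype.card V = c.order := by
  cases c <;> rw [Fintype.card_congr h.some.toEquiv] <;>
    simp [Shape.order, two_mul, add_assoc]

theorem Shape.Rep.nonempty_iso {c : Shape} {V W : Type*} {G : SimpleGraph V} {H : SimpleGraph W}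
    (h : c.Rep G) (h' : c.Rep H) : Nonempty (G ≃g H) := by
  cases c <;> exact ⟨h.some.trans h'.some.symm⟩

theorem Shape.Rep.congr {c : Shape} {V W : Type*} {G : SimpleGraph V} {H : SimpleGraph W}
    (e : G ≃g H) (h : c.Rep H) : c.Rep G := by
  cases c <;> exact ⟨e.trans h.some⟩

end Invariants

/-! ### The component carrying the main eigenvectors -/

section Core

open scoped Classical

variable {W : Type*} [Fintype W]

/-- The eigenvectors for the two main eigenvalues are supported on one connected component, which
is one of the listed graphs and has the same main eigenvalues. It is formed by the vertices whose
planar vector is not zero. -/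
theorem HasSpectralType.exists_shape {H : SimpleGraph W} {τ ρ : ℝ} (h : HasSpectralType H τ ρ) :
    ∃ (U : Set W) (c : Shape), c.Valid ∧ c.Rep (H.induce U) ∧ c.tr = τ ∧ c.dt = ρ ∧ U.Nonempty ∧
      ∀ u v, H.Adj u v → u ∈ U → v ∈ U := by
  obtain ⟨r, s, p, q, hr, hs, hτ, hρ, hp, hq, hp0, hq0, hgram⟩ := h.exists_gram
  have hgram' : ∀ i j, (common H i j : ℝ) - (if i = j then 1 else 0) = planarInner p q i j := by
    intro i j
    rw [← adjMatrix_mul_self_apply, planarInner, ← hgram, Matrix.one_apply]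
  have hAp : ∀ {f : W → ℝ} {t : ℝ}, H.adjMatrix ℝ *ᵥ f = t • f → ∀ i,
      ∑ j ∈ Finset.univ.filter (fun z => H.Adj i z), f j = t * f i := by
    intro f t hf i
    have := congrFun hf i
    rw [SimpleGraph.adjMatrix_mulVec_apply] at this
    rw [← smul_eq_mul, ← Pi.smul_apply, ← this]
    refine Finset.sum_congr ?_ fun _ _ => rfl
    ext z
    simp
  set U : Set W := {v | ¬ (p v = 0 ∧ q v = 0)} with hU
  have hclosed : ∀ u v, H.Adj u v → u ∈ U → v ∈ U := by
    intro u v huv hu hv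
    -- a vertex with zero vector has a single neighbour
    have h1 : common H v v = 1 := by
      have := hgram' v v
      rw [if_pos rfl, planarInner, hv.1, hv.2] at this
      have : (common H v v : ℝ) = 1 := by linarith
      exact_mod_cast this
    have h2 : (Finset.univ.filter fun z => H.Adj v z) = {u} := by
      simp only [common, and_self] at h1
      obtain ⟨z, hz⟩ := Finset.card_eq_one.mp h1
      have : u ∈ Finset.univ.filter fun z => H.Adj v z := by simp [huv.symm]
      rw [hz, Finset.mem_singleton] at this
      rw [hz, this]
    have e1 := hAp hp v
    have e2 := hAp hq v
    rw [h2, Finset.sum_singleton, hv.1, mul_zero] at e1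
    rw [h2, Finset.sum_singleton, hv.2, mul_zero] at e2
    exact hu ⟨e1, e2⟩
  have hzero : ∀ v, v ∉ U → p v = 0 ∧ q v = 0 := fun v hv => not_not.mp hv
  set G := H.induce U with hG
  have hcommon : ∀ i j : U, common G i j = common H i j := by
    intro i j
    refine Finset.card_bij (fun z _ => z.1) ?_ (fun a _ b _ => Subtype.ext) ?_
    · intro z hz
      simpa [hG] using hz
    · intro z hz
      have hz := (Finset.mem_filter.mp hz).2
      exact ⟨⟨z, hclosed i z hz.1 i.2⟩, by simpa [hG] using hz, rfl⟩
  have hplanar : IsPlanarGram G (fun v => p v) fun v => q v := by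
    refine ⟨fun i j => ?_, fun i => ?_⟩
    · rw [hcommon]
      have := hgram' i j
      simp only [Subtype.ext_iff]
      exact this
    · have := i.2
      simp only [hU, Set.mem_ofPred_eq, not_and_or] at this
      rw [planarInner]
      rcases this with h0 | h0
      · have := mul_self_pos.mpr h0
        nlinarith [mul_self_nonneg (q i)]
      · have := mul_self_pos.mpr h0
        nlinarith [mul_self_nonneg (p i)]
  have hmul : ∀ {f : W → ℝ} {t : ℝ}, H.adjMatrix ℝ *ᵥ f = t • f →
      G.adjMatrix ℝ *ᵥ (fun v => f v) = t • fun v : U => f v := by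
    intro f t hf
    ext i
    rw [SimpleGraph.adjMatrix_mulVec_apply, Pi.smul_apply, smul_eq_mul, ← hAp hf i]
    refine Finset.sum_bij (fun z _ => z.1) ?_ (fun a _ b _ => Subtype.ext) ?_ fun _ _ => rfl
    · intro z hz
      simpa [hG] using hz
    · intro z hz
      have hz := (Finset.mem_filter.mp hz).2
      exact ⟨⟨z, hclosed i z hz i.2⟩, by simpa [hG] using hz, rfl⟩
  have hne : ∀ {f : W → ℝ}, f ≠ 0 → (∀ v, v ∉ U → f v = 0) → (fun v : U => f v) ≠ 0 := by
    intro f hf hf0 h0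
    refine hf (funext fun v => ?_)
    by_cases hv : v ∈ U
    exacts [congrFun h0 ⟨v, hv⟩, hf0 v hv]
  have hp1 := hne hp0 fun v hv => (hzero v hv).1
  have hq1 := hne hq0 fun v hv => (hzero v hv).2
  -- otherwise `G` would be a union of cliques, and `s` would be a vertex degree
  have hcross : ∃ u v, G.Adj u v ∧ ¬ Twin G u v := by
    by_contra hcon
    push Not at hcon
    refine hq1 (funext fun i => ?_)
    have e := congrFun (hmul hq) i
    rw [SimpleGraph.adjMatrix_mulVec_apply, Finset.sum_congr rfl (g := fun _ => q i),
      Finset.sum_const, nsmul_eq_mul, Pi.smul_apply, smul_eq_mul] at e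
    · have e' : ((G.neighborFinset i).card - s) * q i = 0 := by linear_combination e
      refine (mul_eq_zero.mp e').resolve_left ?_
      have : (0 : ℝ) ≤ (G.neighborFinset i).card := Nat.cast_nonneg _
      linarith
    · intro j hj
      rw [SimpleGraph.mem_neighborFinset] at hj
      exact (hplanar.eq_of_twin (hcon i j hj)).2.symm
  have hconn : G.Preconnected := by
    by_contra hcon
    simp only [SimpleGraph.Preconnected] at hcon
    push Not at hcon
    obtain ⟨a, b, hab⟩ := hcon
    obtain ⟨u, v, huv, ht⟩ := hcross
    refine ht (hplanar.twin_of_adj_of_det_eq_zero huv ?_)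
    -- vectors of different components are perpendicular, so both `u` and `v` are perpendicular to
    -- a vertex of another component
    have hperp : ∀ x y, ¬ G.Reachable x y →
        planarInner (fun v : U => p v) (fun v => q v) x y = 0 := by
      intro x y hxy
      have hne : x ≠ y := by rintro rfl; exact hxy (SimpleGraph.Reachable.refl _)
      rw [hplanar.inner_of_ne hne]
      have : common G x y = 0 := by
        rw [common, Finset.card_eq_zero, Finset.filter_eq_empty_iff]
        intro z _ hz
        exact hxy (hz.1.reachable.trans hz.2.symm.reachable)
      rw [this, Nat.cast_zero]
    obtain ⟨w, hw⟩ : ∃ w, ¬ G.Reachable u w := by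
      by_contra hall
      push Not at hall
      exact hab ((hall a).symm.trans (hall b))
    exact planarDet_eq_zero_of_perp (hplanar.pos w) (hperp u w hw)
      (hperp v w fun hvw => hw (huv.reachable.trans hvw))
  obtain ⟨S, hS⟩ := hplanar.exists_isCliqueBlowup hconn hcross
  obtain ⟨u, -⟩ := hcross
  have : Nonempty U := ⟨u⟩
  obtain ⟨c, hc, hrep⟩ := hS.exists_shape
  have hst := hrep.hasSpectralType hc
  obtain ⟨e1, e2⟩ := hst.add_mul_eq hr hs (mem_adjSpectrum_of_mulVec_eq hp1 (hmul hp))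
    (mem_adjSpectrum_of_mulVec_eq hq1 (hmul hq))
  exact ⟨U, c, hc, hrep, by rw [← e1, hτ], by rw [← e2, hρ], ⟨u, u.2⟩, hclosed⟩

end Core

/-! ### Graphs with the same two main eigenvalues -/

theorem eq_univ_of_adj_closed {V : Type*} {G : SimpleGraph V} (hG : G.Preconnected) {U : Set V}
    (hU : U.Nonempty) (h : ∀ u v, G.Adj u v → u ∈ U → v ∈ U) : U = Set.univ := by
  obtain ⟨u, hu⟩ := hU
  refine Set.eq_univ_of_forall fun v => ?_
  obtain ⟨w⟩ := hG u v
  induction w with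
  | nil => exact hu
  | cons hab _ ih => exact ih (h _ _ hab hu)

theorem not_preconnected_sum {V W : Type*} [Nonempty V] [Nonempty W] (G : SimpleGraph V)
    (H : SimpleGraph W) : ¬ (G ⊕g H).Preconnected := by
  intro h
  have hU := eq_univ_of_adj_closed h (U := Set.range Sum.inl) (Set.range_nonempty _) (by
    rintro _ (v | v) huv ⟨u, rfl⟩
    · exact ⟨v, rfl⟩
    · simp at huv)
  obtain ⟨w⟩ := ‹Nonempty W›
  have : Sum.inr w ∈ Set.range (Sum.inl : V → V ⊕ W) := hU ▸ Set.mem_univ _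
  simp at this

/-- A component with a vertex of a connected graph is the whole graph. -/
theorem InClassG.exists_shape {V : Type*} [Fintype V] {G : SimpleGraph V} (h : InClassG G) :
    ∃ c : Shape, c.Valid ∧ c.Rep G := by
  obtain ⟨hconn, r, s, M, h1, h2, h3, h4⟩ := h
  obtain ⟨U, c, hc, hrep, -, -, hU, hclosed⟩ :=
    HasSpectralType.exists_shape (H := G) ⟨r, s, M, h1, h2, rfl, rfl, h3, h4⟩
  obtain rfl := eq_univ_of_adj_closed hconn.preconnected hU hclosed
  exact ⟨c, hc, hrep.congr (SimpleGraph.induceUnivIso G).symm⟩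

/-- The parameters of the graphs that have a cospectral mate. -/
def Shape.Exceptional : Shape → Prop
  | crown _ => False
  | two a k => (a = 1 ∧ k = 16) ∨ (a = 2 ∧ k = 7) ∨ (a = 2 ∧ ¬ k.Prime)
  | three l m => ∃ d, d ∣ l * m ∧ m < d ∧ d < l
  | fourA => True
  | fourB => True
  | five _ _ => False
  | six _ _ => False

/-- Of two different factorizations of a number with `m ≤ l`, the one with the smaller sum has its
larger factor strictly between those of the other. -/
theorem exists_dvd_of_mul_eq_mul {l m l' m' : ℕ} (h2 : m ≤ l) (h2' : m' ≤ l') (hm : 0 < m)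
    (hmul : l' * m' = l * m) (hadd : l' + m' ≤ l + m) (hne : ¬ (l' = l ∧ m' = m)) :
    l' ∣ l * m ∧ m < l' ∧ l' < l := by
  have hl : l' < l := by
    rcases lt_trichotomy l' l with h | rfl | h
    · exact h
    · exact absurd ⟨rfl, Nat.eq_of_mul_eq_mul_left (by omega) hmul⟩ hne
    · exfalso
      zify at *
      nlinarith [mul_pos (sub_pos.mpr h) (by linarith : (0 : ℤ) < l' - m)]
  refine ⟨⟨m', hmul.symm⟩, ?_, hl⟩
  by_contra hcon
  have : l' * m' < l * m := Nat.mul_lt_mul_of_lt_of_le hl (by omega) hm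
  omega

/-- Two graphs in the list with the same main eigenvalues, of which the one with more vertices is
not exceptional, are the same. -/
theorem Shape.eq_of_tr_eq {c c' : Shape} (hc : c.Valid) (hc' : c'.Valid) (htr : c'.tr = c.tr)
    (hdt : c'.dt = c.dt) (hle : c'.order ≤ c.order) (hex : ¬ c.Exceptional) : c' = c := by
  cases c with
  | fourA => exact absurd trivial hex
  | fourB => exact absurd trivial hex
  | crown m =>
    cases c' with
    | crown m' =>
      simp only [Shape.dt, Shape.Valid] at *
      have h1 : ((m' : ℤ) - 1 - (m - 1)) * ((m' : ℤ) - 1 + (m - 1)) = 0 := by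
        linear_combination -hdt
      rcases mul_eq_zero.mp h1 with h | h
      · congr 1
        omega
      · omega
    | two a k => simp only [Shape.tr, Shape.Valid] at *; omega
    | three l m => simp [Shape.tr] at htr
    | fourA =>
      simp only [Shape.dt, Shape.Valid, Shape.order] at *
      have : m ≤ 4 := by
        have : (m : ℤ) ≤ 4 := by nlinarith
        exact_mod_cast this
      omega
    | fourB =>
      simp only [Shape.dt, Shape.Valid, Shape.order] at *
      have : m ≤ 5 := by
        have : (m : ℤ) ≤ 5 := by nlinarith
        exact_mod_cast this
      omega
    | five c a => rcases hc' with ⟨rfl, rfl⟩ | ⟨rfl, rfl⟩ | ⟨rfl, rfl⟩ <;> simp [Shape.tr] at htr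
    | six a m => rcases hc' with ⟨rfl, rfl⟩ | ⟨rfl, rfl⟩ <;> simp [Shape.tr] at htr
  | two a k =>
    simp only [Shape.Exceptional, not_or] at hex
    obtain ⟨hex1, hex2, hex3⟩ := hex
    cases c' with
    | crown m' => simp only [Shape.tr, Shape.Valid] at *; omega
    | two a' k' =>
      simp only [Shape.tr, Shape.dt, Shape.Valid] at *
      obtain rfl : a' = a := by exact_mod_cast htr
      have h1 : (2 * a' : ℤ) * (k' - k) = 0 := by linear_combination -hdt
      rcases mul_eq_zero.mp h1 with h | h
      · omega
      · congr 1
        omega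
    | three l m =>
      simp only [Shape.tr, Shape.dt, Shape.Valid] at *
      obtain rfl : a = 2 := by exact_mod_cast htr.symm
      have : k = l * m := by
        have : (k : ℤ) = l * m := by push_cast at hdt; linarith
        exact_mod_cast this
      -- a product of two numbers greater than `1` is not prime
      refine absurd ⟨rfl, ?_⟩ hex3
      rw [this]
      exact Nat.not_prime_mul (by omega) (by omega)
    | fourA => simp only [Shape.tr, Shape.Valid] at *; omega
    | fourB => simp only [Shape.tr, Shape.Valid] at *; omega
    | five c a' =>
      rcases hc' with ⟨rfl, rfl⟩ | ⟨rfl, rfl⟩ | ⟨rfl, rfl⟩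
      · obtain rfl : a = 8 := by simp [Shape.tr] at htr; omega
        simp [Shape.dt] at hdt
        omega
      · obtain rfl : a = 7 := by simp [Shape.tr] at htr; omega
        simp [Shape.dt] at hdt
        omega
      · obtain rfl : a = 8 := by simp [Shape.tr] at htr; omega
        simp [Shape.dt] at hdt
        omega
    | six a' m' =>
      rcases hc' with ⟨rfl, rfl⟩ | ⟨rfl, rfl⟩
      · obtain rfl : a = 1 := by simp [Shape.tr] at htr; omega
        simp [Shape.dt] at hdt
        omega
      · obtain rfl : a = 2 := by simp [Shape.tr] at htr; omega
        simp [Shape.dt] at hdt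
        omega
  | three l m =>
    have hlm : ∀ {p : ℕ}, p.Prime → (l : ℤ) * m = p → False := by
      intro p hp h
      have h : l * m = p := by exact_mod_cast h
      rw [← h] at hp
      exact Nat.not_prime_mul (by have := hc.1; have := hc.2; omega) (by have := hc.1; omega) hp
    cases c' with
    | crown m' => simp [Shape.tr] at htr
    | two a k =>
      simp only [Shape.tr, Shape.dt, Shape.Valid, Shape.order] at *
      obtain rfl : a = 2 := by exact_mod_cast htr
      have h1 : (k : ℤ) = l * m := by push_cast at hdt; linarith
      have h2 : (2 : ℤ) + 2 * k ≤ 2 * l + 2 * m := by exact_mod_cast hle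
      have h3 : (2 : ℤ) ≤ m := by exact_mod_cast hc.1
      have h4 : (m : ℤ) ≤ l := by exact_mod_cast hc.2
      nlinarith
    | three l' m' =>
      simp only [Shape.dt, Shape.Valid, Shape.order] at *
      by_contra hne
      have h1 : l' * m' = l * m := by
        have : (l' : ℤ) * m' = l * m := by linarith
        exact_mod_cast this
      exact hex ⟨l', exists_dvd_of_mul_eq_mul hc.2 hc'.2 (by omega) h1 (by omega)
        fun h => hne (by rw [h.1, h.2])⟩
    | fourA => simp [Shape.tr] at htr
    | fourB => simp [Shape.tr] at htr
    | five c a => rcases hc' with ⟨rfl, rfl⟩ | ⟨rfl, rfl⟩ | ⟨rfl, rfl⟩ <;> simp [Shape.tr] at htr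
    | six a m' =>
      rcases hc' with ⟨rfl, rfl⟩ | ⟨rfl, rfl⟩
      · simp [Shape.tr] at htr
      · simp [Shape.dt] at hdt
        exact (hlm (p := 7) (by norm_num) (by push_cast; linarith)).elim
  | five c a =>
    rcases hc with ⟨rfl, rfl⟩ | ⟨rfl, rfl⟩ | ⟨rfl, rfl⟩ <;> cases c' with
    | crown m' => simp [Shape.tr] at htr
    | two a' k' =>
      simp [Shape.tr] at htr
      simp [Shape.dt, htr] at hdt
      omega
    | three l m => simp [Shape.tr] at htr
    | fourA => simp [Shape.tr] at htr
    | fourB => simp [Shape.tr] at htr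
    | five c' a' =>
      rcases hc' with ⟨rfl, rfl⟩ | ⟨rfl, rfl⟩ | ⟨rfl, rfl⟩ <;>
        simp [Shape.tr, Shape.dt] at htr hdt ⊢
    | six a' m' =>
      rcases hc' with ⟨rfl, rfl⟩ | ⟨rfl, rfl⟩ <;> simp [Shape.tr] at htr
  | six a m =>
    rcases hc with ⟨rfl, rfl⟩ | ⟨rfl, rfl⟩ <;> cases c' with
    | crown m' => simp [Shape.tr] at htr
    | two a' k' =>
      simp [Shape.tr, Shape.order] at htr hle
      simp [Shape.dt, htr] at hdt
      omega
    | three l m =>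
      simp [Shape.tr] at htr
      try
        simp [Shape.dt, Shape.Valid] at hdt hc'
        have h1 : (l : ℤ) * m = 7 := by linarith
        have h2 : l * m = 7 := by exact_mod_cast h1
        have h3 : Nat.Prime (l * m) := by rw [h2]; norm_num
        exact absurd h3 (Nat.not_prime_mul (by omega) (by omega))
    | fourA => simp [Shape.tr] at htr
    | fourB => simp [Shape.tr] at htr
    | five c' a' =>
      rcases hc' with ⟨rfl, rfl⟩ | ⟨rfl, rfl⟩ | ⟨rfl, rfl⟩ <;> simp [Shape.tr] at htr
    | six a' m' =>
      rcases hc' with ⟨rfl, rfl⟩ | ⟨rfl, rfl⟩ <;> simp [Shape.tr] at htr ⊢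

/-! ### Determination by the spectrum -/

/-- A listed graph that is not exceptional is determined by its spectrum. -/
theorem Shape.Rep.determinedBySpectrum {V : Type*} [Fintype V] {G : SimpleGraph V} {c : Shape}
    (hc : c.Valid) (h : c.Rep G) (hex : ¬ c.Exceptional) : DeterminedBySpectrum G := by
  classical
  intro W _ H hGH
  obtain ⟨U, c', hc', hrep, htr, hdt, -, -⟩ :=
    HasSpectralType.exists_shape ((h.hasSpectralType hc).of_cospectral hGH)
  have hcard : Fintype.card V = Fintype.card W := by
    rw [← card_adjSpectrum G, ← card_adjSpectrum H, hGH]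
  have hle : c'.order ≤ c.order := by
    rw [← h.card_eq, ← hrep.card_eq, hcard]
    exact Fintype.card_subtype_le _
  obtain rfl := Shape.eq_of_tr_eq hc hc' (by exact_mod_cast htr) (by exact_mod_cast hdt) hle hex
  have hU : U = Set.univ := by
    rw [← Set.toFinset_eq_univ, ← Finset.card_eq_iff_eq_univ, Set.toFinset_card, hrep.card_eq,
      ← hcard, h.card_eq]
  subst hU
  exact h.nonempty_iso (hrep.congr (SimpleGraph.induceUnivIso H).symm)

theorem Shape.exists_rep (c : Shape) :
    ∃ (W : Type) (_ : Fintype W) (H : SimpleGraph W), c.Rep H := by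
  cases c <;> exact ⟨_, inferInstance, _, ⟨SimpleGraph.Iso.refl⟩⟩

/-- Adding single edges to a listed graph yields a disconnected graph, which is cospectral with
every listed graph with the right invariants. -/
theorem Shape.Rep.not_determinedBySpectrum {V : Type*} [Fintype V] {G : SimpleGraph V}
    {c c' : Shape} (hc : c.Valid) (h : c.Rep G) (hG : G.Connected) (hc' : c'.Valid)
    (htr : c'.tr = c.tr) (hdt : c'.dt = c.dt) {t : ℕ} (ht : 0 < t)
    (ho : c'.order + 2 * t = c.order) : ¬ DeterminedBySpectrum G := by
  intro hds
  obtain ⟨W, _, H, hH⟩ := c'.exists_rep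
  have hco : Cospectral G (H ⊕g disjointEdges t) := by
    refine (h.hasSpectralType hc).cospectral ?_ ?_
    · rw [← htr, ← hdt]
      exact (hH.hasSpectralType hc').sum (adjSpectrum_disjointEdges t)
    · rw [h.card_eq, Fintype.card_sum, hH.card_eq, Fintype.card_fin, ho]
  obtain ⟨e⟩ := hds _ _ hco
  have hW : Nonempty W := by
    obtain ⟨r, s, M, -, -, -, -, hs, -⟩ := hH.hasSpectralType hc'
    have := card_adjSpectrum H
    rw [hs, Multiset.card_cons] at this
    exact Fintype.card_pos_iff.mp (by omega)
  have : Nonempty (Fin (2 * t)) := ⟨⟨0, by omega⟩⟩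
  exact not_preconnected_sum H (disjointEdges t) (e.connected_iff.mp hG).preconnected

theorem determinedBySpectrum_iff {V : Type*} [Fintype V] {G : SimpleGraph V} (hG : InClassG G) :
    DeterminedBySpectrum G ↔
      ¬ ((Nonempty (G ≃g typeII 1 16) ∨ Nonempty (G ≃g typeII 2 7)) ∨
         (∃ k : ℕ, 2 ≤ k ∧ ¬ k.Prime ∧ Nonempty (G ≃g typeII 2 k)) ∨
         (∃ l m : ℕ, 2 ≤ m ∧ m ≤ l ∧ Nonempty (G ≃g typeIII l m) ∧
            ∃ d : ℕ, d ∣ l * m ∧ m < d ∧ d < l) ∨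
         (Nonempty (G ≃g typeIVa) ∨ Nonempty (G ≃g typeIVb))) := by
  constructor
  · rintro hds ((h | h) | ⟨k, hk, hp, h⟩ | ⟨l, m, hm, hml, h, d, hd, hmd, hdl⟩ | (h | h))
    · exact Shape.Rep.not_determinedBySpectrum (c := .two 1 16) (c' := .six 3 5) (t := 10)
        (by simp [Shape.Valid]) h hG.1 (by simp [Shape.Valid]) rfl rfl (by simp) rfl hds
    · exact Shape.Rep.not_determinedBySpectrum (c := .two 2 7) (c' := .six 4 4) (t := 2)
        (by simp [Shape.Valid]) h hG.1 (by simp [Shape.Valid]) rfl rfl (by simp) rfl hds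
    · -- a factorization `k = b * a` gives the graph of type (iii) with parameters `b` and `a`
      obtain ⟨a, b, ha, hb, rfl⟩ : ∃ a b, 2 ≤ a ∧ a ≤ b ∧ k = b * a := by
        obtain ⟨a, ⟨b, rfl⟩, ha, hlt⟩ := (Nat.not_prime_iff_exists_dvd_lt hk).mp hp
        have hb : 2 ≤ b := by
          by_contra hb
          have := Nat.mul_le_mul_left a (show b ≤ 1 by omega)
          omega
        rcases le_total a b with h | h
        exacts [⟨a, b, ha, h, mul_comm _ _⟩, ⟨b, a, hb, h, rfl⟩]
      refine Shape.Rep.not_determinedBySpectrum (c := .two 2 (b * a)) (c' := .three b a)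
        (t := (b - 1) * (a - 1)) ⟨by simp, hk⟩ h hG.1 ⟨ha, hb⟩ rfl ?_ ?_ ?_ hds
      · simp only [Shape.dt]
        push_cast
        ring
      · exact Nat.mul_pos (by omega) (by omega)
      · obtain ⟨x, rfl⟩ := Nat.exists_eq_add_of_le ha
        obtain ⟨y, rfl⟩ := Nat.exists_eq_add_of_le (ha.trans hb)
        simp only [Shape.order, show 2 + y - 1 = y + 1 by omega, show 2 + x - 1 = x + 1 by omega]
        ring
    · obtain ⟨e, he⟩ := hd
      -- `l * m = d * e` with both `d` and `e` strictly between `m` and `l`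
      have hme : m < e := by
        by_contra hcon
        have := Nat.mul_lt_mul_of_lt_of_le hdl (not_lt.mp hcon) (by omega)
        omega
      have hel : e < l := by
        by_contra hcon
        have := Nat.mul_lt_mul_of_lt_of_le hmd (not_lt.mp hcon) (by omega)
        rw [mul_comm m l] at this
        omega
      obtain ⟨x, y, hx, hxy, hyl, hxyl⟩ : ∃ x y, m < x ∧ x ≤ y ∧ y < l ∧ l * m = y * x := by
        rcases le_total d e with h | h
        · exact ⟨d, e, hmd, h, hel, by rw [he, mul_comm]⟩
        · exact ⟨e, d, hme, h, hdl, he⟩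
      have hlt : y + x < l + m := by
        zify at *
        nlinarith [mul_pos (sub_pos.mpr hx) (sub_pos.mpr hyl)]
      refine Shape.Rep.not_determinedBySpectrum (c := .three l m) (c' := .three y x)
        (t := l + m - (y + x)) ⟨hm, hml⟩ h hG.1 ⟨by omega, hxy⟩ rfl ?_ (by omega) ?_ hds
      · have : (l : ℤ) * m = y * x := by exact_mod_cast hxyl
        simp only [Shape.dt]
        linear_combination 4 * this
      · simp only [Shape.order]
        omega
    · exact Shape.Rep.not_determinedBySpectrum (c := .fourA) (c' := .crown 4) (t := 1)
        trivial h hG.1 (by simp [Shape.Valid]) rfl rfl (by simp) rfl hds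
    · exact Shape.Rep.not_determinedBySpectrum (c := .fourB) (c' := .crown 5) (t := 1)
        trivial h hG.1 (by simp [Shape.Valid]) rfl rfl (by simp) rfl hds
  · intro hno
    obtain ⟨c, hc, hrep⟩ := hG.exists_shape
    refine hrep.determinedBySpectrum hc fun hex => hno ?_
    cases c with
    | crown m => exact hex.elim
    | two a k =>
      rcases hex with ⟨rfl, rfl⟩ | ⟨rfl, rfl⟩ | ⟨rfl, hp⟩
      · exact Or.inl (Or.inl hrep)
      · exact Or.inl (Or.inr hrep)
      · exact Or.inr (Or.inl ⟨k, hc.2, hp, hrep⟩)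
    | three l m => exact Or.inr (Or.inr (Or.inl ⟨l, m, hc.1, hc.2, hrep, hex⟩))
    | fourA => exact Or.inr (Or.inr (Or.inr (Or.inl hrep)))
    | fourB => exact Or.inr (Or.inr (Or.inr (Or.inr hrep)))
    | five c a => exact hex.elim
    | six a m => exact hex.elim

/-! ### The friendship graphs -/

theorem friendshipGraph_adj_none {k : ℕ} (x : Fin k × Bool) :
    (friendshipGraph k).Adj none (some x) := by
  refine ⟨by simp, Or.inl ⟨x.1, by simp [friendshipTriangle], ?_⟩⟩
  rcases x with ⟨i, _ | _⟩ <;> simp [friendshipTriangle]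

theorem friendshipGraph_adj_some {k : ℕ} (x y : Fin k × Bool) :
    (friendshipGraph k).Adj (some x) (some y) ↔ x.1 = y.1 ∧ x.2 ≠ y.2 := by
  rcases x with ⟨i, _ | _⟩ <;> rcases y with ⟨j, _ | _⟩ <;>
    simp [friendshipGraph, friendshipTriangle, eq_comm]

theorem connected_friendshipGraph (k : ℕ) : (friendshipGraph k).Connected := by
  have : ∀ x, (friendshipGraph k).Reachable none x := by
    rintro (_ | x)
    · exact SimpleGraph.Reachable.refl _
    · exact (friendshipGraph_adj_none x).reachable
  exact ⟨fun x y => (this x).symm.trans (this y)⟩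

/-- The triangles of the friendship graph, without the common vertex, form a perfect matching. -/
theorem rep_friendshipGraph (k : ℕ) : (Shape.two 1 k).Rep (friendshipGraph k) := by
  classical
  have hψ := Enumerates.exists_of_matching (G := friendshipGraph k) (P := fun v => v ≠ none) (by
    rintro (_ | ⟨i, b⟩) hv
    · exact absurd rfl hv
    refine ⟨some (i, !b), ⟨by simp, ?_⟩, ?_⟩
    · simp [friendshipGraph_adj_some]
    · rintro (_ | ⟨j, c⟩) ⟨hw, hadj⟩
      · exact absurd rfl hw
      rw [friendshipGraph_adj_some] at hadj
      cases b <;> cases c <;> simp_all)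
  obtain ⟨k', ψ, hψ, hadj⟩ := hψ
  have hφ : Enumerates (fun _ : Fin 1 => (none : Option (Fin k × Bool))) fun v => v = none :=
    ⟨fun i j _ => Subsingleton.elim i j, fun v => by simp [eq_comm]⟩
  have hE := hφ.sumElim hψ (R := fun _ => True) (fun v => by simp [em]) fun v h h' => h' h
  have hk : k = k' := by
    have e : Fin 1 ⊕ Fin (2 * k') ≃ Option (Fin k × Bool) :=
      Equiv.ofBijective _ ⟨hE.injective, fun v => (hE.iff_exists v).mp trivial⟩
    have := Fintype.card_congr e
    simp at this
    omega
  subst hk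
  refine hE.nonempty_iso (fun _ => trivial) ?_
  have e2 : ∀ j, (friendshipGraph k).Adj none (ψ j) := fun j => by
    obtain ⟨x, hx⟩ := Option.ne_none_iff_exists'.mp (hψ.apply j)
    rw [hx]
    exact friendshipGraph_adj_none x
  have e3 : ∀ i : Fin (2 * k), i ≠ i.rev := fun i hi => ((hadj i i).mpr hi).ne rfl
  rintro (i | i) (j | j)
  · simp [typeII, graphOfMatrix_adj, eq_iff_true_of_subsingleton]
  · simp [typeII, graphOfMatrix_adj, allOnes_apply, e2]
  · simp [typeII, graphOfMatrix_adj, allOnes_apply, (e2 _).symm]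
  · simp only [typeII, graphOfMatrix_adj, Matrix.fromBlocks_apply₂₂, reverseId_eq_one_iff,
      Sum.elim_inr, hadj, eq_rev_comm (i := i), or_self]
    exact ⟨fun h => h.2, fun h => ⟨fun e => e3 i ((Sum.inr_injective e).trans h), h⟩⟩

theorem connected_typeVI {a m : ℕ} (ha : 1 ≤ a) (hm : 2 ≤ m) : (typeVI a m).Connected := by
  have h1 : ∀ i j, (typeVI a m).Adj (Sum.inl (Sum.inl i)) (Sum.inl (Sum.inr j)) := fun i j => by
    simp [typeVI, graphOfMatrix_adj, allOnes_apply]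
  have h2 : ∀ i j, i ≠ j → (typeVI a m).Adj (Sum.inl (Sum.inr i)) (Sum.inr j) := fun i j hij => by
    simp [typeVI, graphOfMatrix_adj, JsubI_eq_one_iff, hij]
  have hr : ∀ x, (typeVI a m).Reachable (Sum.inl (Sum.inl ⟨0, ha⟩)) x := by
    have hY : ∀ j, (typeVI a m).Reachable (Sum.inl (Sum.inl ⟨0, ha⟩)) (Sum.inl (Sum.inr j)) :=
      fun j => (h1 _ j).reachable
    rintro ((i | j) | j)
    · exact (hY ⟨0, by omega⟩).trans (h1 i _).symm.reachable
    · exact hY j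
    · obtain ⟨i, hi⟩ : ∃ i : Fin m, i ≠ j := by
        have : Nontrivial (Fin m) := Fin.nontrivial_iff_two_le.mpr hm
        exact exists_ne j
      exact (hY i).trans (h2 i j hi).reachable
  have : Nonempty ((Fin a ⊕ Fin m) ⊕ Fin m) := ⟨Sum.inl (Sum.inl ⟨0, ha⟩)⟩
  exact ⟨fun x y => (hr x).symm.trans (hr y)⟩

/-- The trace of `A²` is the sum of the vertex degrees. -/
theorem sum_sq_adjSpectrum {V : Type*} [Fintype V] [DecidableEq V] (G : SimpleGraph V)
    [DecidableRel G.Adj] : ((adjSpectrum G).map fun x => x ^ 2).sum = ∑ v, (G.degree v : ℝ) := by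
  obtain ⟨U, l, hU, hU', hl, hs⟩ := exists_orthogonal_eigenvectors G
  have h1 : ∀ k, l k ^ 2 = U k ⬝ᵥ (G.adjMatrix ℝ * G.adjMatrix ℝ) *ᵥ U k := by
    intro k
    have hk := congrFun (congrFun hU k) k
    rw [Matrix.one_apply_eq] at hk
    rw [← Matrix.mulVec_mulVec, hl, Matrix.mulVec_smul, hl, smul_smul, dotProduct_smul, smul_eq_mul,
      show U k ⬝ᵥ U k = 1 from hk, mul_one, pow_two]
  have h2 : ∀ v, (G.degree v : ℝ) = (G.adjMatrix ℝ * G.adjMatrix ℝ) v v := fun v => by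
    rw [SimpleGraph.adjMatrix_mul_self_apply_self]
  have h3 : ∑ k, l k ^ 2 = (U * ((G.adjMatrix ℝ * G.adjMatrix ℝ) * Uᵀ)).trace := by
    rw [Matrix.trace]
    refine Finset.sum_congr rfl fun k _ => ?_
    rw [h1]
    rfl
  rw [hs, Multiset.map_map]
  simp only [h2]
  change ∑ k, l k ^ 2 = Matrix.trace (G.adjMatrix ℝ * G.adjMatrix ℝ)
  rw [h3, Matrix.trace_mul_comm, Matrix.mul_assoc, hU', Matrix.mul_one]

/-- A graph cospectral with a triangle has three vertices and three edges. -/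
theorem determinedBySpectrum_friendshipGraph_one : DeterminedBySpectrum (friendshipGraph 1) := by
  classical
  intro W _ H hH
  have htop : ∀ x y, x ≠ y → (friendshipGraph 1).Adj x y := by
    rintro (_ | x) (_ | y) hne
    · exact absurd rfl hne
    · exact friendshipGraph_adj_none y
    · exact (friendshipGraph_adj_none x).symm
    · rw [friendshipGraph_adj_some]
      refine ⟨Subsingleton.elim _ _, fun h => hne ?_⟩
      rw [Prod.ext (Subsingleton.elim _ _) h]
  have hcard : Fintype.card W = 3 := by
    rw [← card_adjSpectrum H, ← hH, card_adjSpectrum]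
    rfl
  have hsum : ∑ v, (H.degree v : ℝ) = 6 := by
    rw [← sum_sq_adjSpectrum, ← hH, sum_sq_adjSpectrum]
    have : ∀ v, (friendshipGraph 1).degree v = 2 := by
      intro v
      have : (friendshipGraph 1).neighborFinset v = Finset.univ.erase v := by
        ext w
        simp only [SimpleGraph.mem_neighborFinset, Finset.mem_erase, Finset.mem_univ, and_true]
        exact ⟨fun h => h.ne', fun h => htop v w h.symm⟩
      rw [← SimpleGraph.card_neighborFinset_eq_degree, this,
        Finset.card_erase_of_mem (Finset.mem_univ _)]
      rfl
    simp only [this, Finset.sum_const, Finset.card_univ]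
    norm_num
  have hle : ∀ v, H.degree v ≤ 2 := fun v => by
    have := H.degree_lt_card_verts v
    omega
  have heq : ∀ v, H.degree v = 2 := by
    have h1 : ∑ v, H.degree v = ∑ _v : W, 2 := by
      rw [Finset.sum_const, Finset.card_univ, hcard]
      exact_mod_cast hsum
    intro v
    exact (Finset.sum_eq_sum_iff_of_le fun v _ => hle v).mp h1 v (Finset.mem_univ v)
  have hall : ∀ x y, x ≠ y → H.Adj x y := by
    intro x y hxy
    have hsub : H.neighborFinset x ⊆ Finset.univ.erase x := fun w hw => by
      rw [SimpleGraph.mem_neighborFinset] at hw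
      simp [hw.ne']
    have := Finset.eq_of_subset_of_card_le hsub (by
      rw [Finset.card_erase_of_mem (Finset.mem_univ _), Finset.card_univ, hcard,
        SimpleGraph.card_neighborFinset_eq_degree, heq])
    rw [← SimpleGraph.mem_neighborFinset, this]
    simp [hxy.symm]
  obtain ⟨e⟩ : Nonempty (Option (Fin 1 × Bool) ≃ W) := Fintype.card_eq.mp (by rw [hcard]; rfl)
  exact ⟨⟨e, fun {x y} => ⟨fun h => htop x y fun hxy => h.ne (congrArg e hxy),
    fun h => hall _ _ (e.injective.ne h.ne)⟩⟩⟩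

theorem determinedBySpectrum_friendshipGraph_iff {k : ℕ} (hk : 1 ≤ k) :
    DeterminedBySpectrum (friendshipGraph k) ↔ k ≠ 16 := by
  constructor
  · rintro hds rfl
    exact Shape.Rep.not_determinedBySpectrum (c := .two 1 16) (c' := .six 3 5) (t := 10)
      (by simp [Shape.Valid]) (rep_friendshipGraph 16) (connected_friendshipGraph 16)
      (by simp [Shape.Valid]) rfl rfl (by simp) rfl hds
  · intro hne
    rcases hk.eq_or_lt with rfl | hk
    · exact determinedBySpectrum_friendshipGraph_one
    · exact Shape.Rep.determinedBySpectrum (c := .two 1 k) ⟨le_rfl, hk⟩ (rep_friendshipGraph k)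
        (by simp [Shape.Exceptional, hne])

theorem mainTheorem4 :
    -- the graphs in `𝒢` that are determined by their spectrum
    (∀ (V : Type*) [Fintype V] (G : SimpleGraph V), InClassG G →
      (DeterminedBySpectrum G ↔
        ¬ ((Nonempty (G ≃g typeII 1 16) ∨ Nonempty (G ≃g typeII 2 7)) ∨
           (∃ k : ℕ, 2 ≤ k ∧ ¬ k.Prime ∧ Nonempty (G ≃g typeII 2 k)) ∨
           (∃ l m : ℕ, 2 ≤ m ∧ m ≤ l ∧ Nonempty (G ≃g typeIII l m) ∧
              ∃ d : ℕ, d ∣ l * m ∧ m < d ∧ d < l) ∨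
           (Nonempty (G ≃g typeIVa) ∨ Nonempty (G ≃g typeIVb))))) ∧
    -- the friendship graphs
    (∀ k : ℕ, 1 ≤ k → (DeterminedBySpectrum (friendshipGraph k) ↔ k ≠ 16)) ∧
    -- the cospectral mate of `F_16`
    (InClassG (typeVI 3 5) ∧
      Cospectral (friendshipGraph 16) (typeVI 3 5 ⊕g disjointEdges 10)) := by
  refine ⟨fun V _ G hG => determinedBySpectrum_iff hG,
    fun k hk => determinedBySpectrum_friendshipGraph_iff hk, ?_, ?_⟩
  · obtain ⟨r, s, M, h1, h2, -, -, h3, h4⟩ := hasSpectralType_typeVI_three_five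
    exact ⟨connected_typeVI (by norm_num) (by norm_num), r, s, M, h1, h2, h3, h4⟩
  · have h := (rep_friendshipGraph 16).hasSpectralType (by simp [Shape.Valid])
    refine h.cospectral ?_ rfl
    have := hasSpectralType_typeVI_three_five.sum (adjSpectrum_disjointEdges 10)
    convert this using 1 <;> simp [Shape.tr, Shape.dt]
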